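/- **Theorem 4.8.** Let $d,\alpha\ge 1$ be integers, $\beta>0$, $1\le q<\infty$, $\eta>0$, $\epsilon\in(0,2-1/\alpha)$, $0<c_1\le c_2$ and $0<c_3\le c_4$. There is a constant $C$, depending only on $\alpha,\beta,\eta,d,q,\epsilon$ and $c_1,c_2,c_3,c_4$, such that the following holds for every $1\le p\le\infty$. Let $f:\mathbb{R}^d\to[0,\infty)$ be a probability density with continuous mixed partial derivatives $f^{(\tau)}$, $\tau\in\{0,\dots,\alpha\}^d$, such that $$\|f\|_{\alpha,\beta,p,q}:=\sup_{x\in\mathbb{R}^d,\ \tau\in\{0,\dots,\alpha\}^d}\bigl|e^{\beta\|x\|_p^q}f^{(\tau)}(x)\bigr|<\infty$$ and $$\|f\|_\alpha^2:=\sum_{u\subseteq\{1,\dots,d\}}\int_{\mathbb{R}^{|u|}}\Bigl(\int_{\mathbb{R}^{d-|u|}}|\partial_u^\alpha f(x)|\,dx_{-u}\Bigr)^2dx_u<\infty,\qquad \partial_u^\alpha=\prod_{j\in u}\partial_{x_j}^{\alpha},$$ and put $\|f\|_{\max}=\max\{\|f\|_{\alpha,\beta,p,q},\|f\|_\alpha\}$.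 Let $M\ge\max\{2,\ e^2/\eta,\ e^{2^{1-q}\beta}/\eta\}$ be an integer and let $Y_1,\dots,Y_M$ be independent random vectors with density $f$. Put $$\tau^*=\tfrac1{2\alpha}+\tfrac\epsilon2,\qquad a=\Bigl[\tfrac1{2\beta}\log(\eta M)\Bigr]^{1/q},$$ and let $\lambda$ be a real number and $N$ a prime with $$c_1M^{-1/(1+\tau^*)}\le\lambda\le c_2M^{-1/(1+\tau^*)},\qquad c_3M^{1/(\alpha-\epsilon)}\le N\le c_4M^{1/(\alpha-\epsilon)}.$$ *Korobov space on $[-a,a]^d$.* For $h\in\mathbb{Z}^d$ let $\varphi_h(x)=\prod_{j}(2a)^{-1/2}e^{2\pi i h_j(x_j+a)/(2a)}$ and $r(h)=\prod_j r(h_j)$ with $r(0)=\sqrt{2a}$ and $r(m)=|\pi m/a|^\alpha$ for $m\ne0$. Let $\hat g(h)=\int_{[-a,a]^d}g\,\overline{\varphi_h}$, $\langle g,v\rangle_K=\sum_h\hat g(h)\overline{\hat v(h)}\,r(h)^2$ and $K(x,y)=\sum_h r(h)^{-2}\varphi_h(x)\overline{\varphi_h(y)}$. *Lattice points.* Let $z\in\{1,\dots,N-1\}^d$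 be a generating vector obtained by the component-by-component construction: for $s=1,\dots,d$ in turn, with $z_1,\dots,z_{s-1}$ kept, $z_s$ minimizes over $\{1,\dots,N-1\}$ the criterion $$S_s(z_1,\dots,z_s)=\sum_{h\in\mathbb{Z}^s}\ \sum_{\substack{\ell\in\mathbb{Z}^s\setminus\{0\}\\ \ell\cdot z\equiv0\ (\mathrm{mod}\ N)}}\frac1{\rho(h)\,\rho(h+\ell)},\qquad \rho(h)=\prod_{h_j\ne0}|2\pi h_j|^{2\alpha}.$$ Let $x_k=2a\{kz/N\}-(a,\dots,a)$ for $k=1,\dots,N$ (fractional parts taken componentwise) and let $V_N$ be the span of the functions $K(x_k,\cdot)$. *Estimator.* Let $\widetilde Y_m\in[-a,a)^d$ be congruent to $Y_m$ modulo $2a$ in each coordinate. Then there is exactly one $\widetilde f^\lambda\in V_N$ with $$\langle\widetilde f^\lambda,v\rangle_{L^2([-a,a]^d)}+\lambda\langle\widetilde f^\lambda,v\rangle_K=\frac1M\sum_{m=1}^Mv(\widetilde Y_m)\qquad\text{for all }v\in V_N,$$ and the PSKK estimator $f^\lambda_Y$, equal to $\max\{\widetilde f^\lambda,0\}$ on $[-a,a]^d$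 and to $0$ elsewhere, satisfies $$\mathbb{E}\int_{\mathbb{R}^d}|f^\lambda_Y(x)-f(x)|^2\,dx\ \le\ C\,\|f\|_{\max}^2\,|\log M|^{2(\alpha+1)d/q}\,M^{-\frac1{1+1/(2\alpha)+\epsilon/2}}.$$ -/

import Mathlib

open MeasureTheory ProbabilityTheory
open scoped ENNReal

noncomputable section

namespace PSKK

/-! ### Mixed partial derivatives and the class of densities -/

/-- The partial derivative of `g` in the `j`-th variable. -/
def partialDeriv {d : ℕ} (j : Fin d) (g : (Fin d → ℝ) → ℝ) (x : Fin d → ℝ) : ℝ :=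
  deriv (fun t : ℝ => g (Function.update x j t)) (x j)

/-- The mixed partial derivative `g^(τ)`, differentiated `τ j` times in the `j`-th variable. -/
def mixedDeriv {d : ℕ} (τ : Fin d → ℕ) (g : (Fin d → ℝ) → ℝ) : (Fin d → ℝ) → ℝ :=
  (List.finRange d).foldr (fun j h => (partialDeriv j)^[τ j] h) g

/-- `g` has continuous mixed partial derivatives up to order `α` in each variable: every
`g^(τ)` with `τ ∈ {0,…,α}^d` is continuous, and as long as `τ j < α` it is really differentiable
in the `j`-th variable, with derivative `g^(τ + e_j)`. -/
def HasContMixedDerivs {d : ℕ} (α : ℕ) (g : (Fin d → ℝ) → ℝ) : Prop :=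
  ∀ τ : Fin d → ℕ, (∀ j, τ j ≤ α) →
    Continuous (mixedDeriv τ g) ∧
      ∀ j, τ j < α → ∀ x : Fin d → ℝ,
        HasDerivAt (fun t : ℝ => mixedDeriv τ g (Function.update x j t))
          (mixedDeriv (τ + Pi.single j 1) g x) (x j)

/-- The `ℓ_p` norm on `ℝ^d`, `1 ≤ p ≤ ∞`. -/
def lpNorm {d : ℕ} (p : ℝ≥0∞) (x : Fin d → ℝ) : ℝ :=
  ‖(WithLp.toLp p x : PiLp p (fun _ : Fin d => ℝ))‖

/-- The exponential decay norm
`‖g‖_{α,β,p,q} = sup_{x, τ ∈ {0,…,α}^d} |exp(β ‖x‖_p^q) g^(τ)(x)|`, possibly `∞`. -/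
def expDecayNorm {d : ℕ} (α : ℕ) (β : ℝ) (p : ℝ≥0∞) (q : ℝ) (g : (Fin d → ℝ) → ℝ) : ℝ≥0∞ :=
  ⨆ (τ : Fin d → ℕ) (_ : ∀ j, τ j ≤ α) (x : Fin d → ℝ),
    ENNReal.ofReal |Real.exp (β * lpNorm p x ^ q) * mixedDeriv τ g x|

/-- The point of `ℝ^d` with coordinates `y` on `u` and `w` off `u`. -/
def glue {d : ℕ} (u : Finset (Fin d)) (y : {i // i ∈ u} → ℝ) (w : {i // i ∉ u} → ℝ) :
    Fin d → ℝ :=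
  fun i => if h : i ∈ u then y ⟨i, h⟩ else w ⟨i, h⟩

/-- The norm `‖g‖_α`, possibly `∞`, with
`‖g‖_α² = ∑_u ∫_{ℝ^|u|} (∫_{ℝ^(d-|u|)} |∂_u^α g(x)| dx_{-u})² dx_u`. -/
def alphaNorm {d : ℕ} (α : ℕ) (g : (Fin d → ℝ) → ℝ) : ℝ≥0∞ :=
  (∑ u : Finset (Fin d), ∫⁻ y : {i // i ∈ u} → ℝ,
    (∫⁻ w : {i // i ∉ u} → ℝ,
      ENNReal.ofReal |mixedDeriv (fun i => if i ∈ u then α else 0) g (glue u y w)|) ^ 2)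
    ^ (1 / 2 : ℝ)

/-- The class `S^α_{β,p,q}`. -/
structure MemS {d : ℕ} (α : ℕ) (β : ℝ) (p : ℝ≥0∞) (q : ℝ) (g : (Fin d → ℝ) → ℝ) : Prop where
  smooth : HasContMixedDerivs α g
  expDecay : expDecayNorm α β p q g < ⊤
  alphaNorm_lt_top : alphaNorm α g < ⊤

/-- `‖g‖_max = max {‖g‖_{α,β,p,q}, ‖g‖_α}`. -/
def maxNorm {d : ℕ} (α : ℕ) (β : ℝ) (p : ℝ≥0∞) (q : ℝ) (g : (Fin d → ℝ) → ℝ) : ℝ≥0∞ :=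
  max (expDecayNorm α β p q g) (alphaNorm α g)

/-! ### The Korobov space on the box `[-a,a]^d` -/

/-- The box `[-a,a]^d`. -/
def box (d : ℕ) (a : ℝ) : Set (Fin d → ℝ) := Set.Icc (fun _ => -a) (fun _ => a)

/-- The orthonormal trigonometric functions `φ_{a,d,h}` on the box. -/
def trig {d : ℕ} (a : ℝ) (h : Fin d → ℤ) (x : Fin d → ℝ) : ℂ :=
  ∏ j, ((1 / Real.sqrt (2 * a) : ℝ) : ℂ) *
    Complex.exp (2 * Real.pi * Complex.I * (h j : ℂ) * (((x j + a) / (2 * a) : ℝ) : ℂ))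

/-- The factors `r_{α,a,d}(h)`. -/
def rBox {d : ℕ} (α : ℕ) (a : ℝ) (h : Fin d → ℤ) : ℝ :=
  ∏ j, if h j = 0 then Real.sqrt (2 * a) else |Real.pi * (h j : ℝ) / a| ^ α

/-- The Fourier coefficient of `g` with respect to `φ_{a,d,h}`. -/
def fourierCoeffBox {d : ℕ} (a : ℝ) (g : (Fin d → ℝ) → ℝ) (h : Fin d → ℤ) : ℂ :=
  ∫ x in box d a, (g x : ℂ) * (starRingEnd ℂ) (trig a h x)

/-- The inner product of the Korobov space on the box. The series is real, because the
coefficients of real functions at `h` and `-h` are conjugate. -/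
def korobovInner {d : ℕ} (α : ℕ) (a : ℝ) (g v : (Fin d → ℝ) → ℝ) : ℝ :=
  (∑' h : Fin d → ℤ, fourierCoeffBox a g h * (starRingEnd ℂ) (fourierCoeffBox a v h) *
    ((rBox α a h ^ 2 : ℝ) : ℂ)).re

/-- The reproducing kernel `K_{α,a,d}` of the Korobov space on the box (a real series). -/
def korobovKernel {d : ℕ} (α : ℕ) (a : ℝ) (x y : Fin d → ℝ) : ℝ :=
  (∑' h : Fin d → ℤ, (((rBox α a h ^ 2)⁻¹ : ℝ) : ℂ) * trig a h x *
    (starRingEnd ℂ) (trig a h y)).re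

/-! ### Component-by-component lattice points -/

/-- The squared factors `r_{α,s}(h)²` of the Korobov space on the unit cube. -/
def rUnitSq {s : ℕ} (α : ℕ) (h : Fin s → ℤ) : ℝ :=
  ∏ j, if h j = 0 then 1 else |2 * Real.pi * (h j : ℝ)| ^ (2 * α)

/-- The search criterion for lattice algorithms for `L²` approximation in the Korobov space on the
unit cube,
`S_s(z) = ∑_h r(h)⁻² ∑_{ℓ ≠ 0, ℓ·z ≡ 0 (mod N)} r(h+ℓ)⁻²`. -/
def latticeCriterion {s : ℕ} (α N : ℕ) (z : Fin s → ℕ) : ℝ :=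
  ∑' h : Fin s → ℤ, (rUnitSq α h)⁻¹ *
    ∑' l : {l : Fin s → ℤ // l ≠ 0 ∧ (N : ℤ) ∣ ∑ j, l j * (z j : ℤ)},
      (rUnitSq α (h + l.1))⁻¹

/-- The first `s` components of `z`, up to and including the component number `s` (from 0). -/
def initial {d : ℕ} (s : Fin d) (z : Fin d → ℕ) : Fin (s.1 + 1) → ℕ :=
  fun i => z (Fin.castLE s.2 i)

/-- `z` is a generating vector found by the component-by-component construction: one component
after the other is chosen in `{1,…,N-1}` so as to minimize the criterion of the components chosen
so far, the earlier ones being kept. (For the product weights of this space the contribution of the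
frequencies `ℓ` with last component nonzero, which is what the algorithm for general weights
minimizes up to a positive factor, differs from the criterion by a term that does not depend on the
component being chosen, so that the minimizers are the same.) -/
def IsCBCVector {d : ℕ} (α N : ℕ) (z : Fin d → ℕ) : Prop :=
  ∀ s : Fin d, z s ∈ Finset.Icc 1 (N - 1) ∧
    ∀ c ∈ Finset.Icc 1 (N - 1),
      latticeCriterion α N (initial s z) ≤
        latticeCriterion α N (initial s (Function.update z s c))

/-- The scaled lattice points `x_k = 2a {k z / N} - a`. -/
def latticePoint {d : ℕ} (a : ℝ) (N : ℕ) (z : Fin d → ℕ) (k : ℕ) : Fin d → ℝ :=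
  fun j => 2 * a * Int.fract ((k : ℝ) * (z j : ℝ) / (N : ℝ)) - a

/-! ### The estimator -/

/-- The trial space `V_N`, the span of the functions `K_{α,a,d}(x_k, ·)`, `k = 1,…,N`. -/
def trialSpace {d : ℕ} (α : ℕ) (a : ℝ) (N : ℕ) (z : Fin d → ℕ) :
    Submodule ℝ ((Fin d → ℝ) → ℝ) :=
  Submodule.span ℝ ((fun k : ℕ => korobovKernel α a (latticePoint a N z k)) '' Set.Icc 1 N)

/-- Componentwise reduction modulo `2a` to the representative in `[-a,a)`. -/
def wrap {d : ℕ} (a : ℝ) (y : Fin d → ℝ) : Fin d → ℝ :=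
  fun j => y j - 2 * a * (⌊(y j + a) / (2 * a)⌋ : ℝ)

/-- `g` solves the regularized least squares problem in `V_N` for the sample `y`:
`⟨g,v⟩_{L²([-a,a]^d)} + lam ⟨g,v⟩_K = (1/M) ∑_m v(y_m)` for all `v ∈ V_N`. -/
def IsRidgeSolution {d M : ℕ} (α : ℕ) (a lam : ℝ) (N : ℕ) (z : Fin d → ℕ)
    (y : Fin M → Fin d → ℝ) (g : (Fin d → ℝ) → ℝ) : Prop :=
  g ∈ trialSpace α a N z ∧
    ∀ v ∈ trialSpace α a N z,
      (∫ x in box d a, g x * v x) + lam * korobovInner α a g v = (1 / (M : ℝ)) * ∑ m, v (y m)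

open scoped Classical in
/-- Clipping at zero and truncation to the box. -/
def clip {d : ℕ} (a : ℝ) (g : (Fin d → ℝ) → ℝ) (x : Fin d → ℝ) : ℝ :=
  if x ∈ box d a then max (g x) 0 else 0

end PSKK

end

/-! The functions `trig a h` are 2a-periodic, so the wrapped sample has the Fourier coefficients of
the periodization of `f`. These are `c h = fullCoeff a f h`, integrals over all of `ℝ^d`. Hence
`empCoeff` is an unbiased estimate of `c`, with mean squared error at most 1/M at every frequency.

In Fourier coordinates, with weights `W h = 1 + lam * r(h)²`, the ridge equation says that the
solution is the orthogonal projection, in the W-weighted ℓ² space, of the sequence `W⁻¹ * empCoeff`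
onto the finite-dimensional trial space. Existence, uniqueness and a quasi-optimal error bound all
follow from this (`exists_ridgeSolution`). The error has four sources.

Variance: its expectation is at most `(1/M) ∑ W⁻¹`, and `exists_tsum_ridgeWeight_inv_le` bounds the
sum by a multiple of `lam^(-τ)`, because 2ατ > 1. Regularization bias: `lam` times the squared
Korobov norm of `c`. The prescribed size of `lam` balances these two at `M^(-1/(1+τ))`.

Approximation: the residual of the Korobov projection of `c` onto the trial space vanishes at the
lattice points. Each of its coefficients is therefore minus the sum of the others over its coset of
the dual lattice, and Cauchy-Schwarz with a frequency cutoff B gives the factor `B⁻¹ + B * S(z)`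
(`tsum_norm_sq_le_of_vanish`). An averaging argument over the candidates of the
component-by-component search gives `S(z) = O(N^(-r))` for 1 ≤ r < 2α
(`exists_latticeCriterion_le`), and the size of N then makes this error O(1/M).

Truncation: outside the box `f` is small by its exponential decay. This controls both the mass lost
there and the wrap-around error in the coefficients.

The Korobov norm of `c` is bounded by integrating by parts over the whole space, where no boundary
terms occur, followed by a Bessel inequality for decaying functions (`tsum_norm_fullCoeff_sq_le`).
The constants grow like powers of 2a, which become the logarithmic factor. -/

noncomputable section

namespace PSKK

/-! ### Parseval's identity on the box -/

section Torus

attribute [local instance] instMeasureSpaceUnitAddCircle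

/-- The chart of the circle `ℝ / ℤ` with values in `(-a, a]`. -/
def circleChart (a : ℝ) (t : UnitAddCircle) : ℝ := 2 * a * (AddCircle.equivIoc 1 0 t).1 - a

/-- The chart of the torus with values in `(-a, a]^d`. -/
def torusChart {d : ℕ} (a : ℝ) (t : UnitAddTorus (Fin d)) : Fin d → ℝ :=
  fun j => circleChart a (t j)

lemma measurable_circleChart (a : ℝ) : Measurable (circleChart a) := by
  have h : Measurable fun t : UnitAddCircle => (AddCircle.measurableEquivIoc 1 0 t : ℝ) :=
    measurable_subtype_coe.comp (AddCircle.measurableEquivIoc 1 0).measurable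
  exact (h.const_mul (2 * a)).sub_const a

/-- The circle carries the image of Lebesgue measure on the fundamental domain `Ioc 0 1`, where the
chart is the affine map x ↦ 2ax − a. Closing the interval adds a null set. -/
lemma measurePreserving_circleChart {a : ℝ} (ha : 0 < a) :
    MeasurePreserving (circleChart a) (volume : Measure UnitAddCircle)
      (ENNReal.ofReal (2 * a)⁻¹ • volume.restrict (Set.Icc (-a) a)) := by
  refine ⟨measurable_circleChart a, ?_⟩
  have h1 : (volume : Measure UnitAddCircle)
      = (volume.restrict (Set.Ioc (0 : ℝ) (0 + 1))).map (QuotientAddGroup.mk) := by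
    have := (AddCircle.measurePreserving_mk 1 0).map_eq
    rw [this, AddCircle.volume_eq_smul_haarAddCircle]
    simp [volume]
  have h2 : (volume : Measure ℝ).map (fun x => 2 * a * x - a)
      = ENNReal.ofReal (2 * a)⁻¹ • volume := by
    have e : (fun x : ℝ => 2 * a * x - a) = (fun x => -a + x) ∘ fun x => 2 * a * x := by
      ext x; simp; ring
    rw [e, ← Measure.map_map (by fun_prop) (by fun_prop), Real.map_volume_mul_left (by positivity),
      Measure.map_smul, (measurePreserving_add_left volume (-a)).map_eq,
      abs_of_pos (by positivity)]
  rw [h1, Measure.map_map (measurable_circleChart a) AddCircle.measurable_mk']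
  have h3 : (volume.restrict (Set.Ioc (0 : ℝ) (0 + 1))).map
      (circleChart a ∘ (QuotientAddGroup.mk : ℝ → UnitAddCircle))
      = (volume.restrict (Set.Ioc (0 : ℝ) (0 + 1))).map (fun x => 2 * a * x - a) := by
    refine Measure.map_congr ?_
    filter_upwards [ae_restrict_mem measurableSet_Ioc] with x hx
    simp only [Function.comp, circleChart]
    rw [show ((QuotientAddGroup.mk x : UnitAddCircle)) = ((x : ℝ) : UnitAddCircle) from rfl,
      AddCircle.equivIoc_coe_eq hx]
  rw [h3, show Set.Ioc (0 : ℝ) (0 + 1) = (fun x => 2 * a * x - a) ⁻¹' Set.Ioc (-a) a by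
    ext x
    simp only [Set.mem_Ioc, Set.mem_preimage, zero_add]
    constructor
    · rintro ⟨h, h'⟩; constructor <;> nlinarith
    · rintro ⟨h, h'⟩; constructor <;> by_contra! hc <;> nlinarith,
    ← Measure.restrict_map (by fun_prop) measurableSet_Ioc, h2, Measure.restrict_smul,
    restrict_Ioc_eq_restrict_Icc]

lemma measurePreserving_torusChart {d : ℕ} {a : ℝ} (ha : 0 < a) :
    MeasurePreserving (torusChart (d := d) a) volume
      (ENNReal.ofReal ((2 * a)⁻¹ ^ d) • volume.restrict (box d a)) := by
  have : IsFiniteMeasure ((volume : Measure ℝ).restrict (Set.Icc (-a) a)) := by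
    infer_instance
  have : IsFiniteMeasure (ENNReal.ofReal (2 * a)⁻¹ • (volume : Measure ℝ).restrict
      (Set.Icc (-a) a)) := Measure.smul_finite _ ENNReal.ofReal_ne_top
  have h := measurePreserving_pi (fun _ : Fin d => (volume : Measure UnitAddCircle))
    (fun _ : Fin d => ENNReal.ofReal (2 * a)⁻¹ • (volume : Measure ℝ).restrict (Set.Icc (-a) a))
    (fun _ => measurePreserving_circleChart ha)
  refine ⟨h.measurable, ?_⟩
  refine h.map_eq.trans (Measure.pi_eq fun s hs => ?_)
  have e : box d a = Set.univ.pi fun _ => Set.Icc (-a) a := by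
    rw [Set.pi_univ_Icc]; rfl
  rw [e, Measure.smul_apply, Measure.restrict_apply (MeasurableSet.univ_pi hs), ← Set.pi_inter_distrib,
    volume_pi_pi]
  simp only [Measure.smul_apply, smul_eq_mul, Finset.prod_mul_distrib, Finset.prod_const,
    Finset.card_univ, Fintype.card_fin]
  rw [ENNReal.ofReal_pow (by positivity)]
  congr 1
  exact Finset.prod_congr rfl fun i _ => (Measure.restrict_apply (hs i)).symm

lemma integral_torusChart {d : ℕ} {a : ℝ} (ha : 0 < a) (F : (Fin d → ℝ) → ℂ)
    (hF : AEStronglyMeasurable F (volume.restrict (box d a))) :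
    ∫ t : UnitAddTorus (Fin d), F (torusChart a t) = ((2 * a)⁻¹ ^ d : ℝ) * ∫ x in box d a, F x := by
  have h := measurePreserving_torusChart (d := d) ha
  rw [← integral_map (φ := torusChart a) h.measurable.aemeasurable, h.map_eq, integral_smul_measure,
    ENNReal.toReal_ofReal (by positivity), Complex.real_smul]
  rw [h.map_eq]
  exact hF.smul_measure _

/-- The factor converts between normalization for total mass one on the torus and for Lebesgue
measure on the box. -/
lemma mFourier_eq_trig {d : ℕ} {a : ℝ} (ha : 0 < a) (h : Fin d → ℤ) (t : UnitAddTorus (Fin d)) :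
    UnitAddTorus.mFourier h t = (Real.sqrt (2 * a) : ℂ) ^ d * trig a h (torusChart a t) := by
  have hs : (Real.sqrt (2 * a) : ℂ) ≠ 0 := by
    exact_mod_cast (Real.sqrt_pos.2 (by positivity)).ne'
  have key : ∀ j, fourier (h j) (t j) = (Real.sqrt (2 * a) : ℂ) *
      (((1 / Real.sqrt (2 * a) : ℝ) : ℂ) * Complex.exp (2 * Real.pi * Complex.I * (h j : ℂ) *
        (((torusChart a t j + a) / (2 * a) : ℝ) : ℂ))) := by
    intro j
    have e : (torusChart a t j + a) / (2 * a) = (AddCircle.equivIoc 1 0 (t j)).1 := by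
      simp only [torusChart, circleChart]; field_simp; ring
    rw [e]
    conv_lhs => rw [show t j = (((AddCircle.equivIoc 1 0 (t j)).1 : ℝ) : UnitAddCircle) from
      (AddCircle.coe_equivIoc).symm]
    rw [fourier_coe_apply]
    push_cast
    rw [← mul_assoc, mul_one_div_cancel hs, one_mul, div_one]
  simp only [UnitAddTorus.mFourier, ContinuousMap.coe_mk, trig]
  rw [Finset.prod_congr rfl fun j _ => key j, Finset.prod_mul_distrib]
  simp

end Torus

lemma trig_continuous {d : ℕ} (a : ℝ) (h : Fin d → ℤ) : Continuous (trig a h) := by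
  unfold trig; fun_prop

lemma norm_trig {d : ℕ} (a : ℝ) (h : Fin d → ℤ) (x : Fin d → ℝ) :
    ‖trig a h x‖ = (1 / Real.sqrt (2 * a)) ^ d := by
  have : ∀ j, ‖((1 / Real.sqrt (2 * a) : ℝ) : ℂ) *
    Complex.exp (2 * Real.pi * Complex.I * (h j : ℂ) * (((x j + a) / (2 * a) : ℝ) : ℂ))‖
      = 1 / Real.sqrt (2 * a) := by
    intro j
    have e : (2 * Real.pi * Complex.I * (h j : ℂ) * (((x j + a) / (2 * a) : ℝ) : ℂ))
        = ((2 * Real.pi * (h j : ℝ) * ((x j + a) / (2 * a)) : ℝ) : ℂ) * Complex.I := by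
      push_cast; ring
    rw [norm_mul, e, Complex.norm_exp_ofReal_mul_I, mul_one, Complex.norm_real, Real.norm_eq_abs,
      abs_of_nonneg (by positivity)]
  rw [trig, norm_prod, Finset.prod_congr rfl fun j _ => this j]
  simp

lemma norm_trig_le_one {d : ℕ} {a : ℝ} (ha : 1 ≤ 2 * a) (h : Fin d → ℤ) (x : Fin d → ℝ) :
    ‖trig a h x‖ ≤ 1 := by
  rw [norm_trig]
  refine pow_le_one₀ (by positivity) ?_
  rw [div_le_one (Real.sqrt_pos.2 (by linarith))]
  exact Real.one_le_sqrt.2 ha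

lemma trig_neg {d : ℕ} (a : ℝ) (h : Fin d → ℤ) (x : Fin d → ℝ) :
    trig a (-h) x = (starRingEnd ℂ) (trig a h x) := by
  simp only [trig, map_prod, map_mul, Complex.conj_ofReal, ← Complex.exp_conj, Complex.conj_I,
    Pi.neg_apply, map_intCast, map_ofNat]
  refine Finset.prod_congr rfl fun j _ => ?_
  push_cast
  ring_nf

lemma trig_add_period {d : ℕ} {a : ℝ} (ha : 0 < a) (h n : Fin d → ℤ) (x : Fin d → ℝ) :
    trig a h (fun j => x j + 2 * a * n j) = trig a h x := by
  unfold trig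
  refine Finset.prod_congr rfl fun j _ => ?_
  congr 1
  rw [Complex.exp_eq_exp_iff_exists_int]
  refine ⟨h j * n j, ?_⟩
  have : (a : ℂ) ≠ 0 := by exact_mod_cast ha.ne'
  push_cast
  field_simp
  ring

lemma trig_wrap {d : ℕ} {a : ℝ} (ha : 0 < a) (h : Fin d → ℤ) (x : Fin d → ℝ) :
    trig a h (wrap a x) = trig a h x := by
  rw [← trig_add_period ha h (fun j => -⌊(x j + a) / (2 * a)⌋) x]
  congr 1
  ext j
  simp only [wrap]
  push_cast
  ring

lemma isCompact_box (d : ℕ) (a : ℝ) : IsCompact (box d a) := isCompact_Icc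

lemma measurableSet_box (d : ℕ) (a : ℝ) : MeasurableSet (box d a) := measurableSet_Icc

instance isFiniteMeasure_box (d : ℕ) (a : ℝ) :
    IsFiniteMeasure ((volume : Measure (Fin d → ℝ)).restrict (box d a)) :=
  ⟨by simpa using (isCompact_box d a).measure_lt_top⟩

lemma volume_box {d : ℕ} {a : ℝ} (ha : 0 < a) : volume (box d a) = ENNReal.ofReal ((2 * a) ^ d) := by
  rw [box, Real.volume_Icc_pi]
  rw [ENNReal.ofReal_pow (by positivity)]
  simp [two_mul]

section Torus

attribute [local instance] instMeasureSpaceUnitAddCircle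

lemma integral_trig_mul_conj {d : ℕ} {a : ℝ} (ha : 0 < a) (h k : Fin d → ℤ) :
    ∫ x in box d a, trig a h x * (starRingEnd ℂ) (trig a k x) = if h = k then 1 else 0 := by
  have h1 := orthonormal_iff_ite.1 (UnitAddTorus.orthonormal_mFourier (d := Fin d)) k h
  rw [ContinuousMap.inner_toLp] at h1
  have hs : ((Real.sqrt (2 * a) : ℂ) ^ d) * (Real.sqrt (2 * a) : ℂ) ^ d = ((2 * a) ^ d : ℝ) := by
    rw [← mul_pow, ← Complex.ofReal_mul, Real.mul_self_sqrt (by positivity)]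
    push_cast; rfl
  have h2 : ∀ t : UnitAddTorus (Fin d),
      UnitAddTorus.mFourier h t * (starRingEnd ℂ) (UnitAddTorus.mFourier k t)
      = (((2 * a) ^ d : ℝ) : ℂ) * (fun x => trig a h x * (starRingEnd ℂ) (trig a k x))
        (torusChart a t) := by
    intro t
    simp only [mFourier_eq_trig ha, map_mul, map_pow, Complex.conj_ofReal]
    rw [← hs]; ring
  simp only [h2] at h1
  have h3 := integral_torusChart ha (fun x => trig a h x * (starRingEnd ℂ) (trig a k x))
    ((trig_continuous a h).mul (trig_continuous a k).star).aestronglyMeasurable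
  rw [integral_const_mul, h3, ← mul_assoc, ← Complex.ofReal_mul, inv_pow, mul_inv_cancel₀ (by positivity),
    Complex.ofReal_one, one_mul] at h1
  rw [h1]
  simp only [eq_comm]

lemma mFourierCoeff_torusChart {d : ℕ} {a : ℝ} (ha : 0 < a) (G : (Fin d → ℝ) → ℝ)
    (hG : AEStronglyMeasurable G (volume.restrict (box d a))) (h : Fin d → ℤ) :
    UnitAddTorus.mFourierCoeff (fun t => (G (torusChart a t) : ℂ)) h
      = ((Real.sqrt (2 * a)) ^ d * (2 * a)⁻¹ ^ d : ℝ) * fourierCoeffBox a G h := by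
  rw [UnitAddTorus.mFourierCoeff]
  have h2 : ∀ t : UnitAddTorus (Fin d),
      UnitAddTorus.mFourier (-h) t • (G (torusChart a t) : ℂ)
      = ((Real.sqrt (2 * a) ^ d : ℝ) : ℂ) * (fun x => (G x : ℂ) * (starRingEnd ℂ) (trig a h x))
        (torusChart a t) := by
    intro t
    simp only [mFourier_eq_trig ha, smul_eq_mul, trig_neg]
    push_cast; ring
  have h3 := integral_torusChart ha (fun x => (G x : ℂ) * (starRingEnd ℂ) (trig a h x))
    ((Complex.continuous_ofReal.comp_aestronglyMeasurable hG).mul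
      (trig_continuous a h).star.aestronglyMeasurable)
  simp only [h2]
  rw [integral_const_mul, h3, fourierCoeffBox, Complex.ofReal_mul, mul_assoc]

/-- Parseval's identity on the box. -/
theorem hasSum_fourierCoeffBox_mul_conj {d : ℕ} {a : ℝ} (ha : 0 < a) {G₁ G₂ : (Fin d → ℝ) → ℝ}
    (h₁ : MemLp G₁ 2 (volume.restrict (box d a))) (h₂ : MemLp G₂ 2 (volume.restrict (box d a))) :
    HasSum (fun h => fourierCoeffBox a G₁ h * (starRingEnd ℂ) (fourierCoeffBox a G₂ h))
      ((∫ x in box d a, G₁ x * G₂ x : ℝ) : ℂ) := by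
  have hc := measurePreserving_torusChart (d := d) ha
  have mem : ∀ G : (Fin d → ℝ) → ℝ, MemLp G 2 (volume.restrict (box d a)) →
      MemLp (fun t : UnitAddTorus (Fin d) => (G (torusChart a t) : ℂ)) 2 volume := by
    intro G hG
    exact ((hG.smul_measure (c := ENNReal.ofReal ((2 * a)⁻¹ ^ d)) ENNReal.ofReal_ne_top
      ).comp_measurePreserving hc).ofReal
  have key := UnitAddTorus.hasSum_prod_mFourierCoeff ((mem _ h₂).toLp _) ((mem _ h₁).toLp _)
  have coeff : ∀ (G : (Fin d → ℝ) → ℝ) (hG : MemLp G 2 (volume.restrict (box d a))) h,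
      UnitAddTorus.mFourierCoeff (((mem _ hG).toLp _ : Lp ℂ 2 _) : UnitAddTorus (Fin d) → ℂ) h
      = ((Real.sqrt (2 * a)) ^ d * (2 * a)⁻¹ ^ d : ℝ) * fourierCoeffBox a G h := by
    intro G hG h
    rw [← mFourierCoeff_torusChart ha G hG.1]
    refine integral_congr_ae ?_
    filter_upwards [(mem _ hG).coeFn_toLp] with t ht
    rw [ht]
  have hint : ∫ t, (starRingEnd ℂ) (((mem _ h₂).toLp _ : Lp ℂ 2 _) t) * ((mem _ h₁).toLp _) t
      = ((2 * a)⁻¹ ^ d : ℝ) * ((∫ x in box d a, G₁ x * G₂ x : ℝ) : ℂ) := by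
    rw [← integral_complex_ofReal, ← integral_torusChart ha (fun x => ((G₁ x * G₂ x : ℝ) : ℂ))]
    · refine integral_congr_ae ?_
      filter_upwards [(mem _ h₁).coeFn_toLp, (mem _ h₂).coeFn_toLp] with t ht ht'
      rw [ht, ht', Complex.conj_ofReal]; push_cast; ring
    · exact Complex.continuous_ofReal.comp_aestronglyMeasurable (h₁.1.mul h₂.1)
  rw [hint] at key
  simp only [coeff _ h₁, coeff _ h₂, map_mul, Complex.conj_ofReal] at key
  have hs : (Real.sqrt (2 * a)) ^ d * (Real.sqrt (2 * a)) ^ d = (2 * a) ^ d := by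
    rw [← mul_pow, Real.mul_self_sqrt (by positivity)]
  -- Each coefficient carries (2a)^(d/2) (2a)^(-d) and the integral carries (2a)^(-d). The factor
  -- (2a)^d clears both sides.
  have k2 := key.mul_left (((2 * a) ^ d : ℝ) : ℂ)
  have e0 : (2 * a) ^ d * (2 * a)⁻¹ ^ d = 1 := by
    rw [← mul_pow, mul_inv_cancel₀ (by positivity), one_pow]
  rw [← mul_assoc, ← Complex.ofReal_mul, e0, Complex.ofReal_one, one_mul] at k2
  convert! k2 using 2 with h
  have e : (((2 * a) ^ d : ℝ) : ℂ) * ((((Real.sqrt (2 * a)) ^ d * (2 * a)⁻¹ ^ d : ℝ) : ℂ) *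
      (((Real.sqrt (2 * a)) ^ d * (2 * a)⁻¹ ^ d : ℝ) : ℂ)) = 1 := by
    rw [← Complex.ofReal_mul, ← Complex.ofReal_mul, ← Complex.ofReal_one]
    congr 1
    calc _ = (Real.sqrt (2 * a) ^ d * Real.sqrt (2 * a) ^ d) * (2 * a)⁻¹ ^ d *
          ((2 * a) ^ d * (2 * a)⁻¹ ^ d) := by ring
      _ = 1 := by rw [hs, e0, mul_one]
  linear_combination (-(fourierCoeffBox a G₁ h * (starRingEnd ℂ) (fourierCoeffBox a G₂ h))) * e

end Torus

lemma hasSum_norm_fourierCoeffBox_sq {d : ℕ} {a : ℝ} (ha : 0 < a) {G : (Fin d → ℝ) → ℝ}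
    (hG : MemLp G 2 (volume.restrict (box d a))) :
    HasSum (fun h => ‖fourierCoeffBox a G h‖ ^ 2) (∫ x in box d a, G x ^ 2) := by
  have := hasSum_fourierCoeffBox_mul_conj ha hG hG
  simp only [Complex.mul_conj, Complex.normSq_eq_norm_sq, ← pow_two] at this
  exact_mod_cast this

/-! ### Frequency weights and sums over the lattice of integers -/

/-- Tonelli, one coordinate at a time. Working in `ℝ≥0∞` removes every summability condition, so the
frequency sums below are factored there. -/
lemma tsum_pi_prod : ∀ {s : ℕ} (g : Fin s → ℤ → ℝ≥0∞),
    ∑' h : Fin s → ℤ, ∏ j, g j (h j) = ∏ j, ∑' m, g j m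
  | 0, g => by simp
  | s + 1, g => by
    rw [← (Fin.consEquiv fun _ => ℤ).tsum_eq, ENNReal.tsum_prod', Fin.prod_univ_succ,
      ← tsum_pi_prod fun j => g j.succ, ← ENNReal.tsum_mul_right]
    refine tsum_congr fun m => ?_
    rw [← ENNReal.tsum_mul_left]
    refine tsum_congr fun h => ?_
    simp [Fin.consEquiv, Fin.prod_univ_succ]

lemma ofReal_tsum_of_ne_top {ι : Type*} {f : ι → ℝ} (hf : ∀ i, 0 ≤ f i)
    (h : ∑' i, ENNReal.ofReal (f i) ≠ ⊤) :
    Summable f ∧ ENNReal.ofReal (∑' i, f i) = ∑' i, ENNReal.ofReal (f i) := by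
  have hs : Summable f := by
    have := ENNReal.summable_toReal h
    simpa only [ENNReal.toReal_ofReal (hf _)] using this
  exact ⟨hs, ENNReal.ofReal_tsum_of_nonneg hf hs⟩

/-- The embedding of ℓ^t in ℓ^1. With X the sum of the t-th powers, each term is `f i ^ t * (f i ^
t) ^ (1/t - 1)`, and the second factor is at most `X ^ (1/t - 1)`. -/
lemma tsum_le_rpow_tsum_rpow {ι : Type*} (f : ι → ℝ≥0∞) {t : ℝ} (ht : 0 < t) (ht1 : t ≤ 1) :
    ∑' i, f i ≤ (∑' i, f i ^ t) ^ (1 / t) := by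
  set X := ∑' i, f i ^ t
  have h : ∀ i, f i ≤ f i ^ t * X ^ (1 / t - 1) := by
    intro i
    have h0 : 0 ≤ 1 / t - 1 := by
      rw [sub_nonneg, le_div_iff₀ ht]; linarith
    have h1 : f i ^ t ≤ X := ENNReal.le_tsum i
    calc f i = (f i ^ t) ^ (1 : ℝ) * (f i ^ t) ^ (1 / t - 1) := by
          rw [← ENNReal.rpow_add_of_nonneg _ _ zero_le_one h0, ← ENNReal.rpow_mul]
          rw [show t * (1 + (1 / t - 1)) = 1 by field_simp; ring, ENNReal.rpow_one]
      _ ≤ _ := by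
          rw [ENNReal.rpow_one]
          gcongr
  calc ∑' i, f i ≤ ∑' i, f i ^ t * X ^ (1 / t - 1) := ENNReal.tsum_le_tsum h
    _ = X ^ (1 : ℝ) * X ^ (1 / t - 1) := by rw [ENNReal.tsum_mul_right, ENNReal.rpow_one]
    _ = X ^ (1 / t) := by
      have h0 : 0 ≤ 1 / t - 1 := by
        rw [sub_nonneg, le_div_iff₀ ht]; linarith
      rw [← ENNReal.rpow_add_of_nonneg _ _ zero_le_one h0]
      congr 1; ring

/-- The weight `|m|^(-b)`, and `1` at `m = 0`. -/
def polyWeight (b : ℝ) (m : ℤ) : ℝ≥0∞ := if m = 0 then 1 else ENNReal.ofReal (|(m : ℝ)| ^ (-b))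

lemma polyWeight_le_one {b : ℝ} (hb : 0 ≤ b) (m : ℤ) : polyWeight b m ≤ 1 := by
  unfold polyWeight
  split_ifs with h
  · rfl
  · rw [ENNReal.ofReal_le_one]
    refine Real.rpow_le_one_of_one_le_of_nonpos ?_ (by linarith)
    exact_mod_cast Int.one_le_abs h

lemma tsum_polyWeight_ne_top {b : ℝ} (hb : 1 < b) : ∑' m, polyWeight b m ≠ ⊤ := by
  have h1 : ∀ m, polyWeight b m ≤ (if m = 0 then 1 else 0) + ENNReal.ofReal (|(m : ℝ)| ^ (-b)) := by
    intro m
    unfold polyWeight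
    split_ifs <;> simp
  refine ne_top_of_le_ne_top ?_ (ENNReal.tsum_le_tsum h1)
  rw [ENNReal.tsum_add, tsum_ite_eq]
  refine ENNReal.add_ne_top.2 ⟨by simp, ?_⟩
  exact (Real.summable_abs_int_rpow hb).tsum_ofReal_ne_top

lemma polyWeight_rpow {b t : ℝ} (m : ℤ) (ht : 0 ≤ t) : polyWeight b m ^ t = polyWeight (b * t) m := by
  unfold polyWeight
  split_ifs with h
  · simp
  · rw [ENNReal.ofReal_rpow_of_nonneg (by positivity) ht, ← Real.rpow_mul (abs_nonneg _), neg_mul]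

/-- A frequency divisible by N does not distinguish between the candidates of the search, which
costs a factor N. Its weight gains N^(-b) ≤ N^(-1), which pays for that. -/
lemma polyWeight_mul_le {b : ℝ} (hb : 1 ≤ b) {N : ℕ} (hN : 1 ≤ N) {m : ℤ} (hm : m ≠ 0) :
    (N : ℝ≥0∞) * polyWeight b (N * m) ≤ polyWeight b m := by
  have hNm : (N : ℤ) * m ≠ 0 := mul_ne_zero (by positivity) hm
  have hN' : (1 : ℝ) ≤ N := by exact_mod_cast hN
  simp only [polyWeight, hm, hNm, if_false]
  rw [← ENNReal.ofReal_natCast, ← ENNReal.ofReal_mul (by positivity)]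
  refine ENNReal.ofReal_le_ofReal ?_
  push_cast
  rw [abs_mul, Nat.abs_cast, Real.mul_rpow (by positivity) (by positivity), ← mul_assoc]
  refine mul_le_of_le_one_left (by positivity) ?_
  rw [Real.rpow_neg (by positivity), mul_inv_le_iff₀ (by positivity), one_mul]
  calc (N : ℝ) = (N : ℝ) ^ (1 : ℝ) := (Real.rpow_one _).symm
    _ ≤ _ := Real.rpow_le_rpow_of_exponent_le hN' hb

/-- The one-dimensional factor of `rUnitSq`. -/
def rFactor (α : ℕ) (m : ℤ) : ℝ := if m = 0 then 1 else |2 * Real.pi * (m : ℝ)| ^ (2 * α)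

lemma rUnitSq_eq_prod {s : ℕ} (α : ℕ) (h : Fin s → ℤ) : rUnitSq α h = ∏ j, rFactor α (h j) := rfl

lemma one_le_rFactor (α : ℕ) (m : ℤ) : 1 ≤ rFactor α m := by
  unfold rFactor
  split_ifs with h
  · rfl
  · refine one_le_pow₀ ?_
    have h1 : (1 : ℝ) ≤ |(m : ℝ)| := by exact_mod_cast Int.one_le_abs h
    rw [abs_mul, abs_of_pos (by positivity)]
    nlinarith [Real.pi_gt_three]

lemma rFactor_pos (α : ℕ) (m : ℤ) : 0 < rFactor α m := zero_lt_one.trans_le (one_le_rFactor α m)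

lemma one_le_rUnitSq {s : ℕ} (α : ℕ) (h : Fin s → ℤ) : 1 ≤ rUnitSq α h := by
  rw [rUnitSq_eq_prod]
  exact Finset.prod_induction _ (1 ≤ ·) (fun _ _ => one_le_mul_of_one_le_of_one_le) le_rfl
    fun j _ => one_le_rFactor α (h j)

lemma rUnitSq_pos {s : ℕ} (α : ℕ) (h : Fin s → ℤ) : 0 < rUnitSq α h :=
  zero_lt_one.trans_le (one_le_rUnitSq α h)

/-- The reciprocal of `rFactor`. -/
def freqWeight (α : ℕ) (m : ℤ) : ℝ≥0∞ := ENNReal.ofReal (rFactor α m)⁻¹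

lemma freqWeight_le_one (α : ℕ) (m : ℤ) : freqWeight α m ≤ 1 := by
  rw [freqWeight, ENNReal.ofReal_le_one]
  exact inv_le_one_of_one_le₀ (one_le_rFactor α m)

/-- The factor 2π in `rFactor` absorbs the constant 2 of the hypothesis. -/
lemma freqWeight_le_polyWeight {α : ℕ} {n m : ℤ} (h : |m| ≤ 2 * |n|) :
    freqWeight α n ≤ polyWeight (2 * α) m := by
  unfold polyWeight
  split_ifs with hm
  · exact freqWeight_le_one α n
  have hn : n ≠ 0 := by
    rintro rfl
    simp only [abs_zero, mul_zero] at h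
    exact hm (abs_nonpos_iff.1 h)
  have hm' : (0 : ℝ) < |(m : ℝ)| := abs_pos.2 (by exact_mod_cast hm)
  have h' : |(m : ℝ)| ≤ 2 * |(n : ℝ)| := by exact_mod_cast h
  rw [freqWeight, rFactor, if_neg hn]
  refine ENNReal.ofReal_le_ofReal ?_
  rw [Real.rpow_neg hm'.le, show (2 * (α : ℝ)) = ((2 * α : ℕ) : ℝ) by push_cast; rfl,
    Real.rpow_natCast]
  refine inv_anti₀ (by positivity) (pow_le_pow_left₀ hm'.le ?_ _)
  rw [abs_mul, abs_of_pos Real.two_pi_pos]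
  nlinarith [Real.pi_gt_three, abs_nonneg (n : ℝ)]

lemma tsum_freqWeight_rpow_ne_top {α : ℕ} {t : ℝ} (ht : 0 ≤ t) (hαt : 1 < 2 * α * t) :
    ∑' m, freqWeight α m ^ t ≠ ⊤ := by
  refine ne_top_of_le_ne_top (tsum_polyWeight_ne_top hαt) (ENNReal.tsum_le_tsum fun m => ?_)
  rw [← polyWeight_rpow _ ht]
  gcongr
  exact freqWeight_le_polyWeight (by linarith [abs_nonneg m])

lemma tsum_freqWeight_ne_top {α : ℕ} (hα : 1 ≤ α) : ∑' m, freqWeight α m ≠ ⊤ := by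
  have : (1 : ℝ) ≤ α := by exact_mod_cast hα
  simpa using tsum_freqWeight_rpow_ne_top (α := α) zero_le_one (by linarith)

lemma ofReal_rUnitSq_inv {s : ℕ} (α : ℕ) (h : Fin s → ℤ) :
    ENNReal.ofReal (rUnitSq α h)⁻¹ = ∏ j, freqWeight α (h j) := by
  rw [rUnitSq_eq_prod, ← Finset.prod_inv_distrib, ENNReal.ofReal_prod_of_nonneg]
  · rfl
  · intro i _
    exact inv_nonneg.2 (rFactor_pos α (h i)).le

lemma tsum_ofReal_rUnitSq_inv (s : ℕ) (α : ℕ) :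
    ∑' h : Fin s → ℤ, ENNReal.ofReal (rUnitSq α h)⁻¹ = (∑' m, freqWeight α m) ^ s := by
  simp only [ofReal_rUnitSq_inv]
  rw [tsum_pi_prod fun _ m => freqWeight α m]
  simp

lemma tsum_ofReal_rUnitSq_inv_ne_top (s : ℕ) {α : ℕ} (hα : 1 ≤ α) :
    ∑' h : Fin s → ℤ, ENNReal.ofReal (rUnitSq α h)⁻¹ ≠ ⊤ := by
  rw [tsum_ofReal_rUnitSq_inv]
  exact ENNReal.pow_ne_top (tsum_freqWeight_ne_top hα)

lemma summable_rUnitSq_inv (s : ℕ) {α : ℕ} (hα : 1 ≤ α) :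
    Summable fun h : Fin s → ℤ => (rUnitSq α h)⁻¹ :=
  (ofReal_tsum_of_ne_top (fun h => inv_nonneg.2 (rUnitSq_pos α h).le)
    (tsum_ofReal_rUnitSq_inv_ne_top s hα)).1

/-- The autocorrelation of `freqWeight`. -/
def corrWeight (α : ℕ) (m : ℤ) : ℝ≥0∞ := ∑' n, freqWeight α n * freqWeight α (n + m)

/-- At least one of |n| and |n + m| is at least |m|/2. That factor supplies the decay in m, and the
other is summed over n. -/
lemma corrWeight_le (α : ℕ) (m : ℤ) :
    corrWeight α m ≤ 2 * (∑' n, freqWeight α n) * polyWeight (2 * α) m := by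
  have h : ∀ n, freqWeight α n * freqWeight α (n + m)
      ≤ (freqWeight α n + freqWeight α (n + m)) * polyWeight (2 * α) m := by
    intro n
    rcases le_total |m| (2 * |n|) with h | h
    · calc _ ≤ polyWeight (2 * α) m * freqWeight α (n + m) := by
            gcongr; exact freqWeight_le_polyWeight h
        _ ≤ _ := by rw [mul_comm]; gcongr; exact le_add_self
    · have : |m| ≤ 2 * |n + m| := by
        have := abs_sub_abs_le_abs_sub m (-n)
        rw [abs_neg, sub_neg_eq_add, add_comm] at this
        linarith
      calc _ ≤ freqWeight α n * polyWeight (2 * α) m := by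
            gcongr; exact freqWeight_le_polyWeight this
        _ ≤ _ := by gcongr; exact le_self_add
  refine (ENNReal.tsum_le_tsum h).trans ?_
  rw [ENNReal.tsum_mul_right, ENNReal.tsum_add, two_mul (∑' n, freqWeight α n)]
  exact mul_le_mul_left (add_le_add le_rfl
    ((Equiv.addRight m).tsum_eq (freqWeight α)).le) _

/-! ### The component-by-component construction -/

open scoped Classical in
/-- The lattice criterion as a sum over the dual lattice, with values in `[0, ∞]`. -/
def dualSum {s : ℕ} (α N : ℕ) (z : Fin s → ℕ) : ℝ≥0∞ :=
  ∑' l : Fin s → ℤ, if l ≠ 0 ∧ (N : ℤ) ∣ ∑ j, l j * (z j : ℤ) then ∏ j, corrWeight α (l j) else 0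

lemma tsum_freqWeight_shift {s : ℕ} (α : ℕ) (l : Fin s → ℤ) :
    ∑' h : Fin s → ℤ, ENNReal.ofReal (rUnitSq α h)⁻¹ * ENNReal.ofReal (rUnitSq α (h + l))⁻¹
      = ∏ j, corrWeight α (l j) := by
  simp only [ofReal_rUnitSq_inv, ← Finset.prod_mul_distrib, Pi.add_apply]
  exact tsum_pi_prod fun j n => freqWeight α n * freqWeight α (n + l j)

lemma tsum_ofReal_dualSubtype_le {s : ℕ} (α : ℕ) (p : (Fin s → ℤ) → Prop) (h : Fin s → ℤ) :
    ∑' l : {l // p l}, ENNReal.ofReal (rUnitSq α (h + l.1))⁻¹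
      ≤ ∑' k : Fin s → ℤ, ENNReal.ofReal (rUnitSq α k)⁻¹ := by
  refine (ENNReal.tsum_comp_le_tsum_of_injective (f := fun l : {l // p l} => h + l.1) ?_
    (fun k => ENNReal.ofReal (rUnitSq α k)⁻¹))
  intro a b hab
  exact Subtype.ext (add_left_cancel hab)

/-- The inner sums of the lattice criterion. -/
lemma ofReal_latticeInner {s : ℕ} {α : ℕ} (hα : 1 ≤ α) (p : (Fin s → ℤ) → Prop) (h : Fin s → ℤ) :
    Summable (fun l : {l // p l} => (rUnitSq α (h + l.1))⁻¹) ∧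
    ENNReal.ofReal (∑' l : {l // p l}, (rUnitSq α (h + l.1))⁻¹)
      = ∑' l : {l // p l}, ENNReal.ofReal (rUnitSq α (h + l.1))⁻¹ :=
  ofReal_tsum_of_ne_top (fun _ => inv_nonneg.2 (rUnitSq_pos α _).le)
    (ne_top_of_le_ne_top (tsum_ofReal_rUnitSq_inv_ne_top s hα) (tsum_ofReal_dualSubtype_le α p h))

lemma latticeInner_nonneg {s : ℕ} (α : ℕ) (p : (Fin s → ℤ) → Prop) (h : Fin s → ℤ) :
    0 ≤ ∑' l : {l // p l}, (rUnitSq α (h + l.1))⁻¹ :=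
  tsum_nonneg fun _ => inv_nonneg.2 (rUnitSq_pos α _).le

/-- Exchanging the sums over h and ℓ makes the inner sum a product of one-dimensional
autocorrelations, so the criterion becomes a plain weighted sum over the dual lattice. -/
lemma ofReal_latticeCriterion {s : ℕ} {α : ℕ} (hα : 1 ≤ α) (N : ℕ) (z : Fin s → ℕ) :
    Summable (fun h : Fin s → ℤ => (rUnitSq α h)⁻¹ *
      ∑' l : {l : Fin s → ℤ // l ≠ 0 ∧ (N : ℤ) ∣ ∑ j, l j * (z j : ℤ)},
        (rUnitSq α (h + l.1))⁻¹) ∧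
    ENNReal.ofReal (latticeCriterion α N z) = dualSum α N z := by
  classical
  set p : (Fin s → ℤ) → Prop := fun l => l ≠ 0 ∧ (N : ℤ) ∣ ∑ j, l j * (z j : ℤ)
  have e : ∀ h : Fin s → ℤ, ENNReal.ofReal ((rUnitSq α h)⁻¹ *
      ∑' l : {l // p l}, (rUnitSq α (h + l.1))⁻¹)
      = ENNReal.ofReal (rUnitSq α h)⁻¹ * ∑' l : {l // p l}, ENNReal.ofReal (rUnitSq α (h + l.1))⁻¹ := by
    intro h
    rw [ENNReal.ofReal_mul (inv_nonneg.2 (rUnitSq_pos α h).le), (ofReal_latticeInner hα p h).2]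
  have hfin : ∑' h : Fin s → ℤ, ENNReal.ofReal ((rUnitSq α h)⁻¹ *
      ∑' l : {l // p l}, (rUnitSq α (h + l.1))⁻¹) ≠ ⊤ := by
    simp only [e]
    refine ne_top_of_le_ne_top ?_ (ENNReal.tsum_le_tsum fun h =>
      mul_le_mul_right (tsum_ofReal_dualSubtype_le α p h) _)
    rw [ENNReal.tsum_mul_right]
    exact ENNReal.mul_ne_top (tsum_ofReal_rUnitSq_inv_ne_top s hα)
      (tsum_ofReal_rUnitSq_inv_ne_top s hα)
  have h := ofReal_tsum_of_ne_top (fun h => mul_nonneg (inv_nonneg.2 (rUnitSq_pos α h).le)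
    (latticeInner_nonneg α p h)) hfin
  refine ⟨h.1, ?_⟩
  rw [latticeCriterion, h.2]
  simp only [e, ← ENNReal.tsum_mul_left]
  rw [ENNReal.tsum_comm]
  simp only [tsum_freqWeight_shift]
  rw [dualSum, ← tsum_subtype_eq_of_support_subset (s := {l | p l})]
  · refine tsum_congr fun l => ?_
    rw [if_pos l.2]
  · intro l hl
    by_contra hc
    exact hl (if_neg hc)

open scoped Classical in
/-- The part of the dual sum with nonzero last frequency, with exponent `t`. -/
def lastSum {s : ℕ} (α N : ℕ) (t : ℝ) (z : Fin s → ℕ) (c : ℕ) : ℝ≥0∞ :=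
  ∑' q : ℤ × (Fin s → ℤ), if q.1 ≠ 0 ∧ (N : ℤ) ∣ ∑ j, q.2 j * (z j : ℤ) + q.1 * c then
    (corrWeight α q.1 * ∏ j, corrWeight α (q.2 j)) ^ t else 0

/-- Frequencies with last component zero do not see c. Only `lastSum` depends on the new component.
-/
lemma dualSum_snoc {s : ℕ} (α N : ℕ) (z : Fin s → ℕ) (c : ℕ) :
    dualSum α N (Fin.snoc z c : Fin (s + 1) → ℕ)
      = corrWeight α 0 * dualSum α N z + lastSum α N 1 z c := by
  classical
  rw [dualSum, ← (Fin.snocEquiv fun _ => ℤ).tsum_eq, lastSum, ENNReal.tsum_prod',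
    ENNReal.tsum_prod', ENNReal.tsum_eq_add_tsum_ite 0, dualSum, ← ENNReal.tsum_mul_left]
  simp only [Fin.snocEquiv, Equiv.coe_fn_mk, Fin.prod_univ_castSucc, Fin.sum_univ_castSucc,
    Fin.snoc_castSucc, Fin.snoc_last, ENNReal.rpow_one]
  congr 1
  · refine tsum_congr fun l => ?_
    have : (Fin.snoc l (0 : ℤ) : Fin (s + 1) → ℤ) = 0 ↔ l = 0 := by
      constructor
      · intro h; ext j
        have := congrFun h j.castSucc
        simpa using this
      · rintro rfl; ext j
        refine Fin.lastCases ?_ (fun i => ?_) j <;> simp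
    simp only [ne_eq, this, zero_mul, add_zero]
    split_ifs <;> simp [mul_comm]
  · refine tsum_congr fun m => ?_
    split_ifs with hm
    · simp [hm]
    · refine tsum_congr fun l => ?_
      have : (Fin.snoc l m : Fin (s + 1) → ℤ) ≠ 0 := by
        intro h
        have := congrFun h (Fin.last s)
        simp at this
        exact hm this
      simp only [ne_eq, this, not_false_eq_true, hm, true_and, mul_comm]

lemma lastSum_one_le {s : ℕ} (α N : ℕ) {t : ℝ} (ht : 0 < t) (ht1 : t ≤ 1) (z : Fin s → ℕ) (c : ℕ) :
    lastSum α N 1 z c ≤ lastSum α N t z c ^ (1 / t) := by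
  classical
  refine (tsum_le_rpow_tsum_rpow _ ht ht1).trans_eq ?_
  rw [lastSum]
  congr 1
  refine tsum_congr fun q => ?_
  split_ifs
  · rw [ENNReal.rpow_one]
  · rw [ENNReal.zero_rpow_of_pos ht]

/-- Since N is prime, m is invertible modulo N unless N divides it, so the congruence has at most
one solution c. In the remaining case all candidates are counted. -/
lemma card_filter_dvd_le {N : ℕ} (hN : N.Prime) (A m : ℤ) :
    (((Finset.Icc 1 (N - 1)).filter fun c : ℕ => (N : ℤ) ∣ A + m * c).card : ℝ≥0∞)
      ≤ 1 + if (N : ℤ) ∣ m then (N : ℝ≥0∞) else 0 := by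
  split_ifs with h
  · refine le_trans ?_ le_add_self
    refine Nat.cast_le.2 ((Finset.card_filter_le _ _).trans ?_)
    simp
  · rw [add_zero]
    refine Nat.cast_le_one.2 (Finset.card_le_one.2 fun c hc c' hc' => ?_)
    simp only [Finset.mem_filter, Finset.mem_Icc] at hc hc'
    have hd : (N : ℤ) ∣ m * ((c : ℤ) - c') := by
      have := dvd_sub hc.2 hc'.2
      rwa [show A + m * c - (A + m * c') = m * ((c : ℤ) - c') by ring] at this
    rcases (Nat.prime_iff_prime_int.1 hN).dvd_or_dvd hd with h' | h'
    · exact absurd h' h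
    · have h2 := Int.eq_zero_of_abs_lt_dvd h' (by
        have := hN.two_le
        rw [abs_lt]; omega)
      omega

/-- A bound for the average of `lastSum` over the candidates. -/
def avgConst (α s : ℕ) (t : ℝ) : ℝ≥0∞ :=
  (2 * (2 * ∑' n, freqWeight α n) ^ t * ∑' m, polyWeight (2 * α * t) m) *
    ((2 * ∑' n, freqWeight α n) ^ t * ∑' m, polyWeight (2 * α * t) m) ^ s

lemma corrWeight_rpow_le (α : ℕ) {t : ℝ} (ht : 0 ≤ t) (m : ℤ) :
    corrWeight α m ^ t ≤ (2 * ∑' n, freqWeight α n) ^ t * polyWeight (2 * α * t) m := by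
  rw [← polyWeight_rpow _ ht, ← ENNReal.mul_rpow_of_nonneg _ _ ht]
  gcongr
  exact corrWeight_le α m

lemma avgConst_ne_top {α : ℕ} (hα : 1 ≤ α) (s : ℕ) {t : ℝ} (ht : 0 < t) (hαt : 1 < 2 * α * t) :
    avgConst α s t ≠ ⊤ := by
  have h1 : (2 * ∑' n, freqWeight α n) ^ t ≠ ⊤ :=
    ENNReal.rpow_ne_top_of_nonneg ht.le (ENNReal.mul_ne_top (by simp) (tsum_freqWeight_ne_top hα))
  have h2 := tsum_polyWeight_ne_top hαt
  exact ENNReal.mul_ne_top (ENNReal.mul_ne_top (ENNReal.mul_ne_top (by simp) h1) h2)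
    (ENNReal.pow_ne_top (ENNReal.mul_ne_top h1 h2))

lemma tsum_dvd_polyWeight_le {b : ℝ} (hb : 1 < b) {N : ℕ} (hN : 1 ≤ N) :
    ∑' m : ℤ, (if m ≠ 0 ∧ (N : ℤ) ∣ m then (N : ℝ≥0∞) * polyWeight b m else 0)
      ≤ ∑' m, polyWeight b m := by
  have hinj : Function.Injective fun k : ℤ => (N : ℤ) * k :=
    mul_right_injective₀ (by positivity)
  rw [← hinj.tsum_eq]
  · refine ENNReal.tsum_le_tsum fun k => ?_
    split_ifs with h
    · exact polyWeight_mul_le hb.le hN (right_ne_zero_of_mul h.1)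
    · exact zero_le
  · intro m hm
    have : m ≠ 0 ∧ (N : ℤ) ∣ m := by
      by_contra hc
      exact hm (if_neg hc)
    obtain ⟨k, hk⟩ := this.2
    exact ⟨k, hk.symm⟩

/-- Summing over c first, a frequency with N ∤ m is hit by at most one candidate, while for N ∣ m
the extra factor N is absorbed by `tsum_dvd_polyWeight_le`. The bound does not involve N, so an
average candidate has `lastSum` of order 1/N. -/
lemma sum_lastSum_le {s : ℕ} {α N : ℕ} (hN : N.Prime) {t : ℝ} (ht : 0 < t)
    (hαt : 1 < 2 * α * t) (z : Fin s → ℕ) :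
    ∑ c ∈ Finset.Icc 1 (N - 1), lastSum α N t z c ≤ avgConst α s t := by
  classical
  set B := (2 * ∑' n, freqWeight α n) ^ t
  set w := polyWeight (2 * α * t)
  have h1 : ∑ c ∈ Finset.Icc 1 (N - 1), lastSum α N t z c
      = ∑' q : ℤ × (Fin s → ℤ), ∑ c ∈ Finset.Icc 1 (N - 1),
        (if q.1 ≠ 0 ∧ (N : ℤ) ∣ ∑ j, q.2 j * (z j : ℤ) + q.1 * c then
        (corrWeight α q.1 * ∏ j, corrWeight α (q.2 j)) ^ t else 0) :=
    (Summable.tsum_finsetSum fun _ _ => ENNReal.summable).symm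
  have h2 : ∀ q : ℤ × (Fin s → ℤ), ∑ c ∈ Finset.Icc 1 (N - 1),
        (if q.1 ≠ 0 ∧ (N : ℤ) ∣ ∑ j, q.2 j * (z j : ℤ) + q.1 * c then
        (corrWeight α q.1 * ∏ j, corrWeight α (q.2 j)) ^ t else 0)
      ≤ (B * (w q.1 + if q.1 ≠ 0 ∧ (N : ℤ) ∣ q.1 then N * w q.1 else 0)) *
          ∏ j, (B * w (q.2 j)) := by
    rintro ⟨m, l⟩
    by_cases hm : m = 0
    · simp [hm]
    simp only [ne_eq, hm, not_false_eq_true, true_and]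
    rw [← Finset.sum_filter, Finset.sum_const, nsmul_eq_mul,
      ENNReal.mul_rpow_of_nonneg _ _ ht.le, ← ENNReal.prod_rpow_of_nonneg ht.le]
    calc _ ≤ (1 + if (N : ℤ) ∣ m then (N : ℝ≥0∞) else 0) *
          ((B * w m) * ∏ j, (B * w (l j))) := by
          gcongr
          · exact card_filter_dvd_le hN _ _
          · exact corrWeight_rpow_le α ht.le m
          · exact corrWeight_rpow_le α ht.le _
      _ = _ := by
          split_ifs
          · ring
          · ring
  rw [h1]
  refine (ENNReal.tsum_le_tsum h2).trans ?_
  rw [ENNReal.tsum_prod']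
  simp only [ENNReal.tsum_mul_left, ENNReal.tsum_mul_right]
  rw [tsum_pi_prod fun _ m => B * w m, ENNReal.tsum_add]
  simp only [ENNReal.tsum_mul_left, Finset.prod_const, Finset.card_univ, Fintype.card_fin]
  rw [avgConst]
  refine mul_le_mul_left ?_ _
  calc B * (∑' m, w m + ∑' m : ℤ, if m ≠ 0 ∧ (N : ℤ) ∣ m then (N : ℝ≥0∞) * w m else 0)
      ≤ B * (∑' m, w m + ∑' m, w m) := by
        exact mul_le_mul_right (add_le_add le_rfl (tsum_dvd_polyWeight_le hαt hN.one_le)) _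
    _ = 2 * B * ∑' m, w m := by ring

/-- The minimum is at most the average over N − 1 candidates. The factor 2 comes from N ≤ 2(N − 1).
-/
lemma exists_lastSum_le {s : ℕ} {α N : ℕ} (hN : N.Prime) {t : ℝ} (ht : 0 < t)
    (hαt : 1 < 2 * α * t) (z : Fin s → ℕ) :
    ∃ c ∈ Finset.Icc 1 (N - 1), lastSum α N t z c ≤ 2 * avgConst α s t / N := by
  have hne : (Finset.Icc 1 (N - 1)).Nonempty := ⟨1, by
    have := hN.two_le
    simp only [Finset.mem_Icc]; omega⟩
  obtain ⟨c, hc, hmin⟩ := Finset.exists_min_image _ (lastSum α N t z) hne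
  refine ⟨c, hc, ?_⟩
  have h1 := (Finset.card_nsmul_le_sum _ _ _ hmin).trans (sum_lastSum_le hN ht hαt z)
  rw [Nat.card_Icc, nsmul_eq_mul, Nat.add_sub_cancel] at h1
  rw [ENNReal.le_div_iff_mul_le (Or.inl (by exact_mod_cast hN.ne_zero)) (Or.inl (by simp))]
  calc lastSum α N t z c * N ≤ lastSum α N t z c * (2 * (N - 1 : ℕ) : ℕ) := by
        gcongr
        have := hN.two_le
        omega
    _ = 2 * ((N - 1 : ℕ) * lastSum α N t z c) := by push_cast; ring
    _ ≤ _ := by gcongr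

/-- The constant in the error bound for the component-by-component construction. -/
def cbcConst (α : ℕ) (t : ℝ) : ℕ → ℝ≥0∞
  | 0 => 0
  | s + 1 => corrWeight α 0 * cbcConst α t s + (2 * avgConst α s t) ^ (1 / t)

lemma cbcConst_ne_top {α : ℕ} (hα : 1 ≤ α) {t : ℝ} (ht : 0 < t) (hαt : 1 < 2 * α * t) :
    ∀ s, cbcConst α t s ≠ ⊤
  | 0 => by simp [cbcConst]
  | s + 1 => by
    refine ENNReal.add_ne_top.2 ⟨ENNReal.mul_ne_top ?_ (cbcConst_ne_top hα ht hαt s),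
      ENNReal.rpow_ne_top_of_nonneg (by positivity)
        (ENNReal.mul_ne_top (by simp) (avgConst_ne_top hα s ht hαt))⟩
    refine ne_top_of_le_ne_top ?_ (corrWeight_le α 0)
    exact ENNReal.mul_ne_top (ENNReal.mul_ne_top (by simp) (tsum_freqWeight_ne_top hα))
      (ne_top_of_le_ne_top (by simp) (polyWeight_le_one (by positivity) 0))

lemma initial_eq_snoc {d : ℕ} (s : Fin d) (z : Fin d → ℕ) :
    initial s z = Fin.snoc (fun i : Fin s.1 => z (Fin.castLE s.2.le i)) (z s) := by
  ext j
  refine Fin.lastCases ?_ (fun i => ?_) j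
  · simp [initial]; rfl
  · simp [initial]

lemma initial_update_eq_snoc {d : ℕ} (s : Fin d) (z : Fin d → ℕ) (c : ℕ) :
    initial s (Function.update z s c)
      = Fin.snoc (fun i : Fin s.1 => z (Fin.castLE s.2.le i)) c := by
  rw [initial_eq_snoc]
  congr 1
  · ext i
    rw [Function.update_of_ne]
    intro h
    have := congrArg Fin.val h
    simp at this
    omega
  · simp

/-- Induction on the number of components. The selected component is compared with a candidate that
is good on average for the t-th powers, and `lastSum_one_le` turns its bound of order 1/N into one
of order N^(-1/t). -/
theorem dualSum_le_of_isCBCVector {d : ℕ} {α N : ℕ} (hα : 1 ≤ α) (hN : N.Prime) {t : ℝ}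
    (ht : 0 < t) (ht1 : t ≤ 1) (hαt : 1 < 2 * α * t) {z : Fin d → ℕ} (hz : IsCBCVector α N z) :
    ∀ (s : ℕ) (hs : s ≤ d), dualSum α N (fun i : Fin s => z (Fin.castLE hs i))
      ≤ cbcConst α t s * (N : ℝ≥0∞)⁻¹ ^ (1 / t)
  | 0, _ => by
    rw [cbcConst, zero_mul, nonpos_iff_eq_zero]
    exact ENNReal.tsum_eq_zero.2 fun l => if_neg fun h => h.1 (Subsingleton.elim _ _)
  | s + 1, hs => by
    have ih := dualSum_le_of_isCBCVector hα hN ht ht1 hαt hz s (by omega)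
    set z' : Fin s → ℕ := fun i => z (Fin.castLE (by omega) i)
    obtain ⟨c, hc, hle⟩ := exists_lastSum_le hN ht hαt z'
    have h1 := (hz ⟨s, hs⟩).2 c hc
    rw [initial_update_eq_snoc] at h1
    have h2 := ENNReal.ofReal_le_ofReal h1
    rw [(ofReal_latticeCriterion hα N _).2, (ofReal_latticeCriterion hα N _).2] at h2
    refine h2.trans ?_
    rw [dualSum_snoc, cbcConst, add_mul, mul_assoc]
    gcongr
    refine (lastSum_one_le α N ht ht1 _ c).trans ?_
    rw [← ENNReal.mul_rpow_of_nonneg _ _ (by positivity), ← div_eq_mul_inv]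
    gcongr

/-- The error bound for the component-by-component construction. -/
theorem exists_latticeCriterion_le (d : ℕ) {α : ℕ} (hα : 1 ≤ α) {t : ℝ}
    (ht : 0 < t) (ht1 : t ≤ 1) (hαt : 1 < 2 * α * t) :
    ∃ C : ℝ, 0 < C ∧ ∀ (N : ℕ) (z : Fin d → ℕ), N.Prime → IsCBCVector α N z →
      latticeCriterion α N z ≤ C * (N : ℝ) ^ (-(1 / t)) := by
  have hC := cbcConst_ne_top hα ht hαt d
  refine ⟨(cbcConst α t d).toReal + 1, by positivity, fun N z hN hz => ?_⟩
  have h := dualSum_le_of_isCBCVector hα hN ht ht1 hαt hz d le_rfl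
  change dualSum α N z ≤ _ at h
  rw [← (ofReal_latticeCriterion hα N z).2] at h
  have hN0 : (0 : ℝ) < N := by exact_mod_cast hN.pos
  have e : cbcConst α t d * (N : ℝ≥0∞)⁻¹ ^ (1 / t)
      = ENNReal.ofReal ((cbcConst α t d).toReal * (N : ℝ) ^ (-(1 / t))) := by
    rw [ENNReal.ofReal_mul (by positivity), ENNReal.ofReal_toReal hC, Real.rpow_neg hN0.le,
      ← Real.inv_rpow hN0.le, ← ENNReal.ofReal_rpow_of_pos (by positivity),
      ENNReal.ofReal_inv_of_pos hN0, ENNReal.ofReal_natCast]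
  rw [e, ENNReal.ofReal_le_ofReal_iff (by positivity)] at h
  refine h.trans ?_
  gcongr
  linarith

/-! ### The trial space in terms of Fourier coefficients -/

/-- The one-dimensional factor of `rBox`. -/
def rBoxFactor (α : ℕ) (a : ℝ) (m : ℤ) : ℝ :=
  if m = 0 then Real.sqrt (2 * a) else |Real.pi * (m : ℝ) / a| ^ α

lemma rBoxFactor_pos {α : ℕ} {a : ℝ} (ha : 0 < a) (m : ℤ) : 0 < rBoxFactor α a m := by
  unfold rBoxFactor
  split_ifs with h
  · exact Real.sqrt_pos.2 (by positivity)
  · have : (m : ℝ) ≠ 0 := by exact_mod_cast h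
    positivity

lemma rBox_eq_prod {d : ℕ} (α : ℕ) (a : ℝ) (h : Fin d → ℤ) :
    rBox α a h = ∏ j, rBoxFactor α a (h j) := rfl

lemma rBox_pos {d : ℕ} {α : ℕ} {a : ℝ} (ha : 0 < a) (h : Fin d → ℤ) : 0 < rBox α a h :=
  Finset.prod_pos fun j _ => rBoxFactor_pos ha (h j)

lemma rBox_neg {d : ℕ} (α : ℕ) (a : ℝ) (h : Fin d → ℤ) : rBox α a (-h) = rBox α a h := by
  simp only [rBox, Pi.neg_apply, neg_eq_zero, Int.cast_neg, mul_neg, neg_div, abs_neg]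

/-- Off m = 0 this is the identity |2πm| = 2a |πm/a|. At m = 0 it needs 2a ≥ 1. -/
lemma rFactor_le_rBoxFactor {α : ℕ} {a : ℝ} (ha : 1 ≤ 2 * a) (m : ℤ) :
    rFactor α m ≤ (2 * a) ^ (2 * α) * rBoxFactor α a m ^ 2 := by
  have ha0 : 0 < a := by linarith
  unfold rFactor rBoxFactor
  split_ifs with h
  · rw [Real.sq_sqrt (by linarith)]
    exact one_le_mul_of_one_le_of_one_le (one_le_pow₀ ha) ha
  · rw [← pow_mul, mul_comm α 2, ← mul_pow]
    refine le_of_eq ?_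
    congr 1
    conv_rhs => rw [← abs_of_pos (show 0 < 2 * a by positivity), ← abs_mul]
    congr 1
    field_simp

lemma rUnitSq_le_rBox {d α : ℕ} {a : ℝ} (ha : 1 ≤ 2 * a) (h : Fin d → ℤ) :
    rUnitSq α h ≤ (2 * a) ^ (2 * α * d) * rBox α a h ^ 2 := by
  rw [rUnitSq_eq_prod, rBox_eq_prod, ← Finset.prod_pow, pow_mul]
  calc ∏ j, rFactor α (h j) ≤ ∏ j, ((2 * a) ^ (2 * α) * rBoxFactor α a (h j) ^ 2) :=
        Finset.prod_le_prod (fun j _ => (rFactor_pos α _).le) fun j _ => rFactor_le_rBoxFactor ha _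
    _ = _ := by
      rw [Finset.prod_mul_distrib, Finset.prod_const, Finset.card_univ, Fintype.card_fin]

lemma rBox_sq_inv_le {d α : ℕ} {a : ℝ} (ha : 1 ≤ 2 * a) (h : Fin d → ℤ) :
    (rBox α a h ^ 2)⁻¹ ≤ (2 * a) ^ (2 * α * d) * (rUnitSq α h)⁻¹ := by
  have h1 := rBox_pos (α := α) (show 0 < a by linarith) h
  have h2 := rUnitSq_pos α h
  rw [← div_eq_mul_inv, le_div_iff₀ h2, inv_mul_le_iff₀ (by positivity), mul_comm]
  exact rUnitSq_le_rBox ha h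

lemma summable_rBox_sq_inv {d α : ℕ} (hα : 1 ≤ α) {a : ℝ} (ha : 1 ≤ 2 * a) :
    Summable fun h : Fin d → ℤ => (rBox α a h ^ 2)⁻¹ :=
  Summable.of_nonneg_of_le (fun h => by positivity) (rBox_sq_inv_le ha)
    ((summable_rUnitSq_inv d hα).mul_left _)

lemma fourierCoeffBox_neg {d : ℕ} (a : ℝ) (v : (Fin d → ℝ) → ℝ) (h : Fin d → ℤ) :
    fourierCoeffBox a v (-h) = (starRingEnd ℂ) (fourierCoeffBox a v h) := by
  rw [fourierCoeffBox, fourierCoeffBox, ← integral_conj]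
  simp only [map_mul, Complex.conj_ofReal, trig_neg]

/-- The coefficients of an absolutely convergent trigonometric series. -/
lemma fourierCoeffBox_eq_of_hasSum {d : ℕ} {a : ℝ} (ha : 1 ≤ 2 * a) {v : (Fin d → ℝ) → ℝ}
    {b : (Fin d → ℤ) → ℂ} (hb : Summable fun h => ‖b h‖)
    (hv : ∀ x, HasSum (fun h => b h * trig a h x) (v x : ℂ)) (h : Fin d → ℤ) :
    fourierCoeffBox a v h = b h := by
  have ha0 : 0 < a := by linarith
  have hint : ∀ k : Fin d → ℤ, Integrable
      (fun x => b k * trig a k x * (starRingEnd ℂ) (trig a h x)) (volume.restrict (box d a)) := by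
    intro k
    have hc : Continuous fun x => b k * trig a k x * (starRingEnd ℂ) (trig a h x) :=
      (continuous_const.mul (trig_continuous a k)).mul (trig_continuous a h).star
    exact hc.continuousOn.integrableOn_compact (isCompact_box d a)
  have hsum : Summable fun k : Fin d → ℤ =>
      ∫ x in box d a, ‖b k * trig a k x * (starRingEnd ℂ) (trig a h x)‖ := by
    refine Summable.of_nonneg_of_le (fun k => by positivity) (fun k => ?_)
      (hb.mul_right (volume.real (box d a)))
    have h1 := norm_setIntegral_le_of_norm_le_const (μ := volume) (s := box d a) (C := ‖b k‖)
      (f := fun x => ‖b k * trig a k x * (starRingEnd ℂ) (trig a h x)‖)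
      (isCompact_box d a).measure_lt_top (fun x _ => by
        rw [norm_norm, norm_mul, norm_mul, RCLike.norm_conj]
        have h2 := norm_trig_le_one ha k x
        have h3 := norm_trig_le_one ha h x
        calc _ ≤ ‖b k‖ * 1 * 1 := by gcongr
          _ = _ := by ring)
    exact (Real.le_norm_self _).trans h1
  have key := hasSum_integral_of_summable_integral_norm hint hsum
  have e1 : ∀ k, ∫ x in box d a, b k * trig a k x * (starRingEnd ℂ) (trig a h x)
      = if k = h then b h else 0 := by
    intro k
    simp only [mul_assoc]
    rw [integral_const_mul, integral_trig_mul_conj ha0]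
    split_ifs with hk
    · rw [hk, mul_one]
    · rw [mul_zero]
  simp only [e1] at key
  have e2 : ∫ x in box d a, ∑' k, b k * trig a k x * (starRingEnd ℂ) (trig a h x)
      = fourierCoeffBox a v h := by
    rw [fourierCoeffBox]
    congr 1
    ext x
    rw [tsum_mul_right, (hv x).tsum_eq]
  rw [e2] at key
  exact key.unique (hasSum_ite_eq h (b h))

/-- Functions with a trigonometric series whose coefficients are `O(r(h)⁻²)`. -/
def HasDecayingSeries {d : ℕ} (α : ℕ) (a : ℝ) (v : (Fin d → ℝ) → ℝ) : Prop :=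
  (∃ C, ∀ h, ‖fourierCoeffBox a v h‖ ≤ C * (rBox α a h ^ 2)⁻¹) ∧
    ∀ x, HasSum (fun h => fourierCoeffBox a v h * trig a h x) (v x : ℂ)

lemma summable_norm_of_le {d α : ℕ} (hα : 1 ≤ α) {a : ℝ} (ha : 1 ≤ 2 * a) {b : (Fin d → ℤ) → ℂ}
    {C : ℝ} (hb : ∀ h, ‖b h‖ ≤ C * (rBox α a h ^ 2)⁻¹) : Summable fun h => ‖b h‖ :=
  Summable.of_nonneg_of_le (fun _ => norm_nonneg _) hb ((summable_rBox_sq_inv hα ha).mul_left C)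

lemma HasDecayingSeries.of_coeff {d α : ℕ} (hα : 1 ≤ α) {a : ℝ} (ha : 1 ≤ 2 * a)
    {v : (Fin d → ℝ) → ℝ} {b : (Fin d → ℤ) → ℂ} {C : ℝ}
    (hb : ∀ h, ‖b h‖ ≤ C * (rBox α a h ^ 2)⁻¹)
    (hv : ∀ x, HasSum (fun h => b h * trig a h x) (v x : ℂ)) :
    HasDecayingSeries α a v ∧ ∀ h, fourierCoeffBox a v h = b h := by
  have h1 := fourierCoeffBox_eq_of_hasSum ha (summable_norm_of_le hα ha hb) hv
  refine ⟨⟨⟨C, fun h => ?_⟩, fun x => ?_⟩, h1⟩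
  · rw [h1]; exact hb h
  · simp only [h1]; exact hv x

lemma HasDecayingSeries.add {d α : ℕ} (hα : 1 ≤ α) {a : ℝ} (ha : 1 ≤ 2 * a)
    {v w : (Fin d → ℝ) → ℝ} (hv : HasDecayingSeries α a v) (hw : HasDecayingSeries α a w) :
    HasDecayingSeries α a (v + w) ∧
      ∀ h, fourierCoeffBox a (v + w) h = fourierCoeffBox a v h + fourierCoeffBox a w h := by
  obtain ⟨⟨C, hC⟩, h1⟩ := hv
  obtain ⟨⟨C', hC'⟩, h2⟩ := hw
  refine HasDecayingSeries.of_coeff hα ha (C := C + C') (fun h => ?_) (fun x => ?_)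
  · rw [add_mul]
    exact norm_add_le_of_le (hC h) (hC' h)
  · simp only [add_mul, Pi.add_apply, Complex.ofReal_add]
    exact (h1 x).add (h2 x)

lemma HasDecayingSeries.smul {d α : ℕ} (hα : 1 ≤ α) {a : ℝ} (ha : 1 ≤ 2 * a)
    {v : (Fin d → ℝ) → ℝ} (hv : HasDecayingSeries α a v) (c : ℝ) :
    HasDecayingSeries α a (c • v) ∧
      ∀ h, fourierCoeffBox a (c • v) h = c • fourierCoeffBox a v h := by
  obtain ⟨⟨C, hC⟩, h1⟩ := hv
  refine HasDecayingSeries.of_coeff hα ha (C := |c| * C) (fun h => ?_) (fun x => ?_)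
  · rw [norm_smul, mul_assoc, Real.norm_eq_abs]
    exact mul_le_mul_of_nonneg_left (hC h) (abs_nonneg c)
  · simp only [Complex.real_smul, mul_assoc, Pi.smul_apply, smul_eq_mul, Complex.ofReal_mul]
    exact (h1 x).mul_left _

lemma HasDecayingSeries.kernel {d α : ℕ} (hα : 1 ≤ α) {a : ℝ} (ha : 1 ≤ 2 * a) (y : Fin d → ℝ) :
    HasDecayingSeries α a (korobovKernel α a y) ∧
      ∀ h, fourierCoeffBox a (korobovKernel α a y) h
        = (((rBox α a h ^ 2)⁻¹ : ℝ) : ℂ) * (starRingEnd ℂ) (trig a h y) := by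
  have hbd : ∀ h, ‖(((rBox α a h ^ 2)⁻¹ : ℝ) : ℂ) * (starRingEnd ℂ) (trig a h y)‖
      ≤ 1 * (rBox α a h ^ 2)⁻¹ := by
    intro h
    rw [norm_mul, RCLike.norm_conj, Complex.norm_real, Real.norm_eq_abs,
      abs_of_nonneg (by positivity), mul_comm]
    exact mul_le_mul_of_nonneg_right (norm_trig_le_one ha h y) (by positivity)
  refine HasDecayingSeries.of_coeff hα ha (C := 1) hbd (fun x => ?_)
  set F : (Fin d → ℤ) → ℂ := fun h =>
    (((rBox α a h ^ 2)⁻¹ : ℝ) : ℂ) * (starRingEnd ℂ) (trig a h y) * trig a h x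
  have hF : Summable F := by
    refine Summable.of_norm (Summable.of_nonneg_of_le (fun _ => norm_nonneg _) (fun h => ?_)
      (summable_norm_of_le hα ha hbd))
    rw [norm_mul]
    exact mul_le_of_le_one_right (norm_nonneg _) (norm_trig_le_one ha h x)
  -- The reflection h ↦ −h conjugates the terms, so the series is real and the real part in
  -- `korobovKernel` loses nothing.
  have e1 : ∀ h, (((rBox α a h ^ 2)⁻¹ : ℝ) : ℂ) * trig a h y * (starRingEnd ℂ) (trig a h x)
      = F (-h) := by
    intro h
    simp only [F, rBox_neg, trig_neg, Complex.conj_conj]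
  have e2 : ∀ h, F (-h) = (starRingEnd ℂ) (F h) := by
    intro h
    simp only [F, rBox_neg, trig_neg, map_mul, Complex.conj_ofReal]
  have e3 : ∑' h, F (-h) = ∑' h, F h := (Equiv.neg _).tsum_eq F
  have e4 : (starRingEnd ℂ) (∑' h, F h) = ∑' h, F h := by
    rw [Complex.conj_tsum]
    simp only [← e2]
    exact e3
  have e5 : (korobovKernel α a y x : ℂ) = ∑' h, F h := by
    rw [korobovKernel]
    simp only [e1]
    rw [e3]
    exact Complex.conj_eq_iff_re.1 e4
  rw [e5]
  exact hF.hasSum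

lemma HasDecayingSeries.zero {d α : ℕ} (hα : 1 ≤ α) {a : ℝ} (ha : 1 ≤ 2 * a) :
    HasDecayingSeries α a (0 : (Fin d → ℝ) → ℝ) :=
  (HasDecayingSeries.of_coeff hα ha (b := 0) (C := 0) (by simp)
    (by intro x; simp)).1

lemma hasDecayingSeries_of_mem {d α : ℕ} (hα : 1 ≤ α) {a : ℝ} (ha : 1 ≤ 2 * a) {N : ℕ}
    {z : Fin d → ℕ} {v : (Fin d → ℝ) → ℝ} (hv : v ∈ trialSpace α a N z) :
    HasDecayingSeries α a v := by
  induction hv using Submodule.span_induction with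
  | mem v h =>
    obtain ⟨k, _, rfl⟩ := h
    exact (HasDecayingSeries.kernel hα ha _).1
  | zero => exact HasDecayingSeries.zero hα ha
  | add v w _ _ h1 h2 => exact (h1.add hα ha h2).1
  | smul c v _ h => exact (h.smul hα ha c).1

lemma HasDecayingSeries.continuous {d α : ℕ} (hα : 1 ≤ α) {a : ℝ} (ha : 1 ≤ 2 * a)
    {v : (Fin d → ℝ) → ℝ} (hv : HasDecayingSeries α a v) : Continuous v := by
  obtain ⟨⟨C, hC⟩, h1⟩ := hv
  have h2 : Continuous fun x => ∑' h, fourierCoeffBox a v h * trig a h x := by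
    refine continuous_tsum (fun h => continuous_const.mul (trig_continuous a h))
      (summable_norm_of_le hα ha hC) (fun h x => ?_)
    rw [norm_mul]
    exact mul_le_of_le_one_right (norm_nonneg _) (norm_trig_le_one ha h x)
  have h3 : v = fun x => (∑' h, fourierCoeffBox a v h * trig a h x).re := by
    ext x
    rw [(h1 x).tsum_eq, Complex.ofReal_re]
  rw [h3]
  exact Complex.continuous_re.comp h2

lemma memLp_box_of_continuous {d : ℕ} {a : ℝ} {v : (Fin d → ℝ) → ℝ} (hv : Continuous v) :
    MemLp v 2 (volume.restrict (box d a)) := by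
  obtain ⟨C, hC⟩ := (isCompact_box d a).exists_bound_of_continuousOn hv.continuousOn
  refine MemLp.of_bound hv.aestronglyMeasurable C ?_
  filter_upwards [ae_restrict_mem (measurableSet_box d a)] with x hx using hC x hx

/-- The series represents v at every point of `ℝ^d`, not only almost everywhere on the box. This is
why the ridge solution is unique as a function. -/
lemma HasDecayingSeries.eq_zero {d α : ℕ} {a : ℝ} {v : (Fin d → ℝ) → ℝ}
    (hv : HasDecayingSeries α a v) (h0 : ∀ h, fourierCoeffBox a v h = 0) : v = 0 := by
  ext x
  have := hv.2 x
  simp only [h0, zero_mul] at this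
  exact_mod_cast this.unique hasSum_zero

/-! ### Aliasing on lattice points -/

lemma sum_exp_Icc {N : ℕ} (hN : 1 ≤ N) (m : ℤ) :
    ∑ k ∈ Finset.Icc 1 N, Complex.exp (2 * Real.pi * Complex.I * (k * m / N))
      = if (N : ℤ) ∣ m then (N : ℂ) else 0 := by
  have hN0 : (N : ℂ) ≠ 0 := by exact_mod_cast (show N ≠ 0 by omega)
  set ζ := Complex.exp (2 * Real.pi * Complex.I * (m / N))
  have e : ∀ k : ℕ, Complex.exp (2 * Real.pi * Complex.I * (k * m / N)) = ζ ^ k := by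
    intro k
    rw [← Complex.exp_nat_mul]
    congr 1
    ring
  have hζ : ζ = 1 ↔ (N : ℤ) ∣ m := by
    rw [Complex.exp_eq_one_iff]
    constructor
    · rintro ⟨n, hn⟩
      refine ⟨n, ?_⟩
      have h2 : (m : ℂ) / N = n := by
        have : (2 * Real.pi * Complex.I : ℂ) ≠ 0 := Complex.two_pi_I_ne_zero
        apply mul_left_cancel₀ this
        rw [hn]; ring
      rw [div_eq_iff hN0] at h2
      have h3 : (m : ℂ) = ((N * n : ℤ) : ℂ) := by rw [h2]; push_cast; ring
      exact_mod_cast h3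
    · rintro ⟨n, rfl⟩
      refine ⟨n, ?_⟩
      push_cast
      field_simp
  have hζN : ζ ^ N = 1 := by
    rw [← e, Complex.exp_eq_one_iff]
    exact ⟨m, by field_simp⟩
  simp only [e]
  split_ifs with h
  · simp [hζ.2 h]
  · have h1 : ∑ k ∈ Finset.Icc 1 N, ζ ^ k = ζ * ∑ k ∈ Finset.range N, ζ ^ k := by
      rw [Finset.mul_sum, ← Finset.Ico_succ_right_eq_Icc, Finset.sum_Ico_eq_sum_range]
      refine Finset.sum_congr (by simp) fun k _ => by rw [add_comm, pow_succ, mul_comm]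
    rw [h1, geom_sum_eq (fun h' => h (hζ.1 h')), hζN]
    simp

lemma trig_latticePoint {d : ℕ} {a : ℝ} (ha : 0 < a) (N : ℕ) (z : Fin d → ℕ) (k : ℕ)
    (h : Fin d → ℤ) :
    trig a h (latticePoint a N z k) = ((1 / Real.sqrt (2 * a) : ℝ) : ℂ) ^ d *
      Complex.exp (2 * Real.pi * Complex.I * (k * (∑ j, h j * (z j : ℤ) : ℤ) / N)) := by
  rw [trig, Finset.prod_mul_distrib, Finset.prod_const, Finset.card_univ, Fintype.card_fin]
  congr 1
  have e : ∀ j, Complex.exp (2 * Real.pi * Complex.I * (h j : ℂ) *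
      (((latticePoint a N z k j + a) / (2 * a) : ℝ) : ℂ))
      = Complex.exp (2 * Real.pi * Complex.I * ((h j : ℂ) * (k * (z j) / N))) := by
    intro j
    have e1 : (latticePoint a N z k j + a) / (2 * a)
        = (k : ℝ) * z j / N - ⌊(k : ℝ) * z j / N⌋ := by
      rw [latticePoint, Int.self_sub_floor]
      field_simp
      ring
    rw [e1, Complex.exp_eq_exp_iff_exists_int]
    refine ⟨-(h j * ⌊(k : ℝ) * z j / N⌋), ?_⟩
    push_cast
    ring
  rw [Finset.prod_congr rfl fun j _ => e j, ← Complex.exp_sum]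
  congr 1
  rw [← Finset.mul_sum]
  congr 1
  push_cast
  rw [Finset.mul_sum, Finset.sum_div]
  exact Finset.sum_congr rfl fun j _ => by ring

/-- Discrete orthogonality: two frequencies alias on the lattice points exactly when their
difference lies in the dual lattice. -/
lemma sum_trig_latticePoint {d : ℕ} {a : ℝ} (ha : 0 < a) {N : ℕ} (hN : 1 ≤ N) (z : Fin d → ℕ)
    (h k : Fin d → ℤ) :
    ∑ i ∈ Finset.Icc 1 N, trig a h (latticePoint a N z i) *
        (starRingEnd ℂ) (trig a k (latticePoint a N z i))
      = if (N : ℤ) ∣ ∑ j, (h - k) j * (z j : ℤ) then (((2 * a) ^ d)⁻¹ : ℝ) * (N : ℂ) else 0 := by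
  have e : ∀ i ∈ Finset.Icc 1 N, trig a h (latticePoint a N z i) *
        (starRingEnd ℂ) (trig a k (latticePoint a N z i))
      = (((2 * a) ^ d)⁻¹ : ℝ) * Complex.exp
        (2 * Real.pi * Complex.I * (i * (∑ j, (h - k) j * (z j : ℤ) : ℤ) / N)) := by
    intro i _
    rw [← trig_neg, trig_latticePoint ha, trig_latticePoint ha, mul_mul_mul_comm, ← Complex.exp_add,
      ← mul_pow, ← Complex.ofReal_mul, ← Complex.ofReal_pow]
    congr 2
    · rw [div_mul_div_comm, Real.mul_self_sqrt (by positivity), one_mul, one_div, inv_pow]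
    · have : ∑ j, (h - k) j * (z j : ℤ)
          = ∑ j, h j * (z j : ℤ) + ∑ j, (-k) j * (z j : ℤ) := by
        rw [← Finset.sum_add_distrib]
        exact Finset.sum_congr rfl fun j _ => by simp only [Pi.sub_apply, Pi.neg_apply]; ring
      rw [this]
      push_cast
      ring
  rw [Finset.sum_congr rfl e, ← Finset.mul_sum, sum_exp_Icc hN]
  split_ifs <;> simp

/-- Expand 0 ≤ (r⁻¹ − r‖b‖)²: both r⁻² and r²‖b‖² are summable. -/
lemma summable_norm_of_weighted {d α : ℕ} (hα : 1 ≤ α) {a : ℝ} (ha : 1 ≤ 2 * a)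
    {b : (Fin d → ℤ) → ℂ} (hb : Summable fun h => rBox α a h ^ 2 * ‖b h‖ ^ 2) :
    Summable fun h => ‖b h‖ := by
  refine Summable.of_nonneg_of_le (fun _ => norm_nonneg _) (fun h => ?_)
    ((summable_rBox_sq_inv hα ha).add hb)
  have hr := rBox_pos (α := α) (show 0 < a by linarith) h
  have : (0 : ℝ) ≤ ((rBox α a h)⁻¹ - rBox α a h * ‖b h‖) ^ 2 := sq_nonneg _
  have e : ((rBox α a h)⁻¹ - rBox α a h * ‖b h‖) ^ 2
      = (rBox α a h ^ 2)⁻¹ + rBox α a h ^ 2 * ‖b h‖ ^ 2 - 2 * ‖b h‖ := by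
    field_simp; ring
  linarith [norm_nonneg (b h)]

/-- A trigonometric series vanishing on the lattice points has vanishing sums of coefficients over
the cosets of the dual lattice. -/
lemma coeff_eq_neg_tsum_dual {d : ℕ} {a : ℝ} (ha : 1 ≤ 2 * a) {N : ℕ} (hN : 1 ≤ N)
    (z : Fin d → ℕ) {b : (Fin d → ℤ) → ℂ} (hb : Summable fun h => ‖b h‖)
    (h0 : ∀ k ∈ Finset.Icc 1 N, ∑' h, b h * trig a h (latticePoint a N z k) = 0) (h : Fin d → ℤ) :
    b h = -∑' l : {l : Fin d → ℤ // l ≠ 0 ∧ (N : ℤ) ∣ ∑ j, l j * (z j : ℤ)}, b (h + l.1) := by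
  classical
  have ha0 : 0 < a := by linarith
  have hs : ∀ k, Summable fun h' => b h' * trig a h' (latticePoint a N z k) *
      (starRingEnd ℂ) (trig a h (latticePoint a N z k)) := by
    intro k
    refine Summable.mul_right _ (Summable.of_norm (Summable.of_nonneg_of_le (fun _ => norm_nonneg _)
      (fun h => ?_) hb))
    rw [norm_mul]
    exact mul_le_of_le_one_right (norm_nonneg _) (norm_trig_le_one ha h _)
  -- Pairing the vanishing point values with the conjugate of `trig a h` over the lattice isolates
  -- the coset of h.
  have h1 : ∑' h', ∑ k ∈ Finset.Icc 1 N, b h' * trig a h' (latticePoint a N z k) *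
      (starRingEnd ℂ) (trig a h (latticePoint a N z k)) = 0 := by
    rw [Summable.tsum_finsetSum fun k _ => hs k]
    refine Finset.sum_eq_zero fun k hk => ?_
    rw [tsum_mul_right, h0 k hk, zero_mul]
  set D : ℂ := (((2 * a) ^ d)⁻¹ : ℝ) * (N : ℂ)
  have hD : D ≠ 0 := by
    have : (N : ℂ) ≠ 0 := by exact_mod_cast (show N ≠ 0 by omega)
    refine mul_ne_zero ?_ this
    exact_mod_cast (show ((2 * a) ^ d)⁻¹ ≠ 0 by positivity)
  have h2 : ∀ h', ∑ k ∈ Finset.Icc 1 N, b h' * trig a h' (latticePoint a N z k) *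
      (starRingEnd ℂ) (trig a h (latticePoint a N z k))
      = (if (N : ℤ) ∣ ∑ j, (h' - h) j * (z j : ℤ) then b h' else 0) * D := by
    intro h'
    simp only [mul_assoc]
    rw [← Finset.mul_sum, sum_trig_latticePoint ha0 hN]
    split_ifs <;> simp [D]
  simp only [h2] at h1
  rw [tsum_mul_right] at h1
  have h3 := (mul_eq_zero.1 h1).resolve_right hD
  rw [← (Equiv.addLeft h).tsum_eq] at h3
  simp only [Equiv.coe_addLeft, add_sub_cancel_left] at h3
  have hsum : Summable fun l : Fin d → ℤ =>
      if (N : ℤ) ∣ ∑ j, l j * (z j : ℤ) then b (h + l) else 0 := by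
    refine Summable.of_norm (Summable.of_nonneg_of_le (fun _ => norm_nonneg _) (fun l => ?_)
      ((Equiv.addLeft h).summable_iff.2 hb))
    split_ifs
    · rfl
    · simp
  rw [hsum.tsum_eq_add_tsum_ite 0] at h3
  simp only [Pi.zero_apply, zero_mul, Finset.sum_const_zero, dvd_zero, if_true, add_zero] at h3
  rw [eq_neg_of_add_eq_zero_left h3]
  congr 1
  rw [← tsum_subtype_eq_of_support_subset
    (s := {l : Fin d → ℤ | l ≠ 0 ∧ (N : ℤ) ∣ ∑ j, l j * (z j : ℤ)})]
  · refine tsum_congr fun l => ?_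
    rw [if_neg l.2.1, if_pos l.2.2]
  · intro l hl
    simp only [Function.mem_support, ne_eq, ite_eq_left_iff, Classical.not_imp, ite_eq_right_iff] at hl
    exact ⟨hl.1, hl.2.1⟩

/-- Cauchy-Schwarz for the splitting ‖u‖ = w^(-1/2) · w^(1/2)‖u‖. -/
lemma norm_tsum_sq_le {ι : Type*} {u : ι → ℂ} {w : ι → ℝ} (hw : ∀ i, 0 < w i)
    (hu : Summable fun i => w i * ‖u i‖ ^ 2) (hw' : Summable fun i => (w i)⁻¹) :
    ‖∑' i, u i‖ ^ 2 ≤ (∑' i, (w i)⁻¹) * ∑' i, w i * ‖u i‖ ^ 2 := by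
  have e1 : ∀ i, ((Real.sqrt (w i))⁻¹) ^ (2 : ℝ) = (w i)⁻¹ := fun i => by
    rw [Real.rpow_two, inv_pow, Real.sq_sqrt (hw i).le]
  have e2 : ∀ i, (Real.sqrt (w i) * ‖u i‖) ^ (2 : ℝ) = w i * ‖u i‖ ^ 2 := fun i => by
    rw [Real.rpow_two, mul_pow, Real.sq_sqrt (hw i).le]
  have hpq : (2 : ℝ).HolderConjugate 2 := Real.holderConjugate_iff.2 ⟨by norm_num, by norm_num⟩
  have h := Real.inner_le_Lp_mul_Lq_tsum_of_nonneg
    (f := fun i => (Real.sqrt (w i))⁻¹) (g := fun i => Real.sqrt (w i) * ‖u i‖)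
    hpq (fun i => by positivity)
    (fun i => by positivity) (by simpa only [e1] using hw') (by simpa only [e2] using hu)
  have hs := Real.summable_mul_of_Lp_Lq_of_nonneg
    (f := fun i => (Real.sqrt (w i))⁻¹) (g := fun i => Real.sqrt (w i) * ‖u i‖)
    hpq (fun i => by positivity)
    (fun i => by positivity) (by simpa only [e1] using hw') (by simpa only [e2] using hu)
  simp only [e1, e2] at h
  have e3 : ∀ i, (Real.sqrt (w i))⁻¹ * (Real.sqrt (w i) * ‖u i‖) = ‖u i‖ := fun i => by
    rw [← mul_assoc, inv_mul_cancel₀ (Real.sqrt_pos.2 (hw i)).ne', one_mul]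
  simp only [e3] at h hs
  have h2 := (norm_tsum_le_tsum_norm hs).trans h
  have p1 : 0 ≤ ∑' i, (w i)⁻¹ := tsum_nonneg fun i => (inv_pos.2 (hw i)).le
  have p2 : 0 ≤ ∑' i, w i * ‖u i‖ ^ 2 := tsum_nonneg fun i =>
    mul_nonneg (hw i).le (sq_nonneg _)
  calc ‖∑' i, u i‖ ^ 2 ≤ ((∑' i, (w i)⁻¹) ^ (1 / 2 : ℝ) *
        (∑' i, w i * ‖u i‖ ^ 2) ^ (1 / 2 : ℝ)) ^ 2 := by gcongr
    _ = _ := by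
      rw [mul_pow, ← Real.sqrt_eq_rpow, ← Real.sqrt_eq_rpow, Real.sq_sqrt p1, Real.sq_sqrt p2]

/-- The `L²` bound for a trigonometric series that vanishes on the lattice points. -/
theorem tsum_norm_sq_le_of_vanish {d α : ℕ} (hα : 1 ≤ α) {a : ℝ} (ha : 1 ≤ 2 * a) {N : ℕ}
    (hN : 1 ≤ N) (z : Fin d → ℕ) {b : (Fin d → ℤ) → ℂ}
    (hb : Summable fun h => rBox α a h ^ 2 * ‖b h‖ ^ 2)
    (h0 : ∀ k ∈ Finset.Icc 1 N, ∑' h, b h * trig a h (latticePoint a N z k) = 0)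
    {B : ℝ} (hB : 0 < B) :
    Summable (fun h => ‖b h‖ ^ 2) ∧ ∑' h, ‖b h‖ ^ 2 ≤
      (2 * a) ^ (2 * α * d) * (B⁻¹ + B * latticeCriterion α N z) *
        ∑' h, rBox α a h ^ 2 * ‖b h‖ ^ 2 := by
  have ha0 : 0 < a := by linarith
  set T : ℝ := (2 * a) ^ (2 * α * d)
  have hT : 0 < T := by positivity
  set K := ∑' h, rBox α a h ^ 2 * ‖b h‖ ^ 2
  have hK : 0 ≤ K := tsum_nonneg fun h => by positivity
  set p : (Fin d → ℤ) → Prop := fun l => l ≠ 0 ∧ (N : ℤ) ∣ ∑ j, l j * (z j : ℤ)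
  set G : (Fin d → ℤ) → ℝ := fun h => ∑' l : {l // p l}, (rUnitSq α (h + l.1))⁻¹
  have hb1 := summable_norm_of_weighted hα ha hb
  have hinj : ∀ h : Fin d → ℤ, Function.Injective fun l : {l // p l} => h + l.1 :=
    fun h x y hxy => Subtype.ext (add_left_cancel hxy)
  -- Cauchy-Schwarz over the coset of h with weights r². Comparing the box weights with those of the
  -- unit cube costs T.
  have hG : ∀ h, ‖b h‖ ^ 2 ≤ T * G h * K := by
    intro h
    rw [coeff_eq_neg_tsum_dual ha hN z hb1 h0 h, norm_neg]
    have hw' : Summable fun l : {l // p l} => (rBox α a (h + l.1) ^ 2)⁻¹ :=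
      (summable_rBox_sq_inv hα ha).comp_injective (hinj h)
    have hu : Summable fun l : {l // p l} => rBox α a (h + l.1) ^ 2 * ‖b (h + l.1)‖ ^ 2 :=
      hb.comp_injective (hinj h)
    refine (norm_tsum_sq_le (fun l => pow_pos (rBox_pos ha0 _) 2) hu hw').trans ?_
    have i1 : ∑' l : {l // p l}, (rBox α a (h + l.1) ^ 2)⁻¹ ≤ T * G h := by
      rw [← tsum_mul_left]
      exact hw'.tsum_le_tsum (fun l => rBox_sq_inv_le ha _)
        ((ofReal_latticeInner hα p h).1.mul_left T)
    have i2 : ∑' l : {l // p l}, rBox α a (h + l.1) ^ 2 * ‖b (h + l.1)‖ ^ 2 ≤ K :=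
      tsum_comp_le_tsum_of_inj hb (fun _ => by positivity) (hinj h)
    exact mul_le_mul i1 i2 (tsum_nonneg fun _ => by positivity)
      (mul_nonneg hT.le (latticeInner_nonneg α p h))
  -- Cutoff at B. Low frequencies use the aliasing bound `hG`, inflated by `B / rUnitSq α h ≥ 1` so
  -- that its sum is B times the lattice criterion. High frequencies use the Korobov norm, with gain
  -- B⁻¹.
  have hpt : ∀ h, ‖b h‖ ^ 2 ≤ T * B⁻¹ * (rBox α a h ^ 2 * ‖b h‖ ^ 2)
      + T * B * K * ((rUnitSq α h)⁻¹ * G h) := by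
    intro h
    have hR := rUnitSq_pos α h
    have hr := rBox_pos (α := α) ha0 h
    have hGh : 0 ≤ G h := latticeInner_nonneg α p h
    have n1 : 0 ≤ T * B⁻¹ * (rBox α a h ^ 2 * ‖b h‖ ^ 2) := by positivity
    have n2 : 0 ≤ T * B * K * ((rUnitSq α h)⁻¹ * G h) := by positivity
    rcases le_total (rUnitSq α h) B with hc | hc
    · have : 1 ≤ B * (rUnitSq α h)⁻¹ := by
        rw [← div_eq_mul_inv, one_le_div hR]; exact hc
      calc ‖b h‖ ^ 2 ≤ T * G h * K := hG h
        _ ≤ T * G h * K * (B * (rUnitSq α h)⁻¹) :=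
          le_mul_of_one_le_right (by positivity) this
        _ = T * B * K * ((rUnitSq α h)⁻¹ * G h) := by ring
        _ ≤ _ := by linarith
    · have i1 : 1 ≤ T * B⁻¹ * rBox α a h ^ 2 := by
        have := rUnitSq_le_rBox (α := α) ha h
        calc 1 = B * B⁻¹ := (mul_inv_cancel₀ hB.ne').symm
          _ ≤ T * rBox α a h ^ 2 * B⁻¹ := by gcongr; linarith
          _ = _ := by ring
      have : ‖b h‖ ^ 2 ≤ T * B⁻¹ * rBox α a h ^ 2 * ‖b h‖ ^ 2 :=
        le_mul_of_one_le_left (by positivity) i1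
      linarith
  have hS := (ofReal_latticeCriterion hα N z).1
  have hsum := (hb.mul_left (T * B⁻¹)).add (hS.mul_left (T * B * K))
  have hsq : Summable fun h => ‖b h‖ ^ 2 :=
    Summable.of_nonneg_of_le (fun _ => by positivity) hpt hsum
  refine ⟨hsq, (hsq.tsum_le_tsum hpt hsum).trans_eq ?_⟩
  rw [Summable.tsum_add (hb.mul_left _) (hS.mul_left _), tsum_mul_left, tsum_mul_left,
    latticeCriterion]
  ring

/-! ### Galerkin approximation in weighted sequence spaces -/

section Galerkin

open scoped InnerProductSpace

variable {V E : Type*} [AddCommGroup V] [Module ℝ V] [NormedAddCommGroup E] [InnerProductSpace ℝ E]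

lemma exists_galerkin [FiniteDimensional ℝ V] (Φ : V →ₗ[ℝ] E) (e : E) :
    ∃ g : V, ∀ w, ⟪Φ g, Φ w⟫_ℝ = ⟪e, Φ w⟫_ℝ := by
  have : FiniteDimensional ℝ (LinearMap.range Φ) := inferInstance
  obtain ⟨g, hg⟩ := ((LinearMap.range Φ).orthogonalProjectionOnto e).2
  refine ⟨g, fun w => ?_⟩
  have h := (LinearMap.range Φ).starProjection_inner_eq_zero e (Φ w) ⟨w, rfl⟩
  rw [inner_sub_left, sub_eq_zero] at h
  rw [hg, h]
  rfl

lemma galerkin_unique {Φ : V →ₗ[ℝ] E} (hΦ : Function.Injective Φ) {e : E} {g g' : V}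
    (hg : ∀ w, ⟪Φ g, Φ w⟫_ℝ = ⟪e, Φ w⟫_ℝ) (hg' : ∀ w, ⟪Φ g', Φ w⟫_ℝ = ⟪e, Φ w⟫_ℝ) : g = g' := by
  apply hΦ
  rw [← sub_eq_zero, ← inner_self_eq_zero (𝕜 := ℝ), ← map_sub, map_sub, inner_sub_left, ← map_sub,
    hg, hg', sub_self]

/-- Test the Galerkin equation with g − s and apply Cauchy-Schwarz. -/
lemma norm_galerkin_sub_le {Φ : V →ₗ[ℝ] E} {e : E} {g : V}
    (hg : ∀ w, ⟪Φ g, Φ w⟫_ℝ = ⟪e, Φ w⟫_ℝ) (s : V) : ‖Φ g - Φ s‖ ≤ ‖e - Φ s‖ := by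
  rcases eq_or_ne (‖Φ g - Φ s‖) 0 with h0 | h0
  · rw [h0]; exact norm_nonneg _
  have h1 : ‖Φ g - Φ s‖ * ‖Φ g - Φ s‖ ≤ ‖e - Φ s‖ * ‖Φ g - Φ s‖ := by
    rw [← real_inner_self_eq_norm_mul_norm]
    have h2 : ⟪Φ g - Φ s, Φ g - Φ s⟫_ℝ = ⟪e - Φ s, Φ g - Φ s⟫_ℝ := by
      rw [inner_sub_left, inner_sub_left, ← map_sub, hg]
    rw [h2]
    exact real_inner_le_norm _ _
  exact le_of_mul_le_mul_right h1 (lt_of_le_of_ne (norm_nonneg _) h0.symm)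

/-- Here e is the data, c the target and s any approximant of c. The triangle inequality gives ‖Φg −
c‖ ≤ ‖e − c‖ + 2‖c − Φs‖, and squaring produces 2 and 8. -/
lemma norm_galerkin_error_le {Φ : V →ₗ[ℝ] E} {e : E} {g : V}
    (hg : ∀ w, ⟪Φ g, Φ w⟫_ℝ = ⟪e, Φ w⟫_ℝ) (c : E) (s : V) :
    ‖Φ g - c‖ ^ 2 ≤ 2 * ‖e - c‖ ^ 2 + 8 * ‖c - Φ s‖ ^ 2 := by
  have h1 := norm_galerkin_sub_le hg s
  have h2 : ‖e - Φ s‖ ≤ ‖e - c‖ + ‖c - Φ s‖ := norm_sub_le_norm_sub_add_norm_sub _ _ _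
  have h3 : ‖Φ g - c‖ ≤ ‖Φ g - Φ s‖ + ‖c - Φ s‖ := by
    rw [norm_sub_rev c]
    exact norm_sub_le_norm_sub_add_norm_sub _ _ _
  nlinarith [norm_nonneg (Φ g - c), norm_nonneg (e - c), norm_nonneg (c - Φ s),
    sq_nonneg (‖e - c‖ - 2 * ‖c - Φ s‖)]

/-- Pythagoras: the residual is orthogonal to Φg. -/
lemma norm_sub_galerkin_le {Φ : V →ₗ[ℝ] E} {e : E} {g : V}
    (hg : ∀ w, ⟪Φ g, Φ w⟫_ℝ = ⟪e, Φ w⟫_ℝ) : ‖e - Φ g‖ ≤ ‖e‖ := by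
  have h : ⟪e - Φ g, Φ g⟫_ℝ = 0 := by rw [inner_sub_left, hg, sub_self]
  have h2 := norm_add_sq_eq_norm_sq_add_norm_sq_of_inner_eq_zero _ _ h
  rw [sub_add_cancel] at h2
  nlinarith [norm_nonneg e, norm_nonneg (e - Φ g), norm_nonneg (Φ g)]

end Galerkin

/-! ### Weighted ℓ² spaces of Fourier coefficients and the trial space inside them. -/

section Weighted

open scoped InnerProductSpace

variable {ι : Type*}

lemma memlp_weighted {W : ι → ℝ} (hW : ∀ i, 0 ≤ W i) {b : ι → ℂ}
    (hb : Summable fun i => W i * ‖b i‖ ^ 2) :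
    Memℓp (fun i => ((Real.sqrt (W i) : ℝ) : ℂ) * b i) 2 := by
  rw [memℓp_gen_iff (by norm_num)]
  convert! hb using 2 with i
  rw [ENNReal.toReal_ofNat, Real.rpow_two, norm_mul, mul_pow, Complex.norm_real, Real.norm_eq_abs,
    sq_abs, Real.sq_sqrt (hW i)]

/-- The sequence `(√W_i b_i)` as an element of `ℓ²`. -/
def weightedVec (W : ι → ℝ) (hW : ∀ i, 0 ≤ W i) (b : ι → ℂ)
    (hb : Summable fun i => W i * ‖b i‖ ^ 2) : lp (fun _ : ι => ℂ) 2 :=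
  ⟨fun i => ((Real.sqrt (W i) : ℝ) : ℂ) * b i, memlp_weighted hW hb⟩

lemma weightedVec_apply {W : ι → ℝ} (hW : ∀ i, 0 ≤ W i) {b : ι → ℂ}
    (hb : Summable fun i => W i * ‖b i‖ ^ 2) (i : ι) :
    weightedVec W hW b hb i = ((Real.sqrt (W i) : ℝ) : ℂ) * b i := rfl

lemma hasSum_inner_weightedVec {W : ι → ℝ} (hW : ∀ i, 0 ≤ W i) {b c : ι → ℂ}
    (hb : Summable fun i => W i * ‖b i‖ ^ 2) (hc : Summable fun i => W i * ‖c i‖ ^ 2) :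
    HasSum (fun i => W i * (b i * (starRingEnd ℂ) (c i)).re)
      ⟪weightedVec W hW b hb, weightedVec W hW c hc⟫_ℝ := by
  convert! lp.hasSum_inner (𝕜 := ℝ) (weightedVec W hW b hb) (weightedVec W hW c hc) using 2 with i
  rw [weightedVec_apply, weightedVec_apply, Complex.inner, map_mul, Complex.conj_ofReal]
  have e : ((Real.sqrt (W i) : ℝ) : ℂ) * (Real.sqrt (W i) : ℝ) = (W i : ℂ) := by
    rw [← Complex.ofReal_mul, Real.mul_self_sqrt (hW i)]
  rw [show ((Real.sqrt (W i) : ℝ) : ℂ) * c i * (((Real.sqrt (W i) : ℝ) : ℂ) * (starRingEnd ℂ) (b i))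
    = (W i : ℂ) * (c i * (starRingEnd ℂ) (b i)) by rw [← e]; ring, Complex.re_ofReal_mul]
  congr 1
  rw [← Complex.conj_re, map_mul, Complex.conj_conj, mul_comm]

lemma hasSum_norm_weightedVec_sq {W : ι → ℝ} (hW : ∀ i, 0 ≤ W i) {b : ι → ℂ}
    (hb : Summable fun i => W i * ‖b i‖ ^ 2) :
    HasSum (fun i => W i * ‖b i‖ ^ 2) (‖weightedVec W hW b hb‖ ^ 2) := by
  rw [← real_inner_self_eq_norm_sq]
  convert! hasSum_inner_weightedVec hW hb hb using 2 with i
  rw [Complex.mul_conj, Complex.ofReal_re, Complex.normSq_eq_norm_sq]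

lemma hasSum_norm_weightedVec_sub_sq {W : ι → ℝ} (hW : ∀ i, 0 ≤ W i) {b c : ι → ℂ}
    (hb : Summable fun i => W i * ‖b i‖ ^ 2) (hc : Summable fun i => W i * ‖c i‖ ^ 2) :
    HasSum (fun i => W i * ‖b i - c i‖ ^ 2) (‖weightedVec W hW b hb - weightedVec W hW c hc‖ ^ 2) := by
  have h1 : Summable fun i => W i * ‖b i - c i‖ ^ 2 := by
    refine Summable.of_nonneg_of_le (fun i => mul_nonneg (hW i) (sq_nonneg _)) (fun i => ?_)
      ((hb.add hc).mul_left 2)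
    have h2 : ‖b i - c i‖ ^ 2 ≤ 2 * (‖b i‖ ^ 2 + ‖c i‖ ^ 2) := by
      have := norm_sub_le (b i) (c i)
      nlinarith [norm_nonneg (b i - c i), norm_nonneg (b i), norm_nonneg (c i),
        sq_nonneg (‖b i‖ - ‖c i‖)]
    calc _ ≤ W i * (2 * (‖b i‖ ^ 2 + ‖c i‖ ^ 2)) := mul_le_mul_of_nonneg_left h2 (hW i)
      _ = _ := by ring
  have e : weightedVec W hW b hb - weightedVec W hW c hc
      = weightedVec W hW (fun i => b i - c i) h1 := by
    ext i
    change ((Real.sqrt (W i) : ℝ) : ℂ) * b i - ((Real.sqrt (W i) : ℝ) : ℂ) * c i = _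
    rw [weightedVec_apply, mul_sub]
  rw [e]
  exact hasSum_norm_weightedVec_sq hW h1

end Weighted

instance finiteDimensional_trialSpace {d : ℕ} (α : ℕ) (a : ℝ) (N : ℕ) (z : Fin d → ℕ) :
    FiniteDimensional ℝ (trialSpace α a N z) :=
  FiniteDimensional.span_of_finite ℝ ((Set.finite_Icc 1 N).image _)

/-- Coefficients of order r⁻² against weights of order r² leave r⁻², which is summable. -/
lemma HasDecayingSeries.summable_weighted {d α : ℕ} (hα : 1 ≤ α) {a : ℝ} (ha : 1 ≤ 2 * a)
    {v : (Fin d → ℝ) → ℝ} (hv : HasDecayingSeries α a v) {W : (Fin d → ℤ) → ℝ} (hW : ∀ h, 0 ≤ W h)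
    {B : ℝ} (hWB : ∀ h, W h ≤ B * rBox α a h ^ 2) :
    Summable fun h => W h * ‖fourierCoeffBox a v h‖ ^ 2 := by
  obtain ⟨⟨C, hC⟩, _⟩ := hv
  refine Summable.of_nonneg_of_le (fun h => mul_nonneg (hW h) (sq_nonneg _)) (fun h => ?_)
    ((summable_rBox_sq_inv hα ha).mul_left (B * C ^ 2))
  have hr := rBox_pos (α := α) (show 0 < a by linarith) h
  calc W h * ‖fourierCoeffBox a v h‖ ^ 2
      ≤ (B * rBox α a h ^ 2) * (C * (rBox α a h ^ 2)⁻¹) ^ 2 := by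
        have := hC h
        have := hWB h
        have := hW h
        gcongr
        linarith
    _ = _ := by field_simp

/-- The embedding of the trial space into `ℓ²` by weighted Fourier coefficients. -/
def trialEmb {d α : ℕ} (hα : 1 ≤ α) {a : ℝ} (ha : 1 ≤ 2 * a) (N : ℕ) (z : Fin d → ℕ)
    {W : (Fin d → ℤ) → ℝ} (hW : ∀ h, 0 ≤ W h) {B : ℝ} (hWB : ∀ h, W h ≤ B * rBox α a h ^ 2) :
    trialSpace α a N z →ₗ[ℝ] lp (fun _ : Fin d → ℤ => ℂ) 2 where
  toFun v := weightedVec W hW (fourierCoeffBox a v.1)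
    ((hasDecayingSeries_of_mem hα ha v.2).summable_weighted hα ha hW hWB)
  map_add' v w := by
    ext h
    have := ((hasDecayingSeries_of_mem hα ha v.2).add hα ha (hasDecayingSeries_of_mem hα ha w.2)).2 h
    change ((Real.sqrt (W h) : ℝ) : ℂ) * fourierCoeffBox a (v.1 + w.1) h
      = ((Real.sqrt (W h) : ℝ) : ℂ) * _ + ((Real.sqrt (W h) : ℝ) : ℂ) * _
    rw [this, mul_add]
  map_smul' c v := by
    ext h
    have := ((hasDecayingSeries_of_mem hα ha v.2).smul hα ha c).2 h
    change ((Real.sqrt (W h) : ℝ) : ℂ) * fourierCoeffBox a (c • v.1) h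
      = c • (((Real.sqrt (W h) : ℝ) : ℂ) * _)
    rw [this, mul_smul_comm]

lemma trialEmb_injective {d α : ℕ} (hα : 1 ≤ α) {a : ℝ} (ha : 1 ≤ 2 * a) (N : ℕ) (z : Fin d → ℕ)
    {W : (Fin d → ℤ) → ℝ} (hW : ∀ h, 0 < W h) {B : ℝ} (hWB : ∀ h, W h ≤ B * rBox α a h ^ 2) :
    Function.Injective (trialEmb hα ha N z (fun h => (hW h).le) hWB) := by
  rw [injective_iff_map_eq_zero]
  intro v hv
  refine Subtype.ext ((hasDecayingSeries_of_mem hα ha v.2).eq_zero fun h => ?_)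
  have h1 : ((Real.sqrt (W h) : ℝ) : ℂ) * fourierCoeffBox a v.1 h = 0 :=
    congrArg (fun f : lp (fun _ : Fin d → ℤ => ℂ) 2 => f h) hv
  refine (mul_eq_zero.1 h1).resolve_left ?_
  exact_mod_cast (Real.sqrt_pos.2 (hW h)).ne'

/-- Approximation in the trial space of a sequence of coefficients of finite Korobov norm. -/
theorem exists_trial_approx {d α : ℕ} (hα : 1 ≤ α) {a : ℝ} (ha : 1 ≤ 2 * a) {N : ℕ}
    (hN : 1 ≤ N) (z : Fin d → ℕ) {c : (Fin d → ℤ) → ℂ}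
    (hc : Summable fun h => rBox α a h ^ 2 * ‖c h‖ ^ 2)
    (hsymm : ∀ h, c (-h) = (starRingEnd ℂ) (c h)) {B : ℝ} (hB : 0 < B) :
    ∃ s ∈ trialSpace α a N z,
      (Summable fun h => rBox α a h ^ 2 * ‖c h - fourierCoeffBox a s h‖ ^ 2) ∧
      ∑' h, rBox α a h ^ 2 * ‖c h - fourierCoeffBox a s h‖ ^ 2 ≤ ∑' h, rBox α a h ^ 2 * ‖c h‖ ^ 2 ∧
      Summable (fun h => ‖c h - fourierCoeffBox a s h‖ ^ 2) ∧
      ∑' h, ‖c h - fourierCoeffBox a s h‖ ^ 2 ≤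
        (2 * a) ^ (2 * α * d) * (B⁻¹ + B * latticeCriterion α N z) *
          ∑' h, rBox α a h ^ 2 * ‖c h‖ ^ 2 := by
  have ha0 : 0 < a := by linarith
  have hW : ∀ h : Fin d → ℤ, 0 ≤ rBox α a h ^ 2 := fun h => sq_nonneg _
  set Φ := trialEmb hα ha N z hW (B := 1) (fun h => by rw [one_mul])
  set e := weightedVec _ hW c hc
  -- The approximant is the projection in the Korobov norm. As the trial space is spanned by
  -- reproducing kernels, orthogonality of the residual means that it vanishes at the lattice
  -- points.
  obtain ⟨s, hs⟩ := exists_galerkin Φ e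
  have hsd := hasDecayingSeries_of_mem hα ha s.2
  have hnorm := hasSum_norm_weightedVec_sub_sq hW hc
    (hsd.summable_weighted hα ha hW (B := 1) (fun h => by rw [one_mul]))
  have hle : ∑' h, rBox α a h ^ 2 * ‖c h - fourierCoeffBox a s.1 h‖ ^ 2
      ≤ ∑' h, rBox α a h ^ 2 * ‖c h‖ ^ 2 := by
    rw [hnorm.tsum_eq, (hasSum_norm_weightedVec_sq hW hc).tsum_eq]
    exact pow_le_pow_left₀ (norm_nonneg _) (norm_sub_galerkin_le hs) 2
  have hvan : ∀ k ∈ Finset.Icc 1 N,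
      ∑' h, (c h - fourierCoeffBox a s.1 h) * trig a h (latticePoint a N z k) = 0 := by
    intro k hk
    set y := latticePoint a N z k
    have hmem : korobovKernel α a y ∈ trialSpace α a N z :=
      Submodule.subset_span ⟨k, by simpa using hk, rfl⟩
    have h1 := hs ⟨_, hmem⟩
    have hK := HasDecayingSeries.kernel hα ha (d := d) y
    have hKs := hK.1.summable_weighted hα ha hW (B := 1) (fun h => by rw [one_mul])
    have i1 := hasSum_inner_weightedVec hW hc hKs
    have i2 := hasSum_inner_weightedVec hW
      (hsd.summable_weighted hα ha hW (B := 1) (fun h => by rw [one_mul])) hKs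
    have i3 := i1.sub i2
    change HasSum _ (inner ℝ e (Φ ⟨_, hmem⟩) - inner ℝ (Φ s) (Φ ⟨_, hmem⟩)) at i3
    rw [h1, sub_self] at i3
    -- Reproducing property: the weight r² cancels the r⁻² of the kernel coefficients and leaves
    -- point evaluation at y.
    have e1 : ∀ h, rBox α a h ^ 2 * (c h * (starRingEnd ℂ)
          (fourierCoeffBox a (korobovKernel α a y) h)).re
        - rBox α a h ^ 2 * (fourierCoeffBox a s.1 h * (starRingEnd ℂ)
          (fourierCoeffBox a (korobovKernel α a y) h)).re
        = ((c h - fourierCoeffBox a s.1 h) * trig a h y).re := by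
      intro h
      have hr := (rBox_pos (α := α) ha0 h).ne'
      rw [hK.2, map_mul, Complex.conj_conj, Complex.conj_ofReal, ← mul_sub, ← Complex.sub_re,
        ← sub_mul, mul_left_comm, Complex.re_ofReal_mul, ← mul_assoc,
        mul_inv_cancel₀ (pow_ne_zero 2 hr), one_mul]
    simp only [e1] at i3
    have hsum : Summable fun h => (c h - fourierCoeffBox a s.1 h) * trig a h y := by
      refine Summable.of_norm (Summable.of_nonneg_of_le (fun _ => norm_nonneg _) (fun h => ?_)
        (summable_norm_of_weighted hα ha hnorm.summable))
      rw [norm_mul]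
      exact mul_le_of_le_one_right (norm_nonneg _) (norm_trig_le_one ha h _)
    have hre : (∑' h, (c h - fourierCoeffBox a s.1 h) * trig a h y).re = 0 :=
      (Complex.hasSum_re hsum.hasSum).unique i3
    -- The real inner product controls only the real part. The symmetry of c under h ↦ −h makes the
    -- series real.
    have hconj : (starRingEnd ℂ) (∑' h, (c h - fourierCoeffBox a s.1 h) * trig a h y)
        = ∑' h, (c h - fourierCoeffBox a s.1 h) * trig a h y := by
      rw [Complex.conj_tsum]
      rw [← (Equiv.neg (Fin d → ℤ)).tsum_eq
        fun h => (c h - fourierCoeffBox a s.1 h) * trig a h y]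
      refine tsum_congr fun h => ?_
      rw [Equiv.neg_apply, hsymm, fourierCoeffBox_neg, trig_neg, map_mul, map_sub]
    rw [← Complex.conj_eq_iff_re.1 hconj, hre, Complex.ofReal_zero]
  have hfin := tsum_norm_sq_le_of_vanish hα ha hN z hnorm.summable hvan hB
  refine ⟨s.1, s.2, hnorm.summable, hle, hfin.1, hfin.2.trans ?_⟩
  have hS : 0 ≤ latticeCriterion α N z :=
    tsum_nonneg fun h => mul_nonneg (inv_nonneg.2 (rUnitSq_pos α h).le)
      (latticeInner_nonneg α _ h)
  gcongr

/-! ### The ridge solution for a fixed sample -/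

/-- The empirical Fourier coefficients of a sample. -/
def empCoeff {d M : ℕ} (a : ℝ) (y : Fin M → Fin d → ℝ) (h : Fin d → ℤ) : ℂ :=
  ((1 / (M : ℝ) : ℝ) : ℂ) * ∑ m, (starRingEnd ℂ) (trig a h (y m))

lemma norm_empCoeff_le_one {d M : ℕ} {a : ℝ} (ha : 1 ≤ 2 * a) (y : Fin M → Fin d → ℝ)
    (h : Fin d → ℤ) : ‖empCoeff a y h‖ ≤ 1 := by
  have h1 : ‖∑ m, (starRingEnd ℂ) (trig a h (y m))‖ ≤ M := by
    refine (norm_sum_le_of_le _ (fun m _ => ?_)).trans_eq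
      (show ∑ _m : Fin M, (1 : ℝ) = M by simp)
    rw [RCLike.norm_conj]
    exact norm_trig_le_one ha h _
  rw [empCoeff, norm_mul, Complex.norm_real, Real.norm_eq_abs, abs_of_nonneg (by positivity)]
  calc 1 / (M : ℝ) * _ ≤ 1 / (M : ℝ) * M := by gcongr
    _ ≤ 1 := by rw [one_div]; exact inv_mul_le_one

/-- Pointwise convergence of the series turns the sample mean into a pairing with `empCoeff`. By
periodicity the unwrapped points may be used in the coefficients. -/
lemma hasSum_empCoeff {d M α : ℕ} {a : ℝ} (ha : 0 < a) (y : Fin M → Fin d → ℝ)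
    {w : (Fin d → ℝ) → ℝ} (hw : HasDecayingSeries α a w) :
    HasSum (fun h => (empCoeff a y h * (starRingEnd ℂ) (fourierCoeffBox a w h)).re)
      ((1 / (M : ℝ)) * ∑ m, w (wrap a (y m))) := by
  have h1 : HasSum (fun h => ((1 / (M : ℝ) : ℝ) : ℂ) *
      ∑ m, fourierCoeffBox a w h * trig a h (y m))
      (((1 / (M : ℝ) : ℝ) : ℂ) * ∑ m, (w (wrap a (y m)) : ℂ)) := by
    refine HasSum.mul_left _ (hasSum_sum fun m _ => ?_)
    have := hw.2 (wrap a (y m))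
    simpa only [trig_wrap ha] using this
  have h2 := Complex.hasSum_re h1
  convert! h2 using 2 with h
  · rw [← Complex.conj_re, map_mul, Complex.conj_conj, empCoeff, map_mul, Complex.conj_ofReal,
      map_sum, mul_assoc, mul_comm _ (fourierCoeffBox a w h), Finset.mul_sum]
    simp only [Complex.conj_conj]
  · rw [← Complex.ofReal_sum, ← Complex.ofReal_mul, Complex.ofReal_re]

/-- The weights of the energy norm of the ridge problem. -/
def ridgeWeight {d : ℕ} (α : ℕ) (a lam : ℝ) (h : Fin d → ℤ) : ℝ := 1 + lam * rBox α a h ^ 2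

lemma one_le_ridgeWeight {d α : ℕ} {a lam : ℝ} (hl : 0 < lam) (h : Fin d → ℤ) :
    1 ≤ ridgeWeight α a lam h := by
  rw [ridgeWeight]; nlinarith [sq_nonneg (rBox α a h)]

lemma ridgeWeight_pos {d α : ℕ} {a lam : ℝ} (hl : 0 < lam) (h : Fin d → ℤ) :
    0 < ridgeWeight α a lam h := zero_lt_one.trans_le (one_le_ridgeWeight hl h)

lemma ridgeWeight_le {d α : ℕ} {a lam : ℝ} (ha : 1 ≤ 2 * a) (h : Fin d → ℤ) :
    ridgeWeight α a lam h ≤ ((2 * a) ^ (2 * α * d) + lam) * rBox α a h ^ 2 := by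
  have := (one_le_rUnitSq α h).trans (rUnitSq_le_rBox ha h)
  rw [ridgeWeight, add_mul]
  linarith

lemma summable_ridgeWeight_inv {d α : ℕ} (hα : 1 ≤ α) {a lam : ℝ} (ha : 1 ≤ 2 * a) (hl : 0 < lam) :
    Summable fun h : Fin d → ℤ => (ridgeWeight α a lam h)⁻¹ := by
  refine Summable.of_nonneg_of_le (fun h => (inv_pos.2 (ridgeWeight_pos hl h)).le) (fun h => ?_)
    ((summable_rBox_sq_inv hα ha).mul_left lam⁻¹)
  have hr := rBox_pos (α := α) (show 0 < a by linarith) h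
  rw [← mul_inv]
  refine inv_anti₀ (by positivity) ?_
  rw [ridgeWeight]
  linarith

lemma hasSum_ridge_form {d α : ℕ} (hα : 1 ≤ α) {a : ℝ} (ha : 1 ≤ 2 * a) (lam : ℝ)
    {v w : (Fin d → ℝ) → ℝ} (hv : HasDecayingSeries α a v) (hw : HasDecayingSeries α a w) :
    HasSum (fun h => ridgeWeight α a lam h *
        (fourierCoeffBox a v h * (starRingEnd ℂ) (fourierCoeffBox a w h)).re)
      ((∫ x in box d a, v x * w x) + lam * korobovInner α a v w) := by
  have ha0 : 0 < a := by linarith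
  have h1 := Complex.hasSum_re (hasSum_fourierCoeffBox_mul_conj ha0
    (memLp_box_of_continuous (hv.continuous hα ha)) (memLp_box_of_continuous (hw.continuous hα ha)))
  rw [Complex.ofReal_re] at h1
  have sv := hv.summable_weighted hα ha (W := fun h => rBox α a h ^ 2) (fun h => sq_nonneg _)
    (B := 1) (fun h => by rw [one_mul])
  have sw := hw.summable_weighted hα ha (W := fun h => rBox α a h ^ 2) (fun h => sq_nonneg _)
    (B := 1) (fun h => by rw [one_mul])
  have h2 : Summable fun h => fourierCoeffBox a v h * (starRingEnd ℂ) (fourierCoeffBox a w h) *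
      ((rBox α a h ^ 2 : ℝ) : ℂ) := by
    refine Summable.of_norm (Summable.of_nonneg_of_le (fun _ => norm_nonneg _) (fun h => ?_)
      (sv.add sw))
    rw [norm_mul, norm_mul, RCLike.norm_conj, Complex.norm_real, Real.norm_eq_abs,
      abs_of_nonneg (sq_nonneg _), ← mul_add, mul_comm]
    refine mul_le_mul_of_nonneg_left ?_ (sq_nonneg _)
    nlinarith [sq_nonneg (‖fourierCoeffBox a v h‖ - ‖fourierCoeffBox a w h‖),
      sq_nonneg (‖fourierCoeffBox a v h‖ + ‖fourierCoeffBox a w h‖)]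
  have h3 := (Complex.hasSum_re h2.hasSum).mul_left lam
  refine (h1.add h3).congr_fun fun h => ?_
  rw [mul_comm (_ * _) ((rBox α a h ^ 2 : ℝ) : ℂ), Complex.re_ofReal_mul, ridgeWeight]
  ring

/-- Existence, uniqueness and an error bound for the ridge solution. -/
theorem exists_ridgeSolution {d α M : ℕ} (hα : 1 ≤ α) {a : ℝ} (ha : 1 ≤ 2 * a) {N : ℕ}
    (hN : 1 ≤ N) (z : Fin d → ℕ) {lam : ℝ} (hl : 0 < lam) {c : (Fin d → ℤ) → ℂ}
    (hc : Summable fun h => rBox α a h ^ 2 * ‖c h‖ ^ 2)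
    (hsymm : ∀ h, c (-h) = (starRingEnd ℂ) (c h)) {B : ℝ} (hB : 0 < B)
    (y : Fin M → Fin d → ℝ) :
    ∃ g, (∀ v, IsRidgeSolution α a lam N z (fun m => wrap a (y m)) v ↔ v = g) ∧
      HasDecayingSeries α a g ∧ Summable (fun h => ‖fourierCoeffBox a g h - c h‖ ^ 2) ∧
      Summable (fun h => (ridgeWeight α a lam h)⁻¹ * ‖empCoeff a y h - c h‖ ^ 2) ∧
      ∑' h, ‖fourierCoeffBox a g h - c h‖ ^ 2 ≤
        4 * ∑' h, (ridgeWeight α a lam h)⁻¹ * ‖empCoeff a y h - c h‖ ^ 2 +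
        (12 * lam + 8 * ((2 * a) ^ (2 * α * d) * (B⁻¹ + B * latticeCriterion α N z))) *
          ∑' h, rBox α a h ^ 2 * ‖c h‖ ^ 2 := by
  have ha0 : 0 < a := by linarith
  set W : (Fin d → ℤ) → ℝ := ridgeWeight α a lam
  have hW : ∀ h, 0 < W h := ridgeWeight_pos hl
  have hW0 : ∀ h, 0 ≤ W h := fun h => (hW h).le
  have hWinv := summable_ridgeWeight_inv (d := d) hα ha hl
  have hWB : ∀ h, W h ≤ ((2 * a) ^ (2 * α * d) + lam) * rBox α a h ^ 2 := ridgeWeight_le ha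
  have hcW : Summable fun h => W h * ‖c h‖ ^ 2 := by
    refine Summable.of_nonneg_of_le (fun h => mul_nonneg (hW0 h) (sq_nonneg _)) (fun h => ?_)
      (hc.mul_left ((2 * a) ^ (2 * α * d) + lam))
    rw [← mul_assoc]
    exact mul_le_mul_of_nonneg_right (hWB h) (sq_nonneg _)
  have heW : Summable fun h => W h * ‖((W h)⁻¹ : ℝ) * empCoeff a y h‖ ^ 2 := by
    refine Summable.of_nonneg_of_le (fun h => mul_nonneg (hW0 h) (sq_nonneg _)) (fun h => ?_) hWinv
    have h1 := norm_empCoeff_le_one ha y h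
    have h2 := hW h
    rw [norm_mul, Complex.norm_real, Real.norm_eq_abs, abs_of_pos (inv_pos.2 h2), mul_pow]
    calc W h * ((W h)⁻¹ ^ 2 * ‖empCoeff a y h‖ ^ 2)
        = (W h)⁻¹ * ‖empCoeff a y h‖ ^ 2 := by field_simp
      _ ≤ (W h)⁻¹ * 1 := by
        refine mul_le_mul_of_nonneg_left ?_ (inv_pos.2 h2).le
        exact pow_le_one₀ (norm_nonneg _) h1
      _ = _ := mul_one _
  set Φ := trialEmb hα ha N z hW0 hWB
  have hinj : Function.Injective Φ := trialEmb_injective hα ha N z hW hWB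
  -- The data vector is W⁻¹ · `empCoeff`: its W-weighted inner product with a trial function is the
  -- right-hand side of the ridge equation (`hrhs`).
  set e := weightedVec W hW0 _ heW
  set cA := weightedVec W hW0 c hcW
  have hVW : ∀ v : trialSpace α a N z, Summable fun h => W h * ‖fourierCoeffBox a v.1 h‖ ^ 2 :=
    fun v => (hasDecayingSeries_of_mem hα ha v.2).summable_weighted hα ha hW0 hWB
  have hform : ∀ v w : trialSpace α a N z, inner ℝ (Φ v) (Φ w)
      = (∫ x in box d a, v.1 x * w.1 x) + lam * korobovInner α a v.1 w.1 := fun v w =>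
    (hasSum_inner_weightedVec hW0 (hVW v) (hVW w)).unique (hasSum_ridge_form hα ha lam
      (hasDecayingSeries_of_mem hα ha v.2) (hasDecayingSeries_of_mem hα ha w.2))
  have hrhs : ∀ w : trialSpace α a N z, inner ℝ e (Φ w)
      = (1 / (M : ℝ)) * ∑ m, w.1 (wrap a (y m)) := by
    intro w
    refine (hasSum_inner_weightedVec hW0 heW (hVW w)).unique ?_
    refine (hasSum_empCoeff ha0 y (hasDecayingSeries_of_mem hα ha w.2)).congr_fun fun h => ?_
    rw [mul_assoc, Complex.re_ofReal_mul, ← mul_assoc, mul_inv_cancel₀ (hW h).ne', one_mul]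
  obtain ⟨g, hg⟩ := exists_galerkin Φ e
  have hgd := hasDecayingSeries_of_mem hα ha g.2
  obtain ⟨s, hs, hs1, hs2, hs3, hs4⟩ := exists_trial_approx hα ha hN z hc hsymm hB
  have hec : HasSum (fun h => W h * ‖((W h)⁻¹ : ℝ) * empCoeff a y h - c h‖ ^ 2) (‖e - cA‖ ^ 2) :=
    hasSum_norm_weightedVec_sub_sq hW0 heW hcW
  have hgc : HasSum (fun h => W h * ‖fourierCoeffBox a g.1 h - c h‖ ^ 2) (‖Φ g - cA‖ ^ 2) :=
    hasSum_norm_weightedVec_sub_sq hW0 (hVW g) hcW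
  have hcs : HasSum (fun h => W h * ‖c h - fourierCoeffBox a s h‖ ^ 2) (‖cA - Φ ⟨s, hs⟩‖ ^ 2) :=
    hasSum_norm_weightedVec_sub_sq hW0 hcW (hVW ⟨s, hs⟩)
  have hemp : Summable fun h => (W h)⁻¹ * ‖empCoeff a y h - c h‖ ^ 2 := by
    refine Summable.of_nonneg_of_le
      (fun h => mul_nonneg (inv_nonneg.2 (hW0 h)) (sq_nonneg _)) (fun h => ?_)
      ((hWinv.add hcW).mul_left 2)
    have h1 := norm_empCoeff_le_one ha y h
    have h2 : ‖empCoeff a y h - c h‖ ^ 2 ≤ 2 * 1 + 2 * ‖c h‖ ^ 2 := by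
      have := norm_sub_le (empCoeff a y h) (c h)
      nlinarith [norm_nonneg (empCoeff a y h - c h), norm_nonneg (empCoeff a y h),
        norm_nonneg (c h), sq_nonneg (‖empCoeff a y h‖ - ‖c h‖)]
    have h3 : (W h)⁻¹ ≤ W h :=
      (inv_le_one_of_one_le₀ (one_le_ridgeWeight hl h)).trans (one_le_ridgeWeight hl h)
    calc (W h)⁻¹ * ‖empCoeff a y h - c h‖ ^ 2 ≤ (W h)⁻¹ * (2 * 1 + 2 * ‖c h‖ ^ 2) :=
          mul_le_mul_of_nonneg_left h2 (inv_nonneg.2 (hW0 h))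
      _ = 2 * ((W h)⁻¹ + (W h)⁻¹ * ‖c h‖ ^ 2) := by ring
      _ ≤ _ := by gcongr
  have b1 : ‖e - cA‖ ^ 2 ≤ 2 * ∑' h, (W h)⁻¹ * ‖empCoeff a y h - c h‖ ^ 2 +
      2 * lam * ∑' h, rBox α a h ^ 2 * ‖c h‖ ^ 2 := by
    rw [← hec.tsum_eq, ← tsum_mul_left, ← tsum_mul_left,
      ← Summable.tsum_add (hemp.mul_left 2) (hc.mul_left _)]
    refine hec.summable.tsum_le_tsum (fun h => ?_) ((hemp.mul_left 2).add (hc.mul_left _))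
    have hWh := hW h
    -- As W = 1 + lam r², the difference splits into sampling noise and regularization bias.
    have e1 : ((W h)⁻¹ : ℝ) * empCoeff a y h - c h = ((W h)⁻¹ : ℝ) *
        ((empCoeff a y h - c h) - ((lam * rBox α a h ^ 2 : ℝ) : ℂ) * c h) := by
      have : ((W h : ℝ) : ℂ) ≠ 0 := by exact_mod_cast hWh.ne'
      rw [Complex.ofReal_inv]
      field_simp
      have : (W h : ℂ) = 1 + ((lam * rBox α a h ^ 2 : ℝ) : ℂ) := by
        simp only [W, ridgeWeight]; push_cast; ring
      rw [this]; ring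
    have hr : 0 ≤ lam * rBox α a h ^ 2 := by positivity
    have e2 : ‖(empCoeff a y h - c h) - ((lam * rBox α a h ^ 2 : ℝ) : ℂ) * c h‖ ^ 2
        ≤ 2 * ‖empCoeff a y h - c h‖ ^ 2 + 2 * (lam * rBox α a h ^ 2) ^ 2 * ‖c h‖ ^ 2 := by
      have h4 := norm_sub_le (empCoeff a y h - c h) (((lam * rBox α a h ^ 2 : ℝ) : ℂ) * c h)
      rw [norm_mul, Complex.norm_real, Real.norm_eq_abs, abs_of_nonneg hr] at h4
      set p := ‖empCoeff a y h - c h‖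
      set q := lam * rBox α a h ^ 2 * ‖c h‖
      have hp : 0 ≤ p := norm_nonneg _
      have hq : 0 ≤ q := by positivity
      calc _ ≤ (p + q) ^ 2 := by gcongr
        _ ≤ 2 * p ^ 2 + 2 * q ^ 2 := by nlinarith [sq_nonneg (p - q)]
        _ = _ := by simp only [q]; ring
    rw [e1, norm_mul, Complex.norm_real, Real.norm_eq_abs, abs_of_pos (inv_pos.2 hWh), mul_pow]
    -- The bias is quadratic in lam r². One factor is paid by W⁻¹, which leaves the Korobov norm
    -- times lam.
    have e3 : (W h)⁻¹ * (lam * rBox α a h ^ 2) ≤ 1 := by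
      rw [inv_mul_le_iff₀ hWh]
      simp only [W, ridgeWeight]; linarith
    calc W h * ((W h)⁻¹ ^ 2 *
          ‖empCoeff a y h - c h - ((lam * rBox α a h ^ 2 : ℝ) : ℂ) * c h‖ ^ 2)
        = (W h)⁻¹ * ‖empCoeff a y h - c h - ((lam * rBox α a h ^ 2 : ℝ) : ℂ) * c h‖ ^ 2 := by
          field_simp
      _ ≤ (W h)⁻¹ * (2 * ‖empCoeff a y h - c h‖ ^ 2 +
            2 * (lam * rBox α a h ^ 2) ^ 2 * ‖c h‖ ^ 2) := by gcongr
      _ = 2 * ((W h)⁻¹ * ‖empCoeff a y h - c h‖ ^ 2) +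
          ((W h)⁻¹ * (lam * rBox α a h ^ 2)) * (2 * lam * (rBox α a h ^ 2 * ‖c h‖ ^ 2)) := by ring
      _ ≤ _ := by
        exact add_le_add le_rfl ((mul_le_of_le_one_left (by positivity) e3).trans_eq (by ring))
  have b2 : ‖cA - Φ ⟨s, hs⟩‖ ^ 2 ≤
      (lam + (2 * a) ^ (2 * α * d) * (B⁻¹ + B * latticeCriterion α N z)) *
        ∑' h, rBox α a h ^ 2 * ‖c h‖ ^ 2 := by
    have e1 : ∑' h, W h * ‖c h - fourierCoeffBox a s h‖ ^ 2
        = ∑' h, ‖c h - fourierCoeffBox a s h‖ ^ 2 +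
          lam * ∑' h, rBox α a h ^ 2 * ‖c h - fourierCoeffBox a s h‖ ^ 2 := by
      rw [← tsum_mul_left, ← Summable.tsum_add hs3 (hs1.mul_left _)]
      refine tsum_congr fun h => ?_
      simp only [W, ridgeWeight]; ring
    rw [← hcs.tsum_eq, e1, add_mul, add_comm]
    exact add_le_add (mul_le_mul_of_nonneg_left hs2 hl.le) hs4
  have hle : ∀ h, ‖fourierCoeffBox a g.1 h - c h‖ ^ 2
      ≤ W h * ‖fourierCoeffBox a g.1 h - c h‖ ^ 2 := fun h =>
    le_mul_of_one_le_left (sq_nonneg _) (one_le_ridgeWeight hl h)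
  have hgs : Summable fun h => ‖fourierCoeffBox a g.1 h - c h‖ ^ 2 :=
    Summable.of_nonneg_of_le (fun h => sq_nonneg _) hle hgc.summable
  refine ⟨g.1, fun v => ⟨fun hv => ?_, ?_⟩, hgd, hgs, hemp, ?_⟩
  · have : (⟨v, hv.1⟩ : trialSpace α a N z) = g := by
      refine galerkin_unique hinj (e := e) (fun w => ?_) hg
      rw [hform, hrhs]
      exact hv.2 w.1 w.2
    exact congrArg Subtype.val this
  · rintro rfl
    refine ⟨g.2, fun w hw => ?_⟩
    rw [← hrhs ⟨w, hw⟩, ← hg, hform]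
  · have h1 := hgs.tsum_le_tsum hle hgc.summable
    rw [hgc.tsum_eq] at h1
    -- The constants: 4 = 2·2 from `b1`, 12 = 2·2 + 8 from `b1` and `b2`, and 8 from `b2`.
    have h2 := norm_galerkin_error_le hg cA ⟨s, hs⟩
    refine h1.trans (h2.trans ?_)
    linarith

/-! ### The variance of the empirical coefficients -/

/-- The Fourier coefficients over the whole space. -/
def fullCoeff {d : ℕ} (a : ℝ) (f : (Fin d → ℝ) → ℝ) (h : Fin d → ℤ) : ℂ :=
  ∫ x, (f x : ℂ) * (starRingEnd ℂ) (trig a h x)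

lemma fullCoeff_neg {d : ℕ} (a : ℝ) (f : (Fin d → ℝ) → ℝ) (h : Fin d → ℤ) :
    fullCoeff a f (-h) = (starRingEnd ℂ) (fullCoeff a f h) := by
  rw [fullCoeff, fullCoeff, ← integral_conj]
  simp only [map_mul, Complex.conj_ofReal, trig_neg]

section Variance

variable {Ω : Type*} [MeasurableSpace Ω] {P : Measure Ω} [IsProbabilityMeasure P]

/-- The mean squared error of an empirical mean of bounded independent variables. -/
lemma integral_empMean_sub_sq_le {M : ℕ} (hM : 1 ≤ M) {X : Fin M → Ω → ℝ} {μ B : ℝ}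
    (hX : ∀ m, Measurable (X m)) (hB : ∀ m ω, |X m ω| ≤ B) (hind : iIndepFun X P)
    (hμ : ∀ m, ∫ ω, X m ω ∂P = μ) :
    ∫ ω, ((1 / (M : ℝ)) * ∑ m, X m ω - μ) ^ 2 ∂P ≤ (1 / (M : ℝ)) ^ 2 * ∑ m, ∫ ω, X m ω ^ 2 ∂P := by
  have hM0 : (M : ℝ) ≠ 0 := by exact_mod_cast (show M ≠ 0 by omega)
  have hLp : ∀ m, MemLp (X m) 2 P := fun m =>
    MemLp.of_bound (hX m).aestronglyMeasurable B (Filter.Eventually.of_forall fun ω => hB m ω)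
  have hint : ∀ m, Integrable (X m) P := fun m => (hLp m).integrable (by norm_num)
  have hvar := IndepFun.variance_sum (s := Finset.univ) (fun m _ => hLp m)
    (fun i _ j _ hij => hind.indepFun hij)
  set Z : Ω → ℝ := (1 / (M : ℝ)) • ∑ m, X m
  have hZ : ∀ ω, Z ω = (1 / (M : ℝ)) * ∑ m, X m ω := fun ω => by
    simp [Z, Finset.sum_apply]
  have hEZ : ∫ ω, Z ω ∂P = μ := by
    simp only [hZ]
    rw [integral_const_mul, integral_finsetSum _ fun m _ => hint m]
    simp only [hμ, Finset.sum_const, Finset.card_univ, Fintype.card_fin, nsmul_eq_mul]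
    field_simp
  have hZm : AEMeasurable Z P := by
    rw [show Z = fun ω => (1 / (M : ℝ)) * ∑ m, X m ω from funext hZ]
    exact ((Finset.measurable_fun_sum _ fun m _ => hX m).const_mul _).aemeasurable
  have h1 : Var[Z; P] = (1 / (M : ℝ)) ^ 2 * ∑ m, Var[X m; P] := by
    rw [variance_smul, hvar]
  rw [variance_eq_integral hZm, hEZ] at h1
  simp only [hZ] at h1
  rw [h1]
  gcongr with m
  exact variance_le_expectation_sq (hX m).aestronglyMeasurable

/-- Real and imaginary parts are treated as separate empirical means. Their second moments add up to
that of a function of modulus at most 1, so no factor 2 appears. -/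
lemma lintegral_empCoeff_sub_sq_le {d M : ℕ} (hM : 1 ≤ M) {a : ℝ} (ha : 1 ≤ 2 * a)
    {f : (Fin d → ℝ) → ℝ} (hf0 : ∀ x, 0 ≤ f x) (hf : Measurable f)
    {Y : Fin M → Ω → Fin d → ℝ} (hY : ∀ m, Measurable (Y m)) (hind : iIndepFun Y P)
    (hlaw : ∀ m, P.map (Y m) = volume.withDensity (fun x => ENNReal.ofReal (f x)))
    (h : Fin d → ℤ) :
    ∫⁻ ω, ENNReal.ofReal (‖empCoeff a (fun m => Y m ω) h - fullCoeff a f h‖ ^ 2) ∂P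
      ≤ ENNReal.ofReal (1 / (M : ℝ)) := by
  have hM0 : (M : ℝ) ≠ 0 := by exact_mod_cast (show M ≠ 0 by omega)
  set ψ : (Fin d → ℝ) → ℂ := fun x => (starRingEnd ℂ) (trig a h x)
  have hψc : Continuous ψ := (trig_continuous a h).star
  have hψm : Measurable ψ := hψc.measurable
  have hψ1 : ∀ x, ‖ψ x‖ ≤ 1 := fun x => by
    simp only [ψ]; rw [RCLike.norm_conj]; exact norm_trig_le_one ha h x
  have hmean : ∀ m, ∫ ω, ψ (Y m ω) ∂P = fullCoeff a f h := by
    intro m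
    rw [← integral_map (hY m).aemeasurable hψc.aestronglyMeasurable, hlaw,
      integral_withDensity_eq_integral_toReal_smul₀ hf.ennreal_ofReal.aemeasurable
        (Filter.Eventually.of_forall fun _ => ENNReal.ofReal_lt_top)]
    rw [fullCoeff]
    congr 1
    ext x
    rw [ENNReal.toReal_ofReal (hf0 x), Complex.real_smul]
  have hint : ∀ m, Integrable (fun ω => ψ (Y m ω)) P := fun m =>
    Integrable.of_bound ((hψm.comp (hY m)).aestronglyMeasurable) 1
      (Filter.Eventually.of_forall fun ω => hψ1 _)
  have hre := integral_empMean_sub_sq_le (P := P) hM (X := fun m ω => (ψ (Y m ω)).re)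
    (μ := (fullCoeff a f h).re) (B := 1)
    (fun m => Complex.measurable_re.comp (hψm.comp (hY m)))
    (fun m ω => (Complex.abs_re_le_norm _).trans (hψ1 _))
    (hind.comp (fun _ x => (ψ x).re) fun _ => Complex.measurable_re.comp hψm)
    (fun m => by rw [← hmean m]; exact integral_re (hint m))
  have him := integral_empMean_sub_sq_le (P := P) hM (X := fun m ω => (ψ (Y m ω)).im)
    (μ := (fullCoeff a f h).im) (B := 1)
    (fun m => Complex.measurable_im.comp (hψm.comp (hY m)))
    (fun m ω => (Complex.abs_im_le_norm _).trans (hψ1 _))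
    (hind.comp (fun _ x => (ψ x).im) fun _ => Complex.measurable_im.comp hψm)
    (fun m => by rw [← hmean m]; exact integral_im (hint m))
  have hmre : ∀ m, Measurable fun ω => (ψ (Y m ω)).re := fun m =>
    Complex.measurable_re.comp (hψm.comp (hY m))
  have hmim : ∀ m, Measurable fun ω => (ψ (Y m ω)).im := fun m =>
    Complex.measurable_im.comp (hψm.comp (hY m))
  have bd : ∀ (Z : Fin M → Ω → ℝ) (μ : ℝ), (∀ m, Measurable (Z m)) → (∀ m ω, |Z m ω| ≤ 1) →
      Integrable (fun ω => ((1 / (M : ℝ)) * ∑ m, Z m ω - μ) ^ 2) P := by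
    intro Z μ hZ hZ1
    have hm : Measurable fun ω => ((1 / (M : ℝ)) * ∑ m, Z m ω - μ) :=
      ((Finset.measurable_fun_sum _ fun m _ => hZ m).const_mul _).sub_const _
    refine Integrable.of_bound (hm.pow_const 2).aestronglyMeasurable ((1 + |μ|) ^ 2)
      (Filter.Eventually.of_forall fun ω => ?_)
    rw [Real.norm_eq_abs, abs_pow]
    have : |∑ m, Z m ω| ≤ M := (Finset.abs_sum_le_sum_abs _ _).trans
      ((Finset.sum_le_sum fun m _ => hZ1 m ω).trans_eq (by simp))
    have h2 : |(1 / (M : ℝ)) * ∑ m, Z m ω| ≤ 1 := by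
      rw [abs_mul, abs_of_nonneg (by positivity)]
      calc _ ≤ 1 / (M : ℝ) * M := by gcongr
        _ = 1 := by field_simp
    gcongr
    exact (abs_sub _ _).trans (by gcongr)
  have hsq : ∀ ω, ‖empCoeff a (fun m => Y m ω) h - fullCoeff a f h‖ ^ 2
      = ((1 / (M : ℝ)) * ∑ m, (ψ (Y m ω)).re - (fullCoeff a f h).re) ^ 2 +
        ((1 / (M : ℝ)) * ∑ m, (ψ (Y m ω)).im - (fullCoeff a f h).im) ^ 2 := by
    intro ω
    rw [← Complex.normSq_eq_norm_sq, Complex.normSq_apply, empCoeff]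
    simp only [Complex.sub_re, Complex.sub_im, Complex.re_ofReal_mul, Complex.im_ofReal_mul,
      Complex.re_sum, Complex.im_sum, ψ]
    ring
  have i1 := bd _ (fullCoeff a f h).re hmre (fun m ω => (Complex.abs_re_le_norm _).trans (hψ1 _))
  have i2 := bd _ (fullCoeff a f h).im hmim (fun m ω => (Complex.abs_im_le_norm _).trans (hψ1 _))
  simp only [hsq]
  have i12 : Integrable (fun ω =>
      ((1 / (M : ℝ)) * ∑ m, (ψ (Y m ω)).re - (fullCoeff a f h).re) ^ 2 +
        ((1 / (M : ℝ)) * ∑ m, (ψ (Y m ω)).im - (fullCoeff a f h).im) ^ 2) P := i1.add i2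
  rw [← ofReal_integral_eq_lintegral_ofReal i12
    (Filter.Eventually.of_forall fun ω => by positivity)]
  refine ENNReal.ofReal_le_ofReal ?_
  rw [integral_add i1 i2]
  refine (add_le_add hre him).trans ?_
  rw [← mul_add, ← Finset.sum_add_distrib]
  have hs : ∀ m, ∫ ω, (ψ (Y m ω)).re ^ 2 ∂P + ∫ ω, (ψ (Y m ω)).im ^ 2 ∂P ≤ 1 := by
    intro m
    have j1 : Integrable (fun ω => (ψ (Y m ω)).re ^ 2) P :=
      Integrable.of_bound ((hmre m).pow_const 2).aestronglyMeasurable 1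
        (Filter.Eventually.of_forall fun ω => by
          rw [Real.norm_eq_abs, abs_pow]
          exact pow_le_one₀ (abs_nonneg _) ((Complex.abs_re_le_norm _).trans (hψ1 _)))
    have j2 : Integrable (fun ω => (ψ (Y m ω)).im ^ 2) P :=
      Integrable.of_bound ((hmim m).pow_const 2).aestronglyMeasurable 1
        (Filter.Eventually.of_forall fun ω => by
          rw [Real.norm_eq_abs, abs_pow]
          exact pow_le_one₀ (abs_nonneg _) ((Complex.abs_im_le_norm _).trans (hψ1 _)))
    rw [← integral_add j1 j2]
    refine (integral_mono (j1.add j2) (integrable_const 1) fun ω => ?_).trans_eq (by simp)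
    have : ‖ψ (Y m ω)‖ ^ 2 ≤ 1 := pow_le_one₀ (norm_nonneg _) (hψ1 _)
    rw [← Complex.normSq_eq_norm_sq, Complex.normSq_apply] at this
    simp only [Pi.add_apply]
    nlinarith
  calc (1 / (M : ℝ)) ^ 2 * ∑ m, (∫ ω, (ψ (Y m ω)).re ^ 2 ∂P + ∫ ω, (ψ (Y m ω)).im ^ 2 ∂P)
      ≤ (1 / (M : ℝ)) ^ 2 * ∑ _m : Fin M, (1 : ℝ) := by
        gcongr with m
        exact hs m
    _ = 1 / (M : ℝ) := by
      simp only [Finset.sum_const, Finset.card_univ, Fintype.card_fin, nsmul_eq_mul]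
      field_simp

lemma lintegral_tsum_empCoeff_le {d M α : ℕ} (hα : 1 ≤ α) (hM : 1 ≤ M) {a lam : ℝ} (ha : 1 ≤ 2 * a)
    (hl : 0 < lam)
    {f : (Fin d → ℝ) → ℝ} (hf0 : ∀ x, 0 ≤ f x) (hf : Measurable f)
    {Y : Fin M → Ω → Fin d → ℝ} (hY : ∀ m, Measurable (Y m)) (hind : iIndepFun Y P)
    (hlaw : ∀ m, P.map (Y m) = volume.withDensity (fun x => ENNReal.ofReal (f x)))
    (hsum : ∀ ω, Summable fun h => (ridgeWeight α a lam h)⁻¹ *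
      ‖empCoeff a (fun m => Y m ω) h - fullCoeff a f h‖ ^ 2) :
    ∫⁻ ω, ENNReal.ofReal (∑' h, (ridgeWeight α a lam h)⁻¹ *
        ‖empCoeff a (fun m => Y m ω) h - fullCoeff a f h‖ ^ 2) ∂P
      ≤ ENNReal.ofReal (1 / (M : ℝ) * ∑' h : Fin d → ℤ, (ridgeWeight α a lam h)⁻¹) := by
  have hW : ∀ h : Fin d → ℤ, 0 ≤ (ridgeWeight α a lam h)⁻¹ := fun h =>
    (inv_pos.2 (ridgeWeight_pos hl h)).le
  have hmeas : ∀ h : Fin d → ℤ, Measurable fun ω =>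
      ENNReal.ofReal (‖empCoeff a (fun m => Y m ω) h - fullCoeff a f h‖ ^ 2) := by
    intro h
    have h1 : Measurable fun ω => empCoeff a (fun m => Y m ω) h :=
      (Finset.measurable_fun_sum _ fun m _ =>
        ((trig_continuous a h).star.measurable.comp (hY m))).const_mul _
    exact ((h1.sub_const _).norm.pow_const 2).ennreal_ofReal
  have e : ∀ ω, ENNReal.ofReal (∑' h, (ridgeWeight α a lam h)⁻¹ *
        ‖empCoeff a (fun m => Y m ω) h - fullCoeff a f h‖ ^ 2)
      = ∑' h, ENNReal.ofReal (ridgeWeight α a lam h)⁻¹ *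
        ENNReal.ofReal (‖empCoeff a (fun m => Y m ω) h - fullCoeff a f h‖ ^ 2) := by
    intro ω
    rw [ENNReal.ofReal_tsum_of_nonneg (fun h => mul_nonneg (hW h) (sq_nonneg _)) (hsum ω)]
    exact tsum_congr fun h => ENNReal.ofReal_mul (hW h)
  simp only [e]
  rw [lintegral_tsum fun h => ((hmeas h).const_mul _).aemeasurable,
    ENNReal.ofReal_mul (by positivity),
    ENNReal.ofReal_tsum_of_nonneg hW (summable_ridgeWeight_inv hα ha hl), ← ENNReal.tsum_mul_left]
  refine ENNReal.tsum_le_tsum fun h => ?_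
  rw [lintegral_const_mul _ (hmeas h), mul_comm]
  gcongr
  exact lintegral_empCoeff_sub_sq_le hM ha hf0 hf hY hind hlaw h

end Variance

/-- The effective dimension of the ridge problem. -/
lemma exists_tsum_ridgeWeight_inv_le (d : ℕ) {α : ℕ} (hα : 1 ≤ α) {τ : ℝ} (hτ : 0 < τ)
    (hτ1 : τ ≤ 1) (hατ : 1 < 2 * α * τ) :
    ∃ C : ℝ, 0 < C ∧ ∀ a lam : ℝ, 1 ≤ 2 * a → 0 < lam →
      ∑' h : Fin d → ℤ, (ridgeWeight α a lam h)⁻¹ ≤ C * lam ^ (-τ) * (2 * a) ^ (2 * α * d) := by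
  have hfin : ∑' h : Fin d → ℤ, ENNReal.ofReal ((rUnitSq α h)⁻¹ ^ τ) ≠ ⊤ := by
    have e : ∀ h : Fin d → ℤ, ENNReal.ofReal ((rUnitSq α h)⁻¹ ^ τ) = ∏ j, freqWeight α (h j) ^ τ := by
      intro h
      rw [← ENNReal.ofReal_rpow_of_nonneg (inv_nonneg.2 (rUnitSq_pos α h).le) hτ.le,
        ofReal_rUnitSq_inv, ENNReal.prod_rpow_of_nonneg hτ.le]
    simp only [e]
    rw [tsum_pi_prod fun _ m => freqWeight α m ^ τ]
    exact ENNReal.prod_ne_top fun _ _ => tsum_freqWeight_rpow_ne_top hτ.le hατ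
  have hR0 : ∀ h : Fin d → ℤ, 0 ≤ (rUnitSq α h)⁻¹ ^ τ := fun h =>
    Real.rpow_nonneg (inv_nonneg.2 (rUnitSq_pos α h).le) _
  have hs := (ofReal_tsum_of_ne_top hR0 hfin).1
  refine ⟨∑' h : Fin d → ℤ, (rUnitSq α h)⁻¹ ^ τ + 1, add_pos_of_nonneg_of_pos (tsum_nonneg hR0)
    one_pos, fun a lam ha hl => ?_⟩
  set T : ℝ := (2 * a) ^ (2 * α * d)
  have hT1 : 1 ≤ T := one_le_pow₀ ha
  have hpt : ∀ h : Fin d → ℤ, (ridgeWeight α a lam h)⁻¹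
      ≤ lam ^ (-τ) * T * (rUnitSq α h)⁻¹ ^ τ := by
    intro h
    have hr := rBox_pos (α := α) (show 0 < a by linarith) h
    set t := lam * rBox α a h ^ 2
    have ht : 0 < t := by positivity
    -- Interpolation: W⁻¹ ≤ (lam r²)^(-τ) trades decay in h, still summable because 2ατ > 1, for a
    -- smaller power of 1/lam.
    have h1 : t ^ τ ≤ 1 + t := by
      rcases le_total t 1 with h | h
      · have := Real.rpow_le_one ht.le h hτ.le
        linarith
      · have := Real.rpow_le_rpow_of_exponent_le h hτ1
        rw [Real.rpow_one] at this
        linarith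
    have h2 : (ridgeWeight α a lam h)⁻¹ ≤ (t ^ τ)⁻¹ :=
      inv_anti₀ (Real.rpow_pos_of_pos ht _) h1
    have h3 : (t ^ τ)⁻¹ = lam ^ (-τ) * ((rBox α a h ^ 2)⁻¹) ^ τ := by
      rw [Real.mul_rpow hl.le (by positivity), mul_inv, Real.rpow_neg hl.le,
        Real.inv_rpow (by positivity)]
    rw [h3] at h2
    refine h2.trans ?_
    rw [mul_assoc]
    refine mul_le_mul_of_nonneg_left ?_ (Real.rpow_nonneg hl.le _)
    calc ((rBox α a h ^ 2)⁻¹) ^ τ ≤ (T * (rUnitSq α h)⁻¹) ^ τ :=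
          Real.rpow_le_rpow (by positivity) (rBox_sq_inv_le ha h) hτ.le
      _ = T ^ τ * (rUnitSq α h)⁻¹ ^ τ :=
          Real.mul_rpow (by positivity) (inv_nonneg.2 (rUnitSq_pos α h).le)
      _ ≤ T * (rUnitSq α h)⁻¹ ^ τ := by
          refine mul_le_mul_of_nonneg_right ?_ (hR0 h)
          have := Real.rpow_le_rpow_of_exponent_le hT1 hτ1
          rwa [Real.rpow_one] at this
  refine ((summable_ridgeWeight_inv hα ha hl).tsum_le_tsum hpt (hs.mul_left _)).trans ?_
  rw [tsum_mul_left]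
  have hl' : 0 ≤ lam ^ (-τ) := Real.rpow_nonneg hl.le _
  have : 0 ≤ lam ^ (-τ) * T := by positivity
  nlinarith

/-! ### Rapidly decreasing functions and their Fourier coefficients -/

/-- The exponentially decreasing weight. -/
def decayWeight {d : ℕ} (γ : ℝ) (x : Fin d → ℝ) : ℝ := Real.exp (-γ * ∑ j, |x j|)

lemma decayWeight_continuous {d : ℕ} (γ : ℝ) : Continuous (decayWeight (d := d) γ) := by
  unfold decayWeight; fun_prop

lemma decayWeight_pos {d : ℕ} (γ : ℝ) (x : Fin d → ℝ) : 0 < decayWeight γ x := Real.exp_pos _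

lemma decayWeight_le_one {d : ℕ} {γ : ℝ} (hγ : 0 ≤ γ) (x : Fin d → ℝ) : decayWeight γ x ≤ 1 := by
  rw [decayWeight, Real.exp_le_one_iff]
  have : 0 ≤ ∑ j, |x j| := Finset.sum_nonneg fun j _ => abs_nonneg _
  nlinarith

/-- The sum of the decay weights over the integer lattice. -/
def latticeDecay (d : ℕ) (γ : ℝ) : ℝ≥0∞ :=
  ∑' n : Fin d → ℤ, ENNReal.ofReal (decayWeight (γ / 2) fun j => (n j : ℝ))

lemma latticeDecay_ne_top (d : ℕ) {γ : ℝ} (hγ : 0 < γ) : latticeDecay d γ ≠ ⊤ := by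
  have e : ∀ n : Fin d → ℤ, ENNReal.ofReal (decayWeight (γ / 2) fun j => (n j : ℝ))
      = ∏ j, ENNReal.ofReal (Real.exp (-(γ / 2) * |(n j : ℝ)|)) := by
    intro n
    rw [decayWeight, Finset.mul_sum, Real.exp_sum, ENNReal.ofReal_prod_of_nonneg]
    exact fun _ _ => (Real.exp_pos _).le
  have hnat : Summable fun n : ℕ => Real.exp (-(γ / 2)) ^ n :=
    summable_geometric_of_lt_one (Real.exp_pos _).le (by rw [Real.exp_lt_one_iff]; linarith)
  have hs : Summable fun m : ℤ => Real.exp (-(γ / 2) * |(m : ℝ)|) := by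
    refine Summable.of_nat_of_neg ?_ ?_ <;>
    · refine hnat.congr fun n => ?_
      rw [← Real.exp_nat_mul]
      congr 1
      simp [mul_comm]
  rw [latticeDecay]
  simp only [e]
  rw [tsum_pi_prod fun _ m => ENNReal.ofReal (Real.exp (-(γ / 2) * |(m : ℝ)|))]
  exact ENNReal.prod_ne_top fun _ _ => hs.tsum_ofReal_ne_top

/-- The cells of the partition of the space into translates of the box. -/
def cell {d : ℕ} (a : ℝ) (n : Fin d → ℤ) : Set (Fin d → ℝ) :=
  {x | ∀ j, ⌊(x j + a) / (2 * a)⌋ = n j}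

lemma measurableSet_cell {d : ℕ} (a : ℝ) (n : Fin d → ℤ) : MeasurableSet (cell a n) := by
  rw [cell, Set.ofPred_forall]
  refine MeasurableSet.iInter fun j => ?_
  have h1 : Measurable fun x : Fin d → ℝ => (x j + a) / (2 * a) := by fun_prop
  have : Measurable fun x : Fin d → ℝ => ⌊(x j + a) / (2 * a)⌋ := Int.measurable_floor.comp h1
  exact this (measurableSet_singleton (n j))

lemma cell_disjoint {d : ℕ} (a : ℝ) : Pairwise (Function.onFun Disjoint (cell (d := d) a)) := by
  intro n m hnm
  rw [Function.onFun, Set.disjoint_left]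
  exact fun x hx hx' => hnm (funext fun j => (hx j).symm.trans (hx' j))

lemma iUnion_cell {d : ℕ} (a : ℝ) : ⋃ n, cell (d := d) a n = Set.univ := by
  ext x
  simp only [Set.mem_iUnion, Set.mem_univ, iff_true]
  exact ⟨fun j => ⌊(x j + a) / (2 * a)⌋, fun j => rfl⟩

lemma mem_cell_iff {d : ℕ} {a : ℝ} (ha : 0 < a) {n : Fin d → ℤ} {x : Fin d → ℝ} :
    x ∈ cell a n ↔ ∀ j, 2 * a * n j - a ≤ x j ∧ x j < 2 * a * n j + a := by
  refine forall_congr' fun j => ?_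
  rw [Int.floor_eq_iff, le_div_iff₀ (by positivity), div_lt_iff₀ (by positivity)]
  constructor <;> rintro ⟨h, h'⟩ <;> constructor <;> nlinarith

/-- For n_j ≠ 0 a point of the cell has |x_j| ≥ (2|n_j| − 1)a ≥ |n_j|a ≥ |n_j|/2. Halving the rate
makes the bound independent of a. -/
lemma decayWeight_le_of_mem_cell {d : ℕ} {a γ : ℝ} (ha : 1 ≤ 2 * a) (hγ : 0 ≤ γ) {n : Fin d → ℤ}
    {x : Fin d → ℝ} (hx : x ∈ cell a n) :
    decayWeight γ x ≤ decayWeight (γ / 2) fun j => (n j : ℝ) := by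
  have ha0 : 0 < a := by linarith
  have h1 : ∀ j, |(n j : ℝ)| / 2 ≤ |x j| := by
    intro j
    obtain ⟨h, h'⟩ := (mem_cell_iff ha0).1 hx j
    rcases lt_trichotomy (n j) 0 with hn | hn | hn
    · have : (n j : ℝ) ≤ -1 := by exact_mod_cast Int.le_sub_one_of_lt hn
      rw [abs_of_neg (by linarith)]
      have := neg_le_abs (x j)
      nlinarith
    · simp [hn]
    · have : (1 : ℝ) ≤ n j := by exact_mod_cast hn
      rw [abs_of_pos (by linarith)]
      have := le_abs_self (x j)
      nlinarith
  rw [decayWeight, decayWeight, Real.exp_le_exp]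
  have h2 : ∑ j, |(n j : ℝ)| / 2 ≤ ∑ j, |x j| := Finset.sum_le_sum fun j _ => h1 j
  rw [← Finset.sum_div] at h2
  nlinarith

/-- The integral of a periodic function against the decay weight. -/
lemma lintegral_decayWeight_mul_le {d : ℕ} {a γ : ℝ} (ha : 1 ≤ 2 * a) (hγ : 0 ≤ γ)
    {F : (Fin d → ℝ) → ℝ≥0∞} (hF : Measurable F)
    (hper : ∀ (n : Fin d → ℤ) x, F (fun j => x j + 2 * a * n j) = F x) :
    ∫⁻ x, ENNReal.ofReal (decayWeight γ x) * F x ≤ latticeDecay d γ * ∫⁻ x in box d a, F x := by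
  have ha0 : 0 < a := by linarith
  rw [← setLIntegral_univ, ← iUnion_cell a,
    lintegral_iUnion (measurableSet_cell a) (cell_disjoint a), latticeDecay, ← ENNReal.tsum_mul_right]
  refine ENNReal.tsum_le_tsum fun n => ?_
  calc ∫⁻ x in cell a n, ENNReal.ofReal (decayWeight γ x) * F x
      ≤ ∫⁻ x in cell a n, ENNReal.ofReal (decayWeight (γ / 2) fun j => (n j : ℝ)) * F x := by
        refine setLIntegral_mono (hF.const_mul _) fun x hx => ?_
        gcongr
        exact decayWeight_le_of_mem_cell ha hγ hx
    _ = ENNReal.ofReal (decayWeight (γ / 2) fun j => (n j : ℝ)) * ∫⁻ x in cell a n, F x :=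
        lintegral_const_mul _ hF
    _ ≤ _ := by
      refine mul_le_mul_right ?_ _
      have hmp := measurePreserving_add_right (volume : Measure (Fin d → ℝ))
        (fun j => 2 * a * n j)
      rw [← hmp.setLIntegral_comp_preimage (measurableSet_cell a n) hF]
      have h1 : ∀ x : Fin d → ℝ, F (x + fun j => 2 * a * n j) = F x := hper n
      simp only [h1]
      refine lintegral_mono_set fun x hx => ?_
      have h2 := (mem_cell_iff ha0).1 (Set.mem_preimage.1 hx)
      simp only [Pi.add_apply] at h2
      exact ⟨fun j => by linarith [(h2 j).1], fun j => by linarith [(h2 j).2]⟩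

/-- The cell decomposition with unit cells and F = 1. -/
lemma integrable_decayWeight (d : ℕ) {γ : ℝ} (hγ : 0 < γ) :
    Integrable (decayWeight (d := d) γ) := by
  refine ⟨(decayWeight_continuous γ).aestronglyMeasurable, ?_⟩
  rw [hasFiniteIntegral_iff_ofReal (Filter.Eventually.of_forall fun x => (decayWeight_pos γ x).le)]
  have h := lintegral_decayWeight_mul_le (d := d) (a := 1 / 2) (by norm_num) hγ.le
    (F := fun _ => 1) measurable_const (fun _ _ => rfl)
  simp only [mul_one, setLIntegral_one] at h
  exact h.trans_lt (ENNReal.mul_lt_top (latticeDecay_ne_top d hγ).lt_top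
    (isCompact_box d _).measure_lt_top)

lemma integral_decayWeight_mul_le {d : ℕ} {a γ : ℝ} (ha : 1 ≤ 2 * a) (hγ : 0 < γ)
    {F : (Fin d → ℝ) → ℝ} (hF : Continuous F) (hF0 : ∀ x, 0 ≤ F x)
    (hper : ∀ (n : Fin d → ℤ) x, F (fun j => x j + 2 * a * n j) = F x) :
    ∫ x, decayWeight γ x * F x ≤ (latticeDecay d γ).toReal * ∫ x in box d a, F x := by
  have h := lintegral_decayWeight_mul_le ha hγ.le (F := fun x => ENNReal.ofReal (F x))
    hF.measurable.ennreal_ofReal (fun n x => by rw [hper])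
  have hi : IntegrableOn F (box d a) := hF.continuousOn.integrableOn_compact (isCompact_box d a)
  rw [integral_eq_lintegral_of_nonneg_ae (Filter.Eventually.of_forall fun x =>
      mul_nonneg (decayWeight_pos γ x).le (hF0 x))
    ((decayWeight_continuous γ).mul hF).aestronglyMeasurable,
    integral_eq_lintegral_of_nonneg_ae (Filter.Eventually.of_forall hF0) hF.aestronglyMeasurable,
    ← ENNReal.toReal_mul]
  refine ENNReal.toReal_mono (ENNReal.mul_ne_top (latticeDecay_ne_top d hγ) ?_) ?_
  · exact ((hasFiniteIntegral_iff_ofReal (Filter.Eventually.of_forall hF0)).1 hi.2).ne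
  · simpa only [ENNReal.ofReal_mul (decayWeight_pos γ _).le] using h

lemma one_le_latticeDecay (d : ℕ) {γ : ℝ} (hγ : 0 < γ) : 1 ≤ (latticeDecay d γ).toReal := by
  have h : 1 ≤ latticeDecay d γ := by
    refine le_trans ?_ (ENNReal.le_tsum 0)
    simp [decayWeight]
  rw [← ENNReal.toReal_one]
  exact ENNReal.toReal_mono (latticeDecay_ne_top d hγ) h

/-! ### Bessel's inequality over the whole space. -/

lemma integral_norm_sq_trigPoly {d : ℕ} {a : ℝ} (ha : 0 < a) (S : Finset (Fin d → ℤ))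
    (b : (Fin d → ℤ) → ℂ) :
    ∫ x in box d a, ‖∑ h ∈ S, b h * trig a h x‖ ^ 2 = ∑ h ∈ S, ‖b h‖ ^ 2 := by
  have hint : ∀ h k : Fin d → ℤ, Integrable (fun x => b h * (starRingEnd ℂ) (b k) *
      (trig a h x * (starRingEnd ℂ) (trig a k x))) (volume.restrict (box d a)) := by
    intro h k
    have hc : Continuous fun x => b h * (starRingEnd ℂ) (b k) *
        (trig a h x * (starRingEnd ℂ) (trig a k x)) :=
      continuous_const.mul ((trig_continuous a h).mul (trig_continuous a k).star)
    exact hc.continuousOn.integrableOn_compact (isCompact_box d a)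
  have e : ∀ x, ((‖∑ h ∈ S, b h * trig a h x‖ ^ 2 : ℝ) : ℂ)
      = ∑ h ∈ S, ∑ k ∈ S, b h * (starRingEnd ℂ) (b k) *
        (trig a h x * (starRingEnd ℂ) (trig a k x)) := by
    intro x
    rw [← Complex.normSq_eq_norm_sq, ← Complex.mul_conj, map_sum, Finset.sum_mul_sum]
    refine Finset.sum_congr rfl fun h _ => Finset.sum_congr rfl fun k _ => ?_
    rw [map_mul]; ring
  apply Complex.ofReal_injective
  rw [← integral_complex_ofReal]
  simp only [e]
  rw [integral_finsetSum _ fun h _ => integrable_finsetSum _ fun k _ => hint h k]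
  push_cast
  refine Finset.sum_congr rfl fun h hh => ?_
  rw [integral_finsetSum _ fun k _ => hint h k]
  simp only [integral_const_mul, integral_trig_mul_conj ha, mul_ite, mul_one, mul_zero]
  rw [Finset.sum_ite_eq, if_pos hh, Complex.mul_conj, Complex.normSq_eq_norm_sq]
  push_cast
  rfl

lemma integrable_mul_of_decay {d : ℕ} {γ A : ℝ} (hγ : 0 < γ)
    {G : (Fin d → ℝ) → ℝ} (hG : Measurable G) (hGA : ∀ x, |G x| ≤ A * decayWeight γ x)
    {ψ : (Fin d → ℝ) → ℂ} (hψ : Continuous ψ) {B : ℝ} (hψB : ∀ x, ‖ψ x‖ ≤ B) :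
    Integrable fun x => (G x : ℂ) * ψ x := by
  refine Integrable.mono' ((integrable_decayWeight d hγ).const_mul (A * B))
    ((Complex.measurable_ofReal.comp hG).mul hψ.measurable).aestronglyMeasurable
    (Filter.Eventually.of_forall fun x => ?_)
  rw [norm_mul, Complex.norm_real, Real.norm_eq_abs]
  calc |G x| * ‖ψ x‖ ≤ (A * decayWeight γ x) * B :=
        mul_le_mul (hGA x) (hψB x) (norm_nonneg _) ((abs_nonneg _).trans (hGA x))
    _ = _ := by ring

/-- Bessel's inequality for the coefficients of a rapidly decreasing function on the whole space. -/
theorem tsum_norm_fullCoeff_sq_le {d : ℕ} {a γ A : ℝ} (ha : 1 ≤ 2 * a) (hγ : 0 < γ) (hA : 0 < A)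
    {G : (Fin d → ℝ) → ℝ} (hG : Measurable G) (hGA : ∀ x, |G x| ≤ A * decayWeight γ x) :
    Summable (fun h => ‖fullCoeff a G h‖ ^ 2) ∧
      ∑' h, ‖fullCoeff a G h‖ ^ 2 ≤ A ^ 2 * (latticeDecay d γ).toReal ^ 2 * (2 * a) ^ d := by
  have ha0 : 0 < a := by linarith
  set C := (latticeDecay d γ).toReal
  have hC : 1 ≤ C := one_le_latticeDecay d hγ
  have key : ∀ S : Finset (Fin d → ℤ), ∑ h ∈ S, ‖fullCoeff a G h‖ ^ 2 ≤ A ^ 2 * C ^ 2 * (2 * a) ^ d := by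
    intro S
    set X := ∑ h ∈ S, ‖fullCoeff a G h‖ ^ 2
    -- Duality: X is the pairing of G with its own partial Fourier sum T. Since ‖T‖ is periodic, the
    -- decay of G reduces the integral to the box.
    set T : (Fin d → ℝ) → ℂ := fun x => ∑ h ∈ S, fullCoeff a G h * trig a h x
    have hT : Continuous T := continuous_finsetSum _ fun h _ =>
      continuous_const.mul (trig_continuous a h)
    have hTB : ∀ x, ‖T x‖ ≤ ∑ h ∈ S, ‖fullCoeff a G h‖ := fun x =>
      norm_sum_le_of_le _ fun h _ => by
        rw [norm_mul]
        exact mul_le_of_le_one_right (norm_nonneg _) (norm_trig_le_one ha h x)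
    have hper : ∀ (n : Fin d → ℤ) x, ‖T fun j => x j + 2 * a * n j‖ = ‖T x‖ := fun n x => by
      simp only [T, trig_add_period ha0]
    have h1 : (X : ℂ) = ∫ x, (G x : ℂ) * (starRingEnd ℂ) (T x) := by
      have e : ∀ x, (G x : ℂ) * (starRingEnd ℂ) (T x) = ∑ h ∈ S,
          (starRingEnd ℂ) (fullCoeff a G h) * ((G x : ℂ) * (starRingEnd ℂ) (trig a h x)) := by
        intro x
        simp only [T, map_sum, map_mul, Finset.mul_sum]
        exact Finset.sum_congr rfl fun h _ => by ring
      simp only [e]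
      rw [integral_finsetSum]
      · simp only [integral_const_mul, X]
        push_cast
        refine Finset.sum_congr rfl fun h _ => ?_
        rw [← fullCoeff, ← Complex.ofReal_pow, ← Complex.normSq_eq_norm_sq, ← Complex.mul_conj,
          mul_comm]
      · intro h _
        refine Integrable.const_mul ?_ _
        exact integrable_mul_of_decay hγ hG hGA (trig_continuous a h).star (B := 1)
          fun x => by rw [RCLike.norm_conj]; exact norm_trig_le_one ha h x
    have hX0 : 0 ≤ X := Finset.sum_nonneg fun h _ => sq_nonneg _
    have hwT : Integrable fun x => decayWeight γ x * ‖T x‖ :=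
      (integrable_decayWeight d hγ).mul_bdd (c := ∑ h ∈ S, ‖fullCoeff a G h‖)
        hT.norm.aestronglyMeasurable
        (Filter.Eventually.of_forall fun x => by rw [norm_norm]; exact hTB x)
    have h2 : X ≤ A * (C * ∫ x in box d a, ‖T x‖) := by
      calc X = ‖(X : ℂ)‖ := by rw [Complex.norm_real, Real.norm_eq_abs, abs_of_nonneg hX0]
        _ ≤ ∫ x, A * (decayWeight γ x * ‖T x‖) := by
          rw [h1]
          refine norm_integral_le_of_norm_le (hwT.const_mul A)
            (Filter.Eventually.of_forall fun x => ?_)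
          rw [norm_mul, Complex.norm_real, RCLike.norm_conj, ← mul_assoc]
          exact mul_le_mul_of_nonneg_right (hGA x) (norm_nonneg _)
        _ = A * ∫ x, decayWeight γ x * ‖T x‖ := integral_const_mul _ _
        _ ≤ _ := by
          gcongr
          exact integral_decayWeight_mul_le ha hγ hT.norm (fun x => norm_nonneg _) hper
    set θ := A * C
    have hθ : 0 < θ := by positivity
    have hi1 : IntegrableOn (fun x => ‖T x‖) (box d a) :=
      hT.norm.continuousOn.integrableOn_compact (isCompact_box d a)
    have hi2 : IntegrableOn (fun x => ‖T x‖ ^ 2) (box d a) :=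
      (hT.norm.pow 2).continuousOn.integrableOn_compact (isCompact_box d a)
    have hvol : ∫ _x in box d a, θ / 2 = (2 * a) ^ d * (θ / 2) := by
      rw [setIntegral_const, Measure.real, volume_box ha0, ENNReal.toReal_ofReal (by positivity),
        smul_eq_mul]
    -- Young's inequality ‖T‖ ≤ θ/2 + ‖T‖²/(2θ). With θ = AC, exactly half of X is absorbed on the
    -- left.
    have h3 : ∫ x in box d a, ‖T x‖ ≤ (2 * a) ^ d * (θ / 2) + (2 * θ)⁻¹ * X := by
      rw [← hvol, show X = ∫ x in box d a, ‖T x‖ ^ 2 from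
        (integral_norm_sq_trigPoly ha0 S _).symm, ← integral_const_mul,
        ← integral_add (integrable_const _) (hi2.const_mul _)]
      refine integral_mono hi1 ((integrable_const _).add (hi2.const_mul _)) fun x => ?_
      have : 0 ≤ (2 * θ)⁻¹ * (‖T x‖ - θ) ^ 2 := by positivity
      have e : (2 * θ)⁻¹ * (‖T x‖ - θ) ^ 2 = θ / 2 + (2 * θ)⁻¹ * ‖T x‖ ^ 2 - ‖T x‖ := by
        field_simp; ring
      simp only
      linarith
    have h4 : X ≤ θ * ((2 * a) ^ d * (θ / 2) + (2 * θ)⁻¹ * X) := by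
      calc X ≤ θ * ∫ x in box d a, ‖T x‖ := by rw [mul_assoc]; exact h2
        _ ≤ _ := by gcongr
    have h5 : θ * ((2 * a) ^ d * (θ / 2) + (2 * θ)⁻¹ * X) = (2 * a) ^ d * θ ^ 2 / 2 + X / 2 := by
      field_simp
    rw [h5] at h4
    calc X ≤ (2 * a) ^ d * θ ^ 2 := by linarith
      _ = _ := by simp only [θ]; ring
  have hs : Summable fun h => ‖fullCoeff a G h‖ ^ 2 :=
    summable_of_sum_le (fun h => sq_nonneg _) key
  exact ⟨hs, hs.tsum_le_of_sum_le key⟩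

/-! ### The class of densities -/

lemma mixedDeriv_zero {d : ℕ} (g : (Fin d → ℝ) → ℝ) : mixedDeriv 0 g = g := by
  have : ∀ l : List (Fin d), l.foldr (fun j h => (partialDeriv j)^[(0 : Fin d → ℕ) j] h) g = g := by
    intro l
    induction l with
    | nil => rfl
    | cons j l => simp
  exact this _

lemma abs_le_lpNorm {d : ℕ} {p : ℝ≥0∞} (hp : 1 ≤ p) (x : Fin d → ℝ) (j : Fin d) :
    |x j| ≤ lpNorm p x := by
  have : Fact (1 ≤ p) := ⟨hp⟩
  exact PiLp.norm_apply_le (WithLp.toLp p x : PiLp p fun _ : Fin d => ℝ) j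

lemma lpNorm_nonneg {d : ℕ} (hd : 1 ≤ d) {p : ℝ≥0∞} (hp : 1 ≤ p) (x : Fin d → ℝ) :
    0 ≤ lpNorm p x :=
  (abs_nonneg _).trans (abs_le_lpNorm hp x ⟨0, hd⟩)

lemma sum_abs_le_lpNorm {d : ℕ} {p : ℝ≥0∞} (hp : 1 ≤ p) (x : Fin d → ℝ) :
    ∑ j, |x j| ≤ d * lpNorm p x :=
  (Finset.sum_le_sum fun j _ => abs_le_lpNorm hp x j).trans_eq (by simp)

lemma abs_mixedDeriv_le {d α : ℕ} {β q : ℝ} {p : ℝ≥0∞} {f : (Fin d → ℝ) → ℝ}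
    (hf : expDecayNorm α β p q f < ⊤) {τ : Fin d → ℕ} (hτ : ∀ j, τ j ≤ α) (x : Fin d → ℝ) :
    |mixedDeriv τ f x| ≤ (expDecayNorm α β p q f).toReal * Real.exp (-(β * lpNorm p x ^ q)) := by
  have h1 : ENNReal.ofReal |Real.exp (β * lpNorm p x ^ q) * mixedDeriv τ f x|
      ≤ expDecayNorm α β p q f := by
    rw [expDecayNorm]
    exact le_iSup_of_le τ (le_iSup_of_le hτ (le_iSup (fun x => ENNReal.ofReal
      |Real.exp (β * lpNorm p x ^ q) * mixedDeriv τ f x|) x))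
  rw [ENNReal.ofReal_le_iff_le_toReal hf.ne, abs_mul, abs_of_pos (Real.exp_pos _)] at h1
  rw [Real.exp_neg, ← div_eq_mul_inv, le_div_iff₀ (Real.exp_pos _), mul_comm]
  exact h1

/-- The exponential decay split into a uniform factor and an integrable one. -/
lemma exp_neg_lpNorm_le {d : ℕ} (hd : 1 ≤ d) {p : ℝ≥0∞} (hp : 1 ≤ p) {β q θ b : ℝ} (hβ : 0 < β)
    (hq : 1 ≤ q) (hθ : 0 ≤ θ) (hθ1 : θ ≤ 1) (hb : 0 ≤ b) {x : Fin d → ℝ} (hx : b ≤ lpNorm p x) :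
    Real.exp (-(β * lpNorm p x ^ q)) ≤
      Real.exp (-(β * θ * b ^ q)) * Real.exp β * decayWeight (β * (1 - θ) / d) x := by
  rw [decayWeight, ← Real.exp_add, ← Real.exp_add, Real.exp_le_exp]
  set L := lpNorm p x
  have hL : 0 ≤ L := lpNorm_nonneg hd hp x
  have hd0 : (0 : ℝ) < d := by exact_mod_cast hd
  have h1 : b ^ q ≤ L ^ q := Real.rpow_le_rpow hb hx (by linarith)
  -- Subtracting 1 covers L < 1, where L ≤ L^q may fail. This is the origin of the factor `Real.exp
  -- β`.
  have h2 : L - 1 ≤ L ^ q := by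
    rcases le_total L 1 with h | h
    · have := Real.rpow_nonneg hL q
      linarith
    · have := Real.rpow_le_rpow_of_exponent_le h hq
      rw [Real.rpow_one] at this
      linarith
  have h3 : β * (1 - θ) / d * ∑ j, |x j| ≤ β * (1 - θ) * L := by
    have := sum_abs_le_lpNorm hp x
    have h4 : 0 ≤ β * (1 - θ) / d := by
      have : 0 ≤ 1 - θ := by linarith
      positivity
    calc _ ≤ β * (1 - θ) / d * (d * L) := by gcongr
      _ = _ := by field_simp
  have h5 : β * θ * b ^ q ≤ β * θ * L ^ q := mul_le_mul_of_nonneg_left h1 (by positivity)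
  have h6 : β * (1 - θ) * (L - 1) ≤ β * (1 - θ) * L ^ q :=
    mul_le_mul_of_nonneg_left h2 (mul_nonneg hβ.le (by linarith))
  nlinarith

lemma lt_lpNorm_of_notMem_box {d : ℕ} {p : ℝ≥0∞} (hp : 1 ≤ p) {a : ℝ} {x : Fin d → ℝ}
    (hx : x ∉ box d a) : a < lpNorm p x := by
  by_contra! hc
  refine hx ⟨fun j => ?_, fun j => ?_⟩
  · have := (abs_le.1 ((abs_le_lpNorm hp x j).trans hc)).1
    simpa using this
  · exact (abs_le.1 ((abs_le_lpNorm hp x j).trans hc)).2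

/-! ### Integration by parts against the trigonometric functions. -/

lemma trig_add_smul_single {d : ℕ} (a : ℝ) (h : Fin d → ℤ) (x : Fin d → ℝ) (j : Fin d) (t : ℝ) :
    trig a h (x + t • Pi.single j 1)
      = trig a h x * Complex.exp (Complex.I * Real.pi * h j / a * t) := by
  have key : ∀ i, ((1 / Real.sqrt (2 * a) : ℝ) : ℂ) *
      Complex.exp (2 * Real.pi * Complex.I * (h i : ℂ) *
        ((((x + t • Pi.single j (1 : ℝ) : Fin d → ℝ) i + a) / (2 * a) : ℝ) : ℂ))
      = (((1 / Real.sqrt (2 * a) : ℝ) : ℂ) *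
      Complex.exp (2 * Real.pi * Complex.I * (h i : ℂ) * (((x i + a) / (2 * a) : ℝ) : ℂ))) *
        if i = j then Complex.exp (Complex.I * Real.pi * h j / a * t) else 1 := by
    intro i
    split_ifs with hij
    · subst hij
      rw [mul_assoc ((1 / Real.sqrt (2 * a) : ℝ) : ℂ), ← Complex.exp_add]
      congr 2
      simp only [Pi.add_apply, Pi.smul_apply, Pi.single_eq_same, smul_eq_mul, mul_one]
      push_cast
      ring
    · rw [mul_one]
      simp [Pi.single_eq_of_ne hij]
  rw [trig, Finset.prod_congr rfl fun i _ => key i, Finset.prod_mul_distrib, Finset.prod_ite_eq']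
  simp [trig]

lemma hasLineDerivAt_trig {d : ℕ} (a : ℝ) (h : Fin d → ℤ) (x : Fin d → ℝ) (j : Fin d) :
    HasLineDerivAt ℝ (trig a h) (Complex.I * Real.pi * h j / a * trig a h x) x (Pi.single j 1) := by
  rw [HasLineDerivAt]
  simp only [trig_add_smul_single]
  have h1 : HasDerivAt (fun t : ℝ => Complex.I * Real.pi * h j / a * (t : ℂ))
      (Complex.I * Real.pi * h j / a * 1) 0 := (Complex.ofRealCLM.hasDerivAt).const_mul _
  have h2 := (h1.cexp).const_mul (trig a h x)
  convert! h2 using 1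
  simp
  ring

/-- The decay hypothesis on all mixed derivatives used for integration by parts. -/
def MixedDecay {d : ℕ} (α : ℕ) (A γ : ℝ) (f : (Fin d → ℝ) → ℝ) : Prop :=
  ∀ τ : Fin d → ℕ, (∀ j, τ j ≤ α) → ∀ x, |mixedDeriv τ f x| ≤ A * decayWeight γ x

/-- One integration by parts in direction j. The decay of the derivatives makes every product
integrable, so no boundary terms arise. -/
lemma fullCoeff_mixedDeriv_add_single {d α : ℕ} {a γ A : ℝ} (ha : 1 ≤ 2 * a) (hγ : 0 < γ)
    {f : (Fin d → ℝ) → ℝ} (hf : HasContMixedDerivs α f) (hA : MixedDecay α A γ f)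
    {τ : Fin d → ℕ} (hτ : ∀ j, τ j ≤ α) {j : Fin d} (hj : τ j < α) (h : Fin d → ℤ) :
    fullCoeff a (mixedDeriv (τ + Pi.single j 1) f) h
      = Complex.I * Real.pi * h j / a * fullCoeff a (mixedDeriv τ f) h := by
  have hτ' : ∀ i, (τ + Pi.single j 1 : Fin d → ℕ) i ≤ α := by
    intro i
    rw [Pi.add_apply]
    by_cases hij : i = j
    · subst hij; simp; omega
    · simp [Pi.single_eq_of_ne hij, hτ i]
  have hint : ∀ σ : Fin d → ℕ, (∀ i, σ i ≤ α) → ∀ k : Fin d → ℤ,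
      Integrable fun x => (mixedDeriv σ f x : ℂ) * trig a k x := fun σ hσ k =>
    integrable_mul_of_decay hγ (hf σ hσ).1.measurable (hA σ hσ) (trig_continuous a k) (B := 1)
      fun x => norm_trig_le_one ha k x
  have hline : ∀ x, HasLineDerivAt ℝ (mixedDeriv τ f) (mixedDeriv (τ + Pi.single j 1) f x) x
      (Pi.single j 1) := by
    intro x
    have h1 := (hf τ hτ).2 j hj x
    rw [HasLineDerivAt]
    have e : ∀ t : ℝ, x + t • Pi.single j (1 : ℝ) = Function.update x j (x j + t) := by
      intro t
      ext i
      by_cases hij : i = j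
      · subst hij; simp
      · simp [hij]
    simp only [e]
    have h2 : HasDerivAt (fun s : ℝ => mixedDeriv τ f (Function.update x j s))
        (mixedDeriv (τ + Pi.single j 1) f x) (x j + 0) := by
      rw [add_zero]; exact h1
    exact h2.comp_const_add (x j) 0
  have hlineC : ∀ x, HasLineDerivAt ℝ (fun y => (mixedDeriv τ f y : ℂ))
      (mixedDeriv (τ + Pi.single j 1) f x : ℂ) x (Pi.single j 1) := fun x => by
    have := hline x
    rw [HasLineDerivAt] at this ⊢
    exact this.ofReal_comp
  -- The conjugate of `trig a h` enters as `trig a (-h)`, to which `hasLineDerivAt_trig` applies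
  -- directly.
  have ibp := integral_bilinear_hasLineDerivAt_right_eq_neg_left_of_integrable
    (μ := (volume : Measure (Fin d → ℝ))) (B := ContinuousLinearMap.mul ℝ ℂ)
    (f := fun y => (mixedDeriv τ f y : ℂ))
    (f' := fun y => (mixedDeriv (τ + Pi.single j 1) f y : ℂ))
    (g := trig a (-h)) (g' := fun x => Complex.I * Real.pi * (-h) j / a * trig a (-h) x)
    (v := Pi.single j 1)
    (by simpa using! hint _ hτ' (-h))
    (by
      have := (hint τ hτ (-h)).const_mul (Complex.I * Real.pi * (-h) j / a)
      refine this.congr (Filter.Eventually.of_forall fun x => ?_)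
      simp only [ContinuousLinearMap.mul_apply']
      ring)
    (by simpa using! hint τ hτ (-h))
    (fun x _ => hlineC x)
    (fun x _ => by simpa using! hasLineDerivAt_trig a (-h) x j)
  simp only [ContinuousLinearMap.mul_apply'] at ibp
  have e1 : ∀ x, (mixedDeriv τ f x : ℂ) * (Complex.I * Real.pi * (-h) j / a * trig a (-h) x)
      = -(Complex.I * Real.pi * h j / a) * ((mixedDeriv τ f x : ℂ) * trig a (-h) x) := by
    intro x
    simp only [Pi.neg_apply]
    push_cast
    ring
  rw [show (fun x => (mixedDeriv τ f x : ℂ) *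
      (Complex.I * Real.pi * (((-h) j : ℤ) : ℂ) / a * trig a (-h) x))
      = fun x => -(Complex.I * Real.pi * h j / a) * ((mixedDeriv τ f x : ℂ) * trig a (-h) x) from
        funext e1, integral_const_mul] at ibp
  rw [fullCoeff, fullCoeff]
  simp only [← trig_neg]
  linear_combination ibp

/-- Induction on the total order, removing one derivative at a time. -/
lemma fullCoeff_mixedDeriv {d α : ℕ} {a γ A : ℝ} (ha : 1 ≤ 2 * a) (hγ : 0 < γ)
    {f : (Fin d → ℝ) → ℝ} (hf : HasContMixedDerivs α f) (hA : MixedDecay α A γ f)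
    (h : Fin d → ℤ) : ∀ (n : ℕ) (τ : Fin d → ℕ), ∑ j, τ j = n → (∀ j, τ j ≤ α) →
    fullCoeff a (mixedDeriv τ f) h
      = (∏ j, (Complex.I * Real.pi * h j / a) ^ τ j) * fullCoeff a f h
  | 0, τ, hn, _ => by
    have : τ = 0 := by
      ext j
      exact (Finset.sum_eq_zero_iff.1 hn) j (Finset.mem_univ j)
    subst this
    simp [mixedDeriv_zero]
  | n + 1, τ, hn, hτ => by
    obtain ⟨j, -, hj⟩ : ∃ j ∈ Finset.univ, τ j ≠ 0 := by
      by_contra! hc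
      rw [Finset.sum_eq_zero hc] at hn
      omega
    set σ : Fin d → ℕ := Function.update τ j (τ j - 1)
    have hστ : τ = σ + Pi.single j 1 := by
      ext i
      by_cases hij : i = j
      · subst hij; simp [σ]; omega
      · simp [σ, hij]
    have hσ : ∀ i, σ i ≤ α := by
      intro i
      have := hτ i
      rw [hστ, Pi.add_apply] at this
      omega
    have hσj : σ j < α := by
      have := hτ j
      rw [hστ] at this
      simp at this
      omega
    have hsum : ∑ i, σ i = n := by
      rw [hστ] at hn
      simp only [Pi.add_apply, Finset.sum_add_distrib, Finset.sum_pi_single', Finset.mem_univ,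
        if_true] at hn
      omega
    rw [hστ, fullCoeff_mixedDeriv_add_single ha hγ hf hA hσ hσj,
      fullCoeff_mixedDeriv ha hγ hf hA h n σ hsum hσ]
    simp only [Pi.add_apply, pow_add, Finset.prod_mul_distrib]
    have : ∏ i, (Complex.I * Real.pi * h i / a) ^ (Pi.single j 1 : Fin d → ℕ) i
        = Complex.I * Real.pi * h j / a := by
      rw [Finset.prod_eq_single j]
      · simp
      · intro i _ hij
        simp [Pi.single_eq_of_ne hij]
      · simp
    rw [this]
    ring

/-- The Korobov norm of the periodization. -/
theorem tsum_rBox_mul_norm_fullCoeff_le {d α : ℕ} {a γ A : ℝ} (ha : 1 ≤ 2 * a) (hγ : 0 < γ)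
    (hA0 : 0 < A) {f : (Fin d → ℝ) → ℝ} (hf : HasContMixedDerivs α f) (hA : MixedDecay α A γ f) :
    Summable (fun h => rBox α a h ^ 2 * ‖fullCoeff a f h‖ ^ 2) ∧
      ∑' h, rBox α a h ^ 2 * ‖fullCoeff a f h‖ ^ 2 ≤
        2 ^ d * (A ^ 2 * (latticeDecay d γ).toReal ^ 2) * (2 * a) ^ (2 * d) := by
  have ha0 : 0 < a := by linarith
  set τ : Finset (Fin d) → Fin d → ℕ := fun u i => if i ∈ u then α else 0
  have hτ : ∀ u i, τ u i ≤ α := fun u i => by simp only [τ]; split_ifs <;> omega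
  have bes := fun u => tsum_norm_fullCoeff_sq_le ha hγ hA0 (hf (τ u) (hτ u)).1.measurable
    (hA (τ u) (hτ u))
  have hpt : ∀ h, rBox α a h ^ 2 * ‖fullCoeff a f h‖ ^ 2 ≤
      (2 * a) ^ d * ∑ u, ‖fullCoeff a (mixedDeriv (τ u) f) h‖ ^ 2 := by
    intro h
    -- Differentiating α times in exactly the variables where h is nonzero reproduces r(h), up to a
    -- factor 2a per zero component. As u depends on h, the bound sums over all 2^d subsets. Bessel
    -- contributes the second (2a)^d.
    set u := Finset.univ.filter fun j => h j ≠ 0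
    have h1 := fullCoeff_mixedDeriv ha hγ hf hA h _ (τ u) rfl (hτ u)
    have h2 : rBox α a h ^ 2 ≤ (2 * a) ^ d * ‖∏ j, (Complex.I * Real.pi * h j / a) ^ τ u j‖ ^ 2 := by
      rw [rBox_eq_prod, norm_prod, ← Finset.prod_pow, ← Finset.prod_pow,
        show (2 * a) ^ d = ∏ _j : Fin d, (2 * a) by simp, ← Finset.prod_mul_distrib]
      refine Finset.prod_le_prod (fun j _ => sq_nonneg _) fun j _ => ?_
      unfold rBoxFactor
      split_ifs with hj
      · rw [Real.sq_sqrt (by positivity)]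
        simp [τ, u, hj]
      · have : τ u j = α := by simp [τ, u, hj]
        rw [this, norm_pow]
        have e : ‖Complex.I * Real.pi * h j / a‖ = |Real.pi * h j / a| := by
          rw [norm_div, norm_mul, norm_mul, Complex.norm_I, one_mul, Complex.norm_real,
            Complex.norm_real, Complex.norm_intCast, abs_div, abs_mul]
          simp
        rw [e]
        exact le_mul_of_one_le_left (by positivity) ha
    calc rBox α a h ^ 2 * ‖fullCoeff a f h‖ ^ 2
        ≤ (2 * a) ^ d * ‖∏ j, (Complex.I * Real.pi * h j / a) ^ τ u j‖ ^ 2 *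
          ‖fullCoeff a f h‖ ^ 2 := by gcongr
      _ = (2 * a) ^ d * ‖fullCoeff a (mixedDeriv (τ u) f) h‖ ^ 2 := by
        rw [h1, norm_mul, mul_pow _ ‖fullCoeff a f h‖, mul_assoc]
      _ ≤ _ := by
        gcongr
        exact Finset.single_le_sum (f := fun u => ‖fullCoeff a (mixedDeriv (τ u) f) h‖ ^ 2)
          (fun _ _ => sq_nonneg _) (Finset.mem_univ u)
  have hs : Summable fun h => (2 * a) ^ d * ∑ u, ‖fullCoeff a (mixedDeriv (τ u) f) h‖ ^ 2 :=
    (summable_sum fun u _ => (bes u).1).mul_left _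
  have hs' := Summable.of_nonneg_of_le (fun h => by positivity) hpt hs
  refine ⟨hs', (hs'.tsum_le_tsum hpt hs).trans ?_⟩
  rw [tsum_mul_left, Summable.tsum_finsetSum fun u _ => (bes u).1]
  calc (2 * a) ^ d * ∑ u, ∑' h, ‖fullCoeff a (mixedDeriv (τ u) f) h‖ ^ 2
      ≤ (2 * a) ^ d * ∑ _u : Finset (Fin d),
          A ^ 2 * (latticeDecay d γ).toReal ^ 2 * (2 * a) ^ d := by
        gcongr with u
        exact (bes u).2
    _ = _ := by
      rw [Finset.sum_const, Finset.card_univ, Fintype.card_finset, Fintype.card_fin, nsmul_eq_mul]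
      push_cast
      ring

/-! ### The risk of the estimator -/

lemma integral_decayWeight_le (d : ℕ) {γ : ℝ} (hγ : 0 < γ) :
    ∫ x : Fin d → ℝ, decayWeight γ x ≤ (latticeDecay d γ).toReal := by
  have h := integral_decayWeight_mul_le (d := d) (a := 1 / 2) (by norm_num) hγ (F := fun _ => 1)
    continuous_const (fun _ => zero_le_one) (fun _ _ => rfl)
  simp only [mul_one] at h
  rw [setIntegral_const, Measure.real, volume_box (by norm_num)] at h
  simpa using h

/-- The whole-space coefficient of f also contains the mass folded back from outside the box. The
last term is this wrap-around error. -/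
lemma fourierCoeffBox_sub_fullCoeff {d : ℕ} {a γ A : ℝ} (ha : 1 ≤ 2 * a) (hγ : 0 < γ)
    {f : (Fin d → ℝ) → ℝ} (hf : Continuous f) (hA : ∀ x, |f x| ≤ A * decayWeight γ x)
    {g : (Fin d → ℝ) → ℝ} (hg : Continuous g) (h : Fin d → ℤ) :
    fourierCoeffBox a (fun x => g x - f x) h
      = (fourierCoeffBox a g h - fullCoeff a f h) + fullCoeff a ((box d a)ᶜ.indicator f) h := by
  have hi : ∀ v : (Fin d → ℝ) → ℝ, Continuous v → IntegrableOn
      (fun x => (v x : ℂ) * (starRingEnd ℂ) (trig a h x)) (box d a) := fun v hv =>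
    ((Complex.continuous_ofReal.comp hv).mul (trig_continuous a h).star).continuousOn.integrableOn_compact
      (isCompact_box d a)
  have hfull : Integrable fun x => (f x : ℂ) * (starRingEnd ℂ) (trig a h x) :=
    integrable_mul_of_decay hγ hf.measurable hA (trig_continuous a h).star (B := 1)
      fun x => by rw [RCLike.norm_conj]; exact norm_trig_le_one ha h x
  have e1 : fullCoeff a ((box d a)ᶜ.indicator f) h
      = ∫ x in (box d a)ᶜ, (f x : ℂ) * (starRingEnd ℂ) (trig a h x) := by
    rw [fullCoeff, ← integral_indicator (measurableSet_box d a).compl]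
    congr 1
    ext x
    by_cases hx : x ∈ (box d a)ᶜ <;> simp [hx]
  have e2 : fullCoeff a f h = fourierCoeffBox a f h
      + ∫ x in (box d a)ᶜ, (f x : ℂ) * (starRingEnd ℂ) (trig a h x) :=
    (integral_add_compl (measurableSet_box d a) hfull).symm
  have e3 : fourierCoeffBox a (fun x => g x - f x) h
      = fourierCoeffBox a g h - fourierCoeffBox a f h := by
    rw [fourierCoeffBox, fourierCoeffBox, fourierCoeffBox, ← integral_sub (hi g hg) (hi f hf)]
    simp only [Complex.ofReal_sub, sub_mul]
  rw [e1, e2, e3]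
  ring

/-- The error of the clipped estimator in terms of the errors of the coefficients. -/
lemma lintegral_clip_sub_sq_le {d : ℕ} {a γ A γ' A' : ℝ} (ha : 1 ≤ 2 * a)
    (hγ : 0 < γ) (hγ' : 0 < γ') (hA' : 0 < A') {f : (Fin d → ℝ) → ℝ} (hf0 : ∀ x, 0 ≤ f x)
    (hf : Continuous f) (hA : ∀ x, |f x| ≤ A * decayWeight γ x)
    (htail : ∀ x ∉ box d a, |f x| ≤ A' * decayWeight γ' x)
    {g : (Fin d → ℝ) → ℝ} (hg : Continuous g)
    (hs : Summable fun h => ‖fourierCoeffBox a g h - fullCoeff a f h‖ ^ 2) :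
    ∫⁻ x, ENNReal.ofReal ((clip a g x - f x) ^ 2) ≤
      ENNReal.ofReal (2 * ∑' h, ‖fourierCoeffBox a g h - fullCoeff a f h‖ ^ 2 +
        A' ^ 2 * (2 * (latticeDecay d γ').toReal ^ 2 * (2 * a) ^ d + (latticeDecay d γ').toReal)) := by
  have ha0 : 0 < a := by linarith
  set L := (latticeDecay d γ').toReal
  set G := (box d a)ᶜ.indicator f
  have hGm : Measurable G := hf.measurable.indicator (measurableSet_box d a).compl
  have hGA : ∀ x, |G x| ≤ A' * decayWeight γ' x := by
    intro x
    by_cases hx : x ∈ box d a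
    · rw [show G x = 0 by simp [G, hx], abs_zero]
      exact mul_nonneg hA'.le (decayWeight_pos _ _).le
    · rw [show G x = f x by simp [G, hx]]
      exact htail x hx
  have bes := tsum_norm_fullCoeff_sq_le ha hγ' hA' hGm hGA
  have hmem : MemLp (fun x => g x - f x) 2 (volume.restrict (box d a)) :=
    memLp_box_of_continuous (hg.sub hf)
  have hpar := hasSum_norm_fourierCoeffBox_sq ha0 hmem
  have hbox : ∫ x in box d a, (g x - f x) ^ 2 ≤
      2 * ∑' h, ‖fourierCoeffBox a g h - fullCoeff a f h‖ ^ 2 + 2 * (A' ^ 2 * L ^ 2 * (2 * a) ^ d) := by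
    have hle : ∀ h, ‖fourierCoeffBox a (fun x => g x - f x) h‖ ^ 2 ≤
        2 * ‖fourierCoeffBox a g h - fullCoeff a f h‖ ^ 2 + 2 * ‖fullCoeff a G h‖ ^ 2 := by
      intro h
      rw [fourierCoeffBox_sub_fullCoeff ha hγ hf hA hg h]
      set u := fourierCoeffBox a g h - fullCoeff a f h
      calc ‖u + fullCoeff a G h‖ ^ 2 ≤ (‖u‖ + ‖fullCoeff a G h‖) ^ 2 := by
            gcongr; exact norm_add_le _ _
        _ ≤ _ := by nlinarith [sq_nonneg (‖u‖ - ‖fullCoeff a G h‖)]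
    rw [← hpar.tsum_eq]
    refine (hpar.summable.tsum_le_tsum hle ((hs.mul_left 2).add (bes.1.mul_left 2))).trans ?_
    rw [Summable.tsum_add (hs.mul_left 2) (bes.1.mul_left 2), tsum_mul_left, tsum_mul_left]
    linarith [bes.2]
  have p1 : ∫⁻ x in box d a, ENNReal.ofReal ((clip a g x - f x) ^ 2) ≤
      ENNReal.ofReal (∫ x in box d a, (g x - f x) ^ 2) := by
    rw [ofReal_integral_eq_lintegral_ofReal]
    · refine setLIntegral_mono (by fun_prop) fun x hx => ENNReal.ofReal_le_ofReal ?_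
      rw [clip, if_pos hx, sq_le_sq]
      -- Clipping is 1-Lipschitz and leaves the nonnegative f unchanged.
      have := abs_max_sub_max_le_abs (g x) (f x) 0
      rwa [max_eq_left (hf0 x)] at this
    · exact ((hg.sub hf).pow 2).continuousOn.integrableOn_compact (isCompact_box d a)
    · exact Filter.Eventually.of_forall fun x => sq_nonneg _
  have p2 : ∫⁻ x in (box d a)ᶜ, ENNReal.ofReal ((clip a g x - f x) ^ 2) ≤
      ENNReal.ofReal (A' ^ 2 * L) := by
    have hw : Integrable fun x : Fin d → ℝ => A' ^ 2 * decayWeight γ' x :=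
      (integrable_decayWeight d hγ').const_mul _
    calc _ ≤ ∫⁻ x in (box d a)ᶜ, ENNReal.ofReal (A' ^ 2 * decayWeight γ' x) := by
          refine setLIntegral_mono
            ((decayWeight_continuous γ').measurable.const_mul _).ennreal_ofReal
            fun x hx => ENNReal.ofReal_le_ofReal ?_
          rw [clip, if_neg hx, zero_sub, neg_sq, ← sq_abs]
          have h1 := htail x hx
          have h2 := decayWeight_le_one hγ'.le x
          have h3 := decayWeight_pos γ' x
          calc |f x| ^ 2 ≤ (A' * decayWeight γ' x) ^ 2 := by gcongr
            _ = A' ^ 2 * (decayWeight γ' x * decayWeight γ' x) := by ring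
            _ ≤ A' ^ 2 * decayWeight γ' x := by
              gcongr
              exact mul_le_of_le_one_left h3.le h2
      _ ≤ ∫⁻ x, ENNReal.ofReal (A' ^ 2 * decayWeight γ' x) := setLIntegral_le_lintegral _ _
      _ = ENNReal.ofReal (∫ x : Fin d → ℝ, A' ^ 2 * decayWeight γ' x) :=
        (ofReal_integral_eq_lintegral_ofReal hw (Filter.Eventually.of_forall fun x =>
          mul_nonneg (sq_nonneg _) (decayWeight_pos _ _).le)).symm
      _ ≤ _ := by
        rw [integral_const_mul]
        gcongr
        exact integral_decayWeight_le d hγ'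
  rw [← lintegral_add_compl _ (measurableSet_box d a)]
  refine (add_le_add (p1.trans (ENNReal.ofReal_le_ofReal hbox)) p2).trans ?_
  rw [← ENNReal.ofReal_add]
  · exact ENNReal.ofReal_le_ofReal (by linarith)
  · have : 0 ≤ ∑' h, ‖fourierCoeffBox a g h - fullCoeff a f h‖ ^ 2 := tsum_nonneg fun _ => sq_nonneg _
    positivity
  · positivity

lemma latticeCriterion_nonneg {s : ℕ} (α N : ℕ) (z : Fin s → ℕ) : 0 ≤ latticeCriterion α N z :=
  tsum_nonneg fun h => mul_nonneg (inv_nonneg.2 (rUnitSq_pos α h).le) (latticeInner_nonneg α _ h)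

/-- The mean integrated squared error of the estimator, for arbitrary parameters. -/
theorem exists_estimator_risk_le {d α M : ℕ} (hα : 1 ≤ α) (hM : 1 ≤ M) {a : ℝ} (ha : 1 ≤ 2 * a)
    {N : ℕ} (hN : 1 ≤ N) (z : Fin d → ℕ) {lam : ℝ} (hl : 0 < lam)
    {γ A γ' A' : ℝ} (hγ : 0 < γ) (hA0 : 0 < A) (hγ' : 0 < γ') (hA0' : 0 < A')
    {f : (Fin d → ℝ) → ℝ} (hf0 : ∀ x, 0 ≤ f x) (hf : HasContMixedDerivs α f)
    (hA : MixedDecay α A γ f) (htail : ∀ x ∉ box d a, |f x| ≤ A' * decayWeight γ' x)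
    {Ω : Type*} [MeasurableSpace Ω] {P : Measure Ω} [IsProbabilityMeasure P]
    {Y : Fin M → Ω → Fin d → ℝ} (hY : ∀ m, Measurable (Y m)) (hind : iIndepFun Y P)
    (hlaw : ∀ m, P.map (Y m) = volume.withDensity (fun x => ENNReal.ofReal (f x)))
    {B : ℝ} (hB : 0 < B) :
    ∃ g : Ω → (Fin d → ℝ) → ℝ,
      (∀ ω v, IsRidgeSolution α a lam N z (fun m => wrap a (Y m ω)) v ↔ v = g ω) ∧
      ∫⁻ ω, ∫⁻ x, ENNReal.ofReal ((clip a (g ω) x - f x) ^ 2) ∂volume ∂P ≤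
        ENNReal.ofReal (8 * (1 / (M : ℝ) * ∑' h : Fin d → ℤ, (ridgeWeight α a lam h)⁻¹) +
          ((24 * lam + 16 * ((2 * a) ^ (2 * α * d) * (B⁻¹ + B * latticeCriterion α N z))) *
            (2 ^ d * (A ^ 2 * (latticeDecay d γ).toReal ^ 2) * (2 * a) ^ (2 * d)) +
          A' ^ 2 * (2 * (latticeDecay d γ').toReal ^ 2 * (2 * a) ^ d +
            (latticeDecay d γ').toReal))) := by
  have hfc : Continuous f := by
    have := (hf 0 fun j => Nat.zero_le _).1
    rwa [mixedDeriv_zero] at this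
  have hfA : ∀ x, |f x| ≤ A * decayWeight γ x := by
    have := hA 0 fun j => Nat.zero_le _
    rwa [mixedDeriv_zero] at this
  have hK := tsum_rBox_mul_norm_fullCoeff_le ha hγ hA0 hf hA
  choose g hg1 hg2 hg3 hg4 hg5 using fun ω =>
    exists_ridgeSolution hα ha hN z hl hK.1 (fullCoeff_neg a f) hB (fun m => Y m ω)
  refine ⟨g, hg1, ?_⟩
  set V : Ω → ℝ := fun ω => ∑' h, (ridgeWeight α a lam h)⁻¹ *
    ‖empCoeff a (fun m => Y m ω) h - fullCoeff a f h‖ ^ 2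
  have hV0 : ∀ ω, 0 ≤ V ω := fun ω => tsum_nonneg fun h =>
    mul_nonneg (inv_pos.2 (ridgeWeight_pos hl h)).le (sq_nonneg _)
  set Q := (24 * lam + 16 * ((2 * a) ^ (2 * α * d) * (B⁻¹ + B * latticeCriterion α N z))) *
            (2 ^ d * (A ^ 2 * (latticeDecay d γ).toReal ^ 2) * (2 * a) ^ (2 * d)) +
          A' ^ 2 * (2 * (latticeDecay d γ').toReal ^ 2 * (2 * a) ^ d + (latticeDecay d γ').toReal)
  have hS := latticeCriterion_nonneg α N z
  have hQ0 : 0 ≤ Q := by positivity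
  have hpt : ∀ ω, ∫⁻ x, ENNReal.ofReal ((clip a (g ω) x - f x) ^ 2) ≤
      8 * ENNReal.ofReal (V ω) + ENNReal.ofReal Q := by
    intro ω
    refine (lintegral_clip_sub_sq_le ha hγ hγ' hA0' hf0 hfc hfA htail
      ((hg2 ω).continuous hα ha) (hg3 ω)).trans ?_
    rw [show (8 : ℝ≥0∞) = ENNReal.ofReal 8 by simp, ← ENNReal.ofReal_mul (by norm_num),
      ← ENNReal.ofReal_add (mul_nonneg (by norm_num) (hV0 ω)) hQ0]
    refine ENNReal.ofReal_le_ofReal ?_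
    -- The factor 2 from `lintegral_clip_sub_sq_le` doubles the constants 4, 12, 8 to 8, 24, 16.
    have h1 := hg5 ω
    have h2 : (12 * lam + 8 * ((2 * a) ^ (2 * α * d) * (B⁻¹ + B * latticeCriterion α N z))) *
        ∑' h, rBox α a h ^ 2 * ‖fullCoeff a f h‖ ^ 2 ≤
        (12 * lam + 8 * ((2 * a) ^ (2 * α * d) * (B⁻¹ + B * latticeCriterion α N z))) *
          (2 ^ d * (A ^ 2 * (latticeDecay d γ).toReal ^ 2) * (2 * a) ^ (2 * d)) :=
      mul_le_mul_of_nonneg_left hK.2 (by positivity)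
    simp only [V, Q]
    linarith
  -- Monotonicity of the lower integral needs no measurability, so how g depends on ω need not be
  -- examined.
  calc _ ≤ ∫⁻ ω, (8 * ENNReal.ofReal (V ω) + ENNReal.ofReal Q) ∂P := lintegral_mono hpt
    _ = 8 * ∫⁻ ω, ENNReal.ofReal (V ω) ∂P + ENNReal.ofReal Q := by
      rw [lintegral_add_right _ measurable_const, lintegral_const_mul' _ _ (by simp)]
      simp
    _ ≤ 8 * ENNReal.ofReal (1 / (M : ℝ) * ∑' h : Fin d → ℤ, (ridgeWeight α a lam h)⁻¹)
        + ENNReal.ofReal Q := by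
      refine add_le_add (mul_le_mul_right ?_ _) le_rfl
      exact lintegral_tsum_empCoeff_le hα hM ha hl hf0 hfc.measurable hY hind hlaw hg4
    _ = _ := by
      have : 0 ≤ 1 / (M : ℝ) * ∑' h : Fin d → ℤ, (ridgeWeight α a lam h)⁻¹ :=
        mul_nonneg (by positivity) (tsum_nonneg fun h => (inv_pos.2 (ridgeWeight_pos hl h)).le)
      rw [show (8 : ℝ≥0∞) = ENNReal.ofReal 8 by simp, ← ENNReal.ofReal_mul (by norm_num),
        ← ENNReal.ofReal_add (by positivity) hQ0]

/-! ### The choice of the parameters -/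

/-- The hypothesis is calibrated to a^q ≥ 2^(-q), that is 2a ≥ 1, through 2^(1-q)β = 2β · 2^(-q). -/
lemma inv_mul_log_nonneg {β q η x : ℝ} (hβ : 0 < β) (hη : 0 < η)
    (hx : Real.exp ((2 : ℝ) ^ (1 - q) * β) / η ≤ x) :
    (2 : ℝ) ^ (-q) ≤ 1 / (2 * β) * Real.log (η * x) := by
  have h1 : Real.exp ((2 : ℝ) ^ (1 - q) * β) ≤ η * x := by
    rw [div_le_iff₀ hη] at hx; linarith
  have h2 := (Real.le_log_iff_exp_le ((Real.exp_pos _).trans_le h1)).2 h1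
  have h3 : (2 : ℝ) ^ (1 - q) = 2 * 2 ^ (-q) := by
    rw [sub_eq_add_neg, Real.rpow_add two_pos, Real.rpow_one]
  rw [h3] at h2
  rw [one_div, ← div_eq_inv_mul, le_div_iff₀ (by positivity)]
  linarith

lemma half_le_radius {β q η x : ℝ} (hβ : 0 < β) (hq : 1 ≤ q) (hη : 0 < η)
    (hx : Real.exp ((2 : ℝ) ^ (1 - q) * β) / η ≤ x) :
    1 / 2 ≤ (1 / (2 * β) * Real.log (η * x)) ^ (1 / q) := by
  have hq0 : q ≠ 0 := by positivity
  calc (1 / 2 : ℝ) = ((2 : ℝ) ^ (-q)) ^ (1 / q) := by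
        rw [← Real.rpow_mul two_pos.le, show -q * (1 / q) = -1 by field_simp, Real.rpow_neg_one]
        norm_num
    _ ≤ _ := Real.rpow_le_rpow (by positivity) (inv_mul_log_nonneg hβ hη hx) (by positivity)

/-- For x ≥ 2 the term log η is absorbed into log x, since |log η| ≤ (|log η| / log 2) log x. -/
lemma exists_radius_le {β q η : ℝ} (hβ : 0 < β) (hq : 1 ≤ q) (hη : 0 < η) :
    ∃ C : ℝ, 0 < C ∧ ∀ x : ℝ, 2 ≤ x → Real.exp ((2 : ℝ) ^ (1 - q) * β) / η ≤ x →
      2 * (1 / (2 * β) * Real.log (η * x)) ^ (1 / q) ≤ C * Real.log x ^ (1 / q) := by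
  have hl2 : 0 < Real.log 2 := Real.log_pos (by norm_num)
  set L := |Real.log η| / Real.log 2 + 1
  have hL : 0 < L := by positivity
  refine ⟨2 * (1 / (2 * β) * L) ^ (1 / q), by positivity, fun x hx2 hx => ?_⟩
  have hlx : Real.log 2 ≤ Real.log x := Real.log_le_log two_pos hx2
  have h1 : Real.log (η * x) ≤ L * Real.log x := by
    rw [Real.log_mul hη.ne' (by positivity)]
    have h2 : |Real.log η| ≤ |Real.log η| / Real.log 2 * Real.log x := by
      rw [div_mul_eq_mul_div, le_div_iff₀ hl2]
      exact mul_le_mul_of_nonneg_left hlx (abs_nonneg _)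
    have := le_abs_self (Real.log η)
    simp only [L, add_mul, one_mul]
    linarith
  have h0 : 0 ≤ 1 / (2 * β) * Real.log (η * x) :=
    (Real.rpow_nonneg two_pos.le _).trans (inv_mul_log_nonneg hβ hη hx)
  rw [mul_assoc, ← Real.mul_rpow (by positivity) (by linarith)]
  refine mul_le_mul_of_nonneg_left (Real.rpow_le_rpow h0 ?_ (by positivity)) two_pos.le
  rw [mul_assoc]
  exact mul_le_mul_of_nonneg_left h1 (by positivity)

/-- The factor 1/(2β) in the radius is made for squared tails: 2βρ a^q = ρ log(ηx). -/
lemma sq_exp_neg_radius {β q η x ρ : ℝ} (hβ : 0 < β) (hq : 1 ≤ q) (hη : 0 < η) (hx0 : 0 < x)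
    (hx : Real.exp ((2 : ℝ) ^ (1 - q) * β) / η ≤ x) :
    Real.exp (-(β * ρ * ((1 / (2 * β) * Real.log (η * x)) ^ (1 / q)) ^ q)) ^ 2 =
      η ^ (-ρ) * x ^ (-ρ) := by
  have h0 : 0 ≤ 1 / (2 * β) * Real.log (η * x) :=
    (Real.rpow_nonneg two_pos.le _).trans (inv_mul_log_nonneg hβ hη hx)
  rw [← Real.rpow_mul h0, one_div_mul_cancel (by positivity), Real.rpow_one,
    ← Real.mul_rpow hη.le hx0.le, Real.rpow_def_of_pos (by positivity), ← Real.exp_nat_mul]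
  congr 1
  push_cast
  field_simp

lemma sub_pos_of_lt_two_sub {α : ℕ} (hα : 1 ≤ α) {ε : ℝ} (hε' : ε < 2 - 1 / (α : ℝ)) :
    0 < (α : ℝ) - ε := by
  have hα0 : (0 : ℝ) < α := by exact_mod_cast hα
  have : 2 ≤ (α : ℝ) + 1 / α := by
    rw [← sub_nonneg, show (α : ℝ) + 1 / α - 2 = (α - 1) ^ 2 / α by field_simp; ring]
    positivity
  linarith

/-- With a criterion of order N^(-r), the cutoff B = N^(r/2) balances the two terms. The choice r =
max(1, 2δ) with δ = α − ε keeps 1 ≤ r < 2α, as t = 1/r requires, and r/2 ≥ δ makes the result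
O(1/x). -/
lemma exists_aliasing_factor_le (d : ℕ) {α : ℕ} (hα : 1 ≤ α) {ε c : ℝ} (hε : 0 < ε)
    (hε' : ε < 2 - 1 / (α : ℝ)) (hc : 0 < c) :
    ∃ C : ℝ, 0 < C ∧ ∀ (x : ℝ) (N : ℕ) (z : Fin d → ℕ), 0 < x → N.Prime →
      c * x ^ (1 / ((α : ℝ) - ε)) ≤ (N : ℝ) → IsCBCVector α N z →
      ∃ B : ℝ, 0 < B ∧ B⁻¹ + B * latticeCriterion α N z ≤ C * x⁻¹ := by
  have hα1 : (1 : ℝ) ≤ α := by exact_mod_cast hα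
  have hδ := sub_pos_of_lt_two_sub hα hε'
  set δ := (α : ℝ) - ε
  set r := max 1 (2 * δ)
  have hr1 : 1 ≤ r := le_max_left _ _
  have hr2 : 2 * δ ≤ r := le_max_right _ _
  have hr3 : r < 2 * α := max_lt (by linarith) (by simp only [δ]; linarith)
  have hr0 : 0 < r := by linarith
  obtain ⟨C, hC0, hC⟩ := exists_latticeCriterion_le d hα (t := 1 / r) (by positivity)
    (by rw [div_le_one hr0]; exact hr1) (by rw [mul_one_div, one_lt_div hr0]; exact hr3)
  refine ⟨(1 + C) * c ^ (-δ), by positivity, fun x N z hx hN hNx hz => ?_⟩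
  have hN1 : (1 : ℝ) ≤ N := by exact_mod_cast hN.one_lt.le
  have hN0 : (0 : ℝ) < N := by linarith
  refine ⟨(N : ℝ) ^ (r / 2), by positivity, ?_⟩
  have h1 := hC N z hN hz
  rw [one_div_one_div] at h1
  calc ((N : ℝ) ^ (r / 2))⁻¹ + (N : ℝ) ^ (r / 2) * latticeCriterion α N z
      ≤ (N : ℝ) ^ (-(r / 2)) + (N : ℝ) ^ (r / 2) * (C * (N : ℝ) ^ (-r)) := by
        rw [← Real.rpow_neg hN0.le]
        gcongr
    _ = (1 + C) * (N : ℝ) ^ (-(r / 2)) := by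
        rw [mul_left_comm, ← Real.rpow_add hN0, show r / 2 + -r = -(r / 2) by ring]
        ring
    _ ≤ (1 + C) * (N : ℝ) ^ (-δ) :=
        mul_le_mul_of_nonneg_left (Real.rpow_le_rpow_of_exponent_le hN1 (by linarith))
          (by positivity)
    _ ≤ (1 + C) * (c * x ^ (1 / δ)) ^ (-δ) :=
        mul_le_mul_of_nonneg_left
          (Real.rpow_le_rpow_of_nonpos (by positivity) hNx (by linarith)) (by positivity)
    _ = (1 + C) * c ^ (-δ) * x⁻¹ := by
        rw [Real.mul_rpow hc.le (by positivity), ← Real.rpow_mul hx.le,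
          show 1 / δ * -δ = -1 by field_simp, Real.rpow_neg_one, mul_assoc]

/-- A density has mass one, so its decay constant cannot be small. This lets the variance term,
which carries no norm of f, be bounded by a multiple of the squared norm. -/
lemma one_le_mul_latticeDecay {d : ℕ} {γ A : ℝ} (hγ : 0 < γ) {f : (Fin d → ℝ) → ℝ}
    (hf : ∀ x, f x ≤ A * decayWeight γ x)
    (h : ∫⁻ x, ENNReal.ofReal (f x) = 1) : 1 ≤ A * (latticeDecay d γ).toReal := by
  have hA : 0 ≤ A := by
    by_contra! hA
    have : ∀ x, ENNReal.ofReal (f x) = 0 := fun x => ENNReal.ofReal_of_nonpos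
      ((hf x).trans (mul_nonpos_of_nonpos_of_nonneg hA.le (decayWeight_pos γ x).le))
    simp [this] at h
  have h1 : (1 : ℝ≥0∞) ≤ ENNReal.ofReal (∫ x : Fin d → ℝ, A * decayWeight γ x) := by
    rw [ofReal_integral_eq_lintegral_ofReal ((integrable_decayWeight d hγ).const_mul A)
      (.of_forall fun x => mul_nonneg hA (decayWeight_pos γ x).le), ← h]
    exact lintegral_mono fun x => ENNReal.ofReal_le_ofReal (hf x)
  rw [ENNReal.one_le_ofReal, integral_const_mul] at h1
  exact h1.trans (mul_le_mul_of_nonneg_left (integral_decayWeight_le d hγ) hA)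

lemma lintegral_density_eq_one {d : ℕ} {f : (Fin d → ℝ) → ℝ} {Ω : Type*} [MeasurableSpace Ω]
    {P : Measure Ω} [IsProbabilityMeasure P] {Y : Ω → Fin d → ℝ} (hY : Measurable Y)
    (hlaw : P.map Y = volume.withDensity (fun x => ENNReal.ofReal (f x))) :
    ∫⁻ x, ENNReal.ofReal (f x) = 1 := by
  have : IsProbabilityMeasure (P.map Y) := Measure.isProbabilityMeasure_map hY.aemeasurable
  have h := measure_univ (μ := P.map Y)
  rwa [hlaw, withDensity_apply _ MeasurableSet.univ, Measure.restrict_univ] at h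

/-- The balance of exponents: −1 + τ/(1 + τ) = −1/(1 + τ). -/
lemma variance_factor_le {c τ x lam : ℝ} (hc : 0 < c) (hτ : 0 < τ) (hx : 0 < x)
    (hl : c * x ^ (-(1 / (1 + τ))) ≤ lam) :
    1 / x * lam ^ (-τ) ≤ c ^ (-τ) * x ^ (-(1 / (1 + τ))) := by
  have h1 : lam ^ (-τ) ≤ (c * x ^ (-(1 / (1 + τ)))) ^ (-τ) :=
    Real.rpow_le_rpow_of_nonpos (by positivity) hl (by linarith)
  calc 1 / x * lam ^ (-τ) ≤ x ^ (-1 : ℝ) * (c * x ^ (-(1 / (1 + τ)))) ^ (-τ) := by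
        rw [Real.rpow_neg_one, ← one_div]
        exact mul_le_mul_of_nonneg_left h1 (by positivity)
    _ = c ^ (-τ) * x ^ (-(1 / (1 + τ))) := by
        rw [Real.mul_rpow hc.le (by positivity), ← Real.rpow_mul hx.le, mul_left_comm,
          ← Real.rpow_add hx]
        congr 2
        field_simp
        ring

/-- Pure algebra, used with s = 2a and μ = M^(-ρ). Every term is raised to the common size D²
s^(2(α+1)d) μ, the variance by inserting (AL)² ≥ 1. The exponent is 2αd + 2d, from the weight
comparison and the Korobov norm. -/
lemma risk_bound_le {d α : ℕ} {s V lam Bf A A' L L' D E H v l b μ : ℝ}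
    (hs : 1 ≤ s) (hμ : 0 ≤ μ) (hv : 0 ≤ v) (hl : 0 ≤ l)
    (hV : V ≤ v * μ * s ^ (2 * α * d)) (hlam : lam ≤ l * μ) (hB : Bf ≤ b * μ)
    (hA : A = D * E) (hX : 1 ≤ A * L) (hA' : A' ^ 2 = D ^ 2 * E ^ 2 * (H * μ))
    (hL' : 0 ≤ L') :
    8 * V + ((24 * lam + 16 * (s ^ (2 * α * d) * Bf)) * (2 ^ d * (A ^ 2 * L ^ 2) * s ^ (2 * d)) +
      A' ^ 2 * (2 * L' ^ 2 * s ^ d + L')) ≤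
      (8 * v * (E * L) ^ 2 + (24 * l + 16 * b) * (2 ^ d * (E * L) ^ 2) +
        E ^ 2 * H * (2 * L' ^ 2 + L')) * (D ^ 2 * s ^ (2 * (α + 1) * d) * μ) := by
  set Q := s ^ (2 * (α + 1) * d)
  have hs0 : 0 ≤ s := by linarith
  have hQ1 : 1 ≤ Q := one_le_pow₀ hs
  have hQd : s ^ d ≤ Q := pow_le_pow_right₀ hs (by nlinarith)
  have hQ2d : s ^ (2 * d) ≤ Q := pow_le_pow_right₀ hs (by nlinarith)
  have hQα : s ^ (2 * α * d) ≤ Q := pow_le_pow_right₀ hs (by nlinarith)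
  have hQm : s ^ (2 * α * d) * s ^ (2 * d) = Q := by rw [← pow_add]; congr 1; ring
  have hAL : 1 ≤ (A * L) ^ 2 := one_le_pow₀ hX
  have hAL' : (A * L) ^ 2 = D ^ 2 * (E * L) ^ 2 := by rw [hA]; ring
  have e1 : V ≤ v * μ * (Q * (D ^ 2 * (E * L) ^ 2)) := by
    refine hV.trans (mul_le_mul_of_nonneg_left ?_ (mul_nonneg hv hμ))
    rw [← hAL']
    nlinarith
  have e2 : lam * s ^ (2 * d) ≤ l * μ * Q :=
    (mul_le_mul_of_nonneg_right hlam (by positivity)).trans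
      (mul_le_mul_of_nonneg_left hQ2d (mul_nonneg hl hμ))
  have e3 : Bf * Q ≤ b * μ * Q := mul_le_mul_of_nonneg_right hB (by linarith)
  have e4 : 2 * L' ^ 2 * s ^ d + L' ≤ (2 * L' ^ 2 + L') * Q := by nlinarith [sq_nonneg L']
  have e5 : A' ^ 2 * (2 * L' ^ 2 * s ^ d + L') ≤
      D ^ 2 * E ^ 2 * (H * μ) * ((2 * L' ^ 2 + L') * Q) := by
    rw [← hA']
    exact mul_le_mul_of_nonneg_left e4 (sq_nonneg _)
  have e6 : (24 * lam + 16 * (s ^ (2 * α * d) * Bf)) * (2 ^ d * (A ^ 2 * L ^ 2) * s ^ (2 * d)) ≤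
      (24 * (l * μ * Q) + 16 * (b * μ * Q)) * (2 ^ d * (D ^ 2 * (E * L) ^ 2)) := by
    rw [← hAL', ← mul_pow, show (24 * lam + 16 * (s ^ (2 * α * d) * Bf)) *
      (2 ^ d * (A * L) ^ 2 * s ^ (2 * d)) = (24 * (lam * s ^ (2 * d)) +
        16 * (Bf * (s ^ (2 * α * d) * s ^ (2 * d)))) * (2 ^ d * (A * L) ^ 2) by ring, hQm]
    gcongr
  nlinarith

end PSKK

end

/-! ### Assembly of the error terms. -/

theorem theorem4p8 (d α : ℕ) (hd : 1 ≤ d) (hα : 1 ≤ α) (β q η ε : ℝ) (hβ : 0 < β) (hq : 1 ≤ q)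
    (hη : 0 < η) (hε : 0 < ε) (hε' : ε < 2 - 1 / (α : ℝ))
    (c₁ c₂ c₃ c₄ : ℝ) (hc₁ : 0 < c₁) (hc₂ : c₁ ≤ c₂) (hc₃ : 0 < c₃) (hc₄ : c₃ ≤ c₄) :
    ∃ C : ℝ, 0 < C ∧
      ∀ (p : ℝ≥0∞), 1 ≤ p →
      ∀ (f : (Fin d → ℝ) → ℝ), (∀ x, 0 ≤ f x) → PSKK.MemS α β p q f →
      ∀ (Ω : Type*) [MeasurableSpace Ω] (P : Measure Ω) [IsProbabilityMeasure P]
        (M : ℕ) (Y : Fin M → Ω → Fin d → ℝ),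
        (∀ m, Measurable (Y m)) → iIndepFun Y P →
        (∀ m, P.map (Y m) = volume.withDensity (fun x => ENNReal.ofReal (f x))) →
        2 ≤ M →
        max (Real.exp 2 / η) (Real.exp ((2 : ℝ) ^ (1 - q) * β) / η) ≤ (M : ℝ) →
      ∀ (τ a lam : ℝ) (N : ℕ) (z : Fin d → ℕ),
        τ = 1 / (2 * (α : ℝ)) + ε / 2 →
        a = (1 / (2 * β) * Real.log (η * (M : ℝ))) ^ (1 / q) →
        c₁ * (M : ℝ) ^ (-(1 / (1 + τ))) ≤ lam → lam ≤ c₂ * (M : ℝ) ^ (-(1 / (1 + τ))) →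
        N.Prime →
        c₃ * (M : ℝ) ^ (1 / ((α : ℝ) - ε)) ≤ (N : ℝ) →
        (N : ℝ) ≤ c₄ * (M : ℝ) ^ (1 / ((α : ℝ) - ε)) →
        PSKK.IsCBCVector α N z →
        ∃ g : Ω → (Fin d → ℝ) → ℝ,
          (∀ ω v, PSKK.IsRidgeSolution α a lam N z (fun m => PSKK.wrap a (Y m ω)) v ↔ v = g ω) ∧
          ∫⁻ ω, ∫⁻ x, ENNReal.ofReal ((PSKK.clip a (g ω) x - f x) ^ 2) ∂volume ∂P ≤
            ENNReal.ofReal C * PSKK.maxNorm α β p q f ^ 2 *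
              ENNReal.ofReal (|Real.log (M : ℝ)| ^ (2 * ((α : ℝ) + 1) * (d : ℝ) / q) *
                (M : ℝ) ^ (-(1 / (1 + 1 / (2 * (α : ℝ)) + ε / 2)))) := by
  have hα0 : (0 : ℝ) < α := by exact_mod_cast hα
  have hd0 : (0 : ℝ) < d := by exact_mod_cast hd
  set τ₀ : ℝ := 1 / (2 * (α : ℝ)) + ε / 2 with hτ₀
  have hτ0 : 0 < τ₀ := by positivity
  -- The condition ε < 2 − 1/α is equivalent to τ₀ < 1.
  have hτ1 : τ₀ ≤ 1 := by
    have : 1 / (2 * (α : ℝ)) = 1 / α / 2 := by field_simp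
    rw [hτ₀, this]; linarith
  have hατ : 1 < 2 * (α : ℝ) * τ₀ := by
    have : 2 * (α : ℝ) * τ₀ = 1 + α * ε := by rw [hτ₀]; field_simp
    rw [this]
    linarith [mul_pos hα0 hε]
  set ρ : ℝ := 1 / (1 + τ₀) with hρ
  have hρ0 : 0 < ρ := by positivity
  have hρ1 : ρ < 1 := by rw [hρ, div_lt_one (by linarith)]; linarith
  -- Two splittings of the exponential decay. The share θ = 0 keeps all of it for integrability. In
  -- the tail, the share θ = ρ yields M^(-ρ) after squaring, and 1 − ρ > 0 remains for
  -- integrability.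
  have hγ : 0 < β * (1 - 0) / d := by positivity
  have hγ' : 0 < β * (1 - ρ) / d := div_pos (mul_pos hβ (by linarith)) hd0
  set L := (PSKK.latticeDecay d (β * (1 - 0) / d)).toReal
  set L' := (PSKK.latticeDecay d (β * (1 - ρ) / d)).toReal
  have hL : 1 ≤ L := PSKK.one_le_latticeDecay d hγ
  have hL' : 1 ≤ L' := PSKK.one_le_latticeDecay d hγ'
  obtain ⟨v, hv0, hv⟩ := PSKK.exists_tsum_ridgeWeight_inv_le d hα hτ0 hτ1 hατ
  obtain ⟨b, hb0, hb⟩ := PSKK.exists_aliasing_factor_le d hα hε hε' hc₃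
  obtain ⟨k, hk0, hk⟩ := PSKK.exists_radius_le hβ hq hη
  have hc₂0 : 0 < c₂ := hc₁.trans_le hc₂
  set E := Real.exp β
  have hE : 0 < E := Real.exp_pos β
  set C₁ : ℝ := 8 * (v * c₁ ^ (-τ₀)) * (E * L) ^ 2 + (24 * c₂ + 16 * b) * (2 ^ d * (E * L) ^ 2) +
    E ^ 2 * η ^ (-ρ) * (2 * L' ^ 2 + L') with hC₁
  have hC₁0 : 0 < C₁ := by positivity
  refine ⟨C₁ * k ^ (2 * (α + 1) * d), by positivity, ?_⟩
  intro p hp f hf0 hf Ω _ P _ M Y hY hind hlaw hM2 hM τ a lam N z hτ ha hlam hlam' hN hN3 hN4 hz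
  have hM2' : (2 : ℝ) ≤ M := by exact_mod_cast hM2
  have hM0 : (0 : ℝ) < M := by linarith
  have hMβ := (le_max_right _ _).trans hM
  subst hτ
  have ha2 : 1 / 2 ≤ a := ha ▸ PSKK.half_le_radius hβ hq hη hMβ
  have ha1 : 1 ≤ 2 * a := by linarith
  set μ := (M : ℝ) ^ (-ρ) with hμ
  have hμ0 : 0 < μ := by positivity
  have hlam0 : 0 < lam := (mul_pos hc₁ hμ0).trans_le hlam
  set D := (PSKK.expDecayNorm α β p q f).toReal
  have hdecay : ∀ σ : Fin d → ℕ, (∀ j, σ j ≤ α) → ∀ θ b : ℝ, 0 ≤ θ → θ ≤ 1 → 0 ≤ b →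
      ∀ x, b ≤ PSKK.lpNorm p x → |PSKK.mixedDeriv σ f x| ≤
        D * (Real.exp (-(β * θ * b ^ q)) * E) * PSKK.decayWeight (β * (1 - θ) / d) x :=
    fun σ hσ θ b hθ hθ1 hb x hx => (PSKK.abs_mixedDeriv_le hf.expDecay hσ x).trans
      ((mul_le_mul_of_nonneg_left (PSKK.exp_neg_lpNorm_le hd hp hβ hq hθ hθ1 hb hx)
        ENNReal.toReal_nonneg).trans_eq (mul_assoc _ _ _).symm)
  have hmixed : PSKK.MixedDecay α (D * E) (β * (1 - 0) / d) f := fun σ hσ x => by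
    simpa using hdecay σ hσ 0 0 le_rfl zero_le_one le_rfl x (PSKK.lpNorm_nonneg hd hp x)
  have hX : 1 ≤ D * E * L := by
    refine PSKK.one_le_mul_latticeDecay hγ (f := f) (fun x => ?_)
      (PSKK.lintegral_density_eq_one (hY ⟨0, by omega⟩) (hlaw _))
    have := hmixed 0 (fun j => Nat.zero_le _) x
    rw [PSKK.mixedDeriv_zero] at this
    exact (le_abs_self _).trans this
  have hD : 0 < D := by
    refine lt_of_le_of_ne ENNReal.toReal_nonneg fun h => ?_
    rw [← h] at hX
    norm_num at hX
  have htail : ∀ x ∉ PSKK.box d a, |f x| ≤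
      D * (Real.exp (-(β * ρ * a ^ q)) * E) * PSKK.decayWeight (β * (1 - ρ) / d) x := fun x hx => by
    have := hdecay 0 (fun j => Nat.zero_le _) ρ a hρ0.le hρ1.le (by linarith) x
      (PSKK.lt_lpNorm_of_notMem_box hp hx).le
    rwa [PSKK.mixedDeriv_zero] at this
  obtain ⟨B, hB0, hB⟩ := hb M N z hM0 hN hN3 hz
  obtain ⟨g, hg, hrisk⟩ := PSKK.exists_estimator_risk_le hα (by omega : 1 ≤ M) ha1 hN.one_lt.le z
    hlam0 hγ (by positivity) hγ' (by positivity) hf0 hf.smooth hmixed htail hY hind hlaw hB0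
  refine ⟨g, hg, hrisk.trans ?_⟩
  have hvar : 1 / (M : ℝ) * ∑' h : Fin d → ℤ, (PSKK.ridgeWeight α a lam h)⁻¹ ≤
      v * c₁ ^ (-τ₀) * μ * (2 * a) ^ (2 * α * d) := by
    calc _ ≤ 1 / (M : ℝ) * (v * lam ^ (-τ₀) * (2 * a) ^ (2 * α * d)) :=
          mul_le_mul_of_nonneg_left (hv a lam ha1 hlam0) (by positivity)
      _ = v * (1 / (M : ℝ) * lam ^ (-τ₀)) * (2 * a) ^ (2 * α * d) := by ring
      _ ≤ v * (c₁ ^ (-τ₀) * μ) * (2 * a) ^ (2 * α * d) := by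
          have := PSKK.variance_factor_le hc₁ hτ0 hM0 hlam
          exact mul_le_mul_of_nonneg_right (mul_le_mul_of_nonneg_left this hv0.le) (by positivity)
      _ = _ := by ring
  -- The approximation error is even O(1/M), and M⁻¹ ≤ M^(-ρ) because ρ < 1.
  have hB' : B⁻¹ + B * PSKK.latticeCriterion α N z ≤ b * μ := by
    refine hB.trans (mul_le_mul_of_nonneg_left ?_ hb0.le)
    rw [← Real.rpow_neg_one]
    exact Real.rpow_le_rpow_of_exponent_le (by linarith) (by linarith)
  have htot := PSKK.risk_bound_le (d := d) (α := α) (A := D * E) (L := L) (L' := L') (H := η ^ (-ρ))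
    ha1 hμ0.le (by positivity) hc₂0.le hvar hlam' hB' rfl hX
    (A' := D * (Real.exp (-(β * ρ * a ^ q)) * E))
    (by rw [mul_pow, mul_pow, ha, PSKK.sq_exp_neg_radius hβ hq hη hM0 hMβ]; ring) (by linarith)
  have hlog : 0 < Real.log M := Real.log_pos (by linarith)
  have hQ : (2 * a) ^ (2 * (α + 1) * d) ≤ k ^ (2 * (α + 1) * d) *
      |Real.log M| ^ (2 * ((α : ℝ) + 1) * d / q) := by
    have h1 : 2 * a ≤ k * Real.log M ^ (1 / q) := ha ▸ hk M hM2' hMβ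
    refine (pow_le_pow_left₀ (by linarith) h1 _).trans_eq ?_
    rw [mul_pow, abs_of_pos hlog, ← Real.rpow_natCast (Real.log M ^ (1 / q)),
      ← Real.rpow_mul hlog.le]
    congr 2
    push_cast
    ring
  have hDmax : ENNReal.ofReal D ≤ PSKK.maxNorm α β p q f := by
    rw [ENNReal.ofReal_toReal hf.expDecay.ne]
    exact le_max_left _ _
  rw [show 1 / (1 + 1 / (2 * (α : ℝ)) + ε / 2) = ρ by rw [hρ, hτ₀, add_assoc]]
  calc _ ≤ ENNReal.ofReal (C₁ * k ^ (2 * (α + 1) * d) * D ^ 2 *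
        (|Real.log M| ^ (2 * ((α : ℝ) + 1) * d / q) * μ)) := by
        refine ENNReal.ofReal_le_ofReal (htot.trans ?_)
        calc _ ≤ C₁ * (D ^ 2 * (k ^ (2 * (α + 1) * d) *
              |Real.log M| ^ (2 * ((α : ℝ) + 1) * d / q)) * μ) := by
              rw [hC₁]; gcongr
          _ = _ := by ring
    _ = ENNReal.ofReal (C₁ * k ^ (2 * (α + 1) * d)) * ENNReal.ofReal D ^ 2 *
        ENNReal.ofReal (|Real.log M| ^ (2 * ((α : ℝ) + 1) * d / q) * μ) := by
        rw [ENNReal.ofReal_mul (by positivity), ENNReal.ofReal_mul (by positivity),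
          ENNReal.ofReal_pow hD.le]
    _ ≤ _ := by gcongr
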